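/- **Model.** Let $E$ be a standard Borel space, $\nu$ a $\sigma$-finite measure on $E$, $p\in[0,1]$, $q=1-p$, and let $\gamma(u,s)\ge 0$ and $\lambda_Q(u,s)>0$ be measurable on $E\times[0,\infty)$ such that $\nu_0(du\,ds)=\gamma(u,s)\,\nu(du)\,ds$ and $\nu_1(du\,ds)=\lambda_Q(u,s)\,\nu(du)\,ds$ are finite on $E\times[0,t]$ for every $t$. On a probability space $(\Omega,\mathcal F,Q)$ with a filtration $\{\mathcal F_t\}$ let $N$ and $C$ be independent Poisson random measures on $E\times[0,\infty)$ with mean measures $\nu_0$ and $\nu_1$, let $I_1,I_2,\dots$ be i.i.d. Bernoulli($p$) variables and $D_0$ a $\{0,1\}$-valued variable, such that $(N,C)$, $D_0$ and $(I_k)_k$ are independent. Let $(c_i,t_i)$ be the points of $C$ ("cluster events"), and let $D$ be the $\{0,1\}$-valued process that starts at $D_0$, is constant between cluster events, and at the $k$-th cluster event becomes $1$ if it was $0$, and $1-I_k$ if it was $1$. Assume that $N$, $C$ and $D$ are $\{\mathcal F_t\}$-adapted. Put $$\eta_t=\sum_{t_i\le t}\delta_{(c_i,t_i)},\qquad h_t=\delta_{(D_0,0)}+\sum_{t_i\le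 t}\delta_{(D_{t_i},t_i)},\qquad O=N+C,$$ and let $\mathcal F^O_t$ be the $\sigma$-algebra generated by the restriction of $O$ to $E\times[0,t]$. Let $\lambda(u,s,h,\eta)\ge 0$ be measurable, and let $L$ be an $\{\mathcal F_t\}$-martingale under $Q$ with a.s. càdlàg paths that satisfies a.s., for all $t$ (the integrals being assumed to exist), $$L(t)=1+\int_{E\times[0,t]}\Big(\frac{\lambda(u,s,h_{s-},\eta_{s-})}{\lambda_Q(u,s)}-1\Big)L(s-)\,[C(du\,ds)-\lambda_Q(u,s)\,\nu(du)\,ds].$$ **Filters.** The unnormalized filter is an $\{\mathcal F^O_t\}$-adapted process $\phi_t$ of finite measures on the space of pairs $(h,\eta)$, with $t\mapsto\phi_t(A)$ càdlàg for every measurable $A$, such that, with $\phi(f,t)=\int f\,d\phi_t$, $$\phi(f,t)=E^Q[f(h_t,\eta_t)L(t)\mid\mathcal F^O_t]\quad\text{a.s.}$$ for all $t$ and all measurable $f$ for which $f(h_t,\eta_t)L(t)$ is integrable. Put $\pi(f,t)=\phi(f,t)/\phi(1,t)$, and let $\phi(f,s-)$, $\pi(f,s-)$ be the left limits at $s$ of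 $r\mapsto\phi(f,r)$, $r\mapsto\pi(f,r)$. Let $\alpha(h,\eta)\in\{0,1\}$ be the mark of the last atom of $h$ (so $\alpha(h_s,\eta_s)=D_s$) and, for a point $(u,s)$, $$f_{\rm new}=(1-\alpha)\,f(\cdot+\delta_{(1,s)},\cdot+\delta_{(u,s)})+\alpha\,[\,p\,f(\cdot+\delta_{(0,s)},\cdot+\delta_{(u,s)})+q\,f(\cdot+\delta_{(1,s)},\cdot+\delta_{(u,s)})].$$ **Theorem 2.4.** The filter $\phi$ exists, and every version of it has the following properties. (a) $Q$-a.s., for every real measurable function $f$ of $(h,\eta)$ (bounded or not): $\phi(f,t)$ is a well-defined, càdlàg function of $t$, the integrals below exist, and for all $t\ge0$ $$\begin{aligned}\phi(f,t)=\phi(f,0)&-\int_{E\times[0,t]}\phi\big(f\,[\lambda(u,s,\cdot,\cdot)-\lambda_Q(u,s)],s\big)\,\nu(du)\,ds\\&+\int_{E\times[0,t]}\phi\Big(f_{\rm new}\frac{\lambda(u,s,\cdot,\cdot)}{\lambda_Q(u,s)}-f,\,s-\Big)\frac{\lambda_Q(u,s)}{\lambda_Q(u,s)+\gamma(u,s)}\,O(du\,ds).\end{aligned}$$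 (b) $Q$-a.s., for all $t$ with $\phi(1,t)>0$ and every real measurable $f$, the integrals below exist, their denominator is positive at the points of $O$ up to time $t$, and $$\begin{aligned}\pi(f,t)=\pi(f,0)&+\int_{E\times[0,t]}\frac{\pi(f_{\rm new}\lambda(u,s,\cdot,\cdot),s-)-\pi(\lambda(u,s,\cdot,\cdot),s-)\,\pi(f,s-)}{\pi(\lambda(u,s,\cdot,\cdot)+\gamma(u,s),s-)}\,O(du\,ds)\\&-\int_{E\times[0,t]}\big\{\pi(f\lambda(u,s,\cdot,\cdot),s)-\pi(f,s)\,\pi(\lambda(u,s,\cdot,\cdot),s)\big\}\,\nu(du)\,ds.\end{aligned}$$ (c) If $P$ is a probability measure on $\mathcal F$ with $dP|_{\mathcal F_t}=L(t)\,dQ|_{\mathcal F_t}$ for all $t$, then $\pi(f,t)=E^P[f(h_t,\eta_t)\mid\mathcal F^O_t]$ $P$-a.s. for every $t$ and every measurable $f$ with $f(h_t,\eta_t)$ $P$-integrable; moreover, $P$-a.s., $\phi(1,t)>0$ for all $t$, and for every real measurable $f$ the function $t\mapsto\pi(f,t)$ is càdlàg and satisfies the equation in (b), with a positive denominator at the points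 of $O$, for all $t\ge0$. -/

import Mathlib

open MeasureTheory ProbabilityTheory Set Filter Topology
open scoped NNReal ENNReal

noncomputable section

namespace ClusterFilter

/-- Lebesgue measure on the time axis `[0, ∞)`. -/
def lebesgue : Measure ℝ≥0 := (volume : Measure ℝ).comap (fun t : ℝ≥0 => (t : ℝ))

/-- The set `E × [0, t]`. -/
def upTo (E : Type*) (t : ℝ≥0) : Set (E × ℝ≥0) := univ ×ˢ Iic t

/-- The set `E × [0, t)`. -/
def before (E : Type*) (t : ℝ≥0) : Set (E × ℝ≥0) := univ ×ˢ Iio t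

/-- A path is càdlàg: right-continuous with (finite) left limits. -/
def IsCadlag (g : ℝ≥0 → ℝ) : Prop :=
  ∀ t, ContinuousWithinAt g (Ici t) t ∧ ∃ l, Tendsto g (𝓝[<] t) (𝓝 l)

/-- A marked point process on `[0, ∞)` with marks in `E`: a random counting measure on
`E × [0, ∞)` having finitely many points in every `E × [0, t]`. -/
structure IsMarkedPointProcess {E Ω : Type*} [MeasurableSpace E] [MeasurableSpace Ω]
    (ξ : Ω → Measure (E × ℝ≥0)) : Prop where
  measurable : Measurable ξ
  counting : ∀ ω t, ∃ s : Multiset (E × ℝ≥0),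
    (ξ ω).restrict (upTo E t) = (s.map Measure.dirac).sum

/-- A Poisson random measure with mean measure `Λ`. -/
structure IsPoissonRandomMeasure {E Ω : Type*} [MeasurableSpace E] [MeasurableSpace Ω]
    (Q : Measure Ω) (Λ : Measure (E × ℝ≥0)) (ξ : Ω → Measure (E × ℝ≥0)) : Prop
    extends IsMarkedPointProcess ξ where
  /-- the number of points in a set `B` of finite mean measure is Poisson distributed -/
  law : ∀ B, MeasurableSet B → Λ B < ∞ →
    Q.map (fun ω => ξ ω B) = (poissonMeasure (Λ B).toNNReal).map (fun n : ℕ => (n : ℝ≥0∞))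
  /-- the numbers of points in disjoint sets are independent -/
  indep : ∀ (n : ℕ) (B : Fin n → Set (E × ℝ≥0)), (∀ i, MeasurableSet (B i)) →
    Pairwise (fun i j => Disjoint (B i) (B j)) → iIndepFun (fun i ω => ξ ω (B i)) Q

/-- The states `(h, η)`. The counting measure `h` on `{0, 1} × [0, ∞)` records the values of `D`
(`true` stands for `1`, cluster active; `false` for `0`, no active cluster) together with the
times at which they were taken; the counting measure `η` on `E × [0, ∞)` records the
marks and times of the cluster events. -/
abbrev State (E : Type*) [MeasurableSpace E] : Type _ :=
  Measure (Bool × ℝ≥0) × Measure (E × ℝ≥0)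

/-- The indicator `α(h, η)` that a cluster is active, i.e. that the last atom of `h` has
mark `1`: from some (rational) time on, `h` charges the mark `1` but not the mark `0`. -/
def active {E : Type*} [MeasurableSpace E] (x : State E) : ℝ :=
  open Classical in
  if ∃ r : ℚ≥0, x.1 ({true} ×ˢ Ici (r : ℝ≥0)) ≠ 0 ∧ x.1 ({false} ×ˢ Ici (r : ℝ≥0)) = 0
  then 1 else 0

/-- The state `(h + δ_{(d, s)}, η + δ_{(u, s)})` after a cluster event with mark `u` at time `s`
that sets `D` to `d`; here `y = (u, s)`. -/
def addPoint {E : Type*} [MeasurableSpace E] (d : Bool) (y : E × ℝ≥0) (x : State E) : State E :=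
  (x.1 + Measure.dirac (d, y.2), x.2 + Measure.dirac y)

/-- The update operator `f_new` at the observed point `y = (u, s)`. -/
def fNew {E : Type*} [MeasurableSpace E] (p : ℝ) (f : State E → ℝ) (y : E × ℝ≥0)
    (x : State E) : ℝ :=
  (1 - active x) * f (addPoint true y x) +
    active x * (p * f (addPoint false y x) + (1 - p) * f (addPoint true y x))

/-- The deterministic ingredients of the model. -/
structure Params (E : Type*) [MeasurableSpace E] where
  /-- reference measure on the marks -/
  ν : Measure E
  /-- intensity `γ(u, s)` of the single events -/
  γ : E × ℝ≥0 → ℝ≥0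
  /-- intensity `λ_Q(u, s)` of the cluster events under the reference probability -/
  rateQ : E × ℝ≥0 → ℝ≥0
  /-- intensity `λ(u, s, h, η)` of the cluster events in the model -/
  rate : E × ℝ≥0 → State E → ℝ≥0
  /-- probability that a cluster dies out at one of its events -/
  p : ℝ

namespace Params

variable {E : Type*} [MeasurableSpace E]

/-- The mean measure `γ(u, s) ν(du) ds`. -/
def mean₀ (θ : Params E) : Measure (E × ℝ≥0) :=
  (θ.ν.prod lebesgue).withDensity (fun y => (θ.γ y : ℝ≥0∞))

/-- The mean measure `λ_Q(u, s) ν(du) ds`. -/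
def mean₁ (θ : Params E) : Measure (E × ℝ≥0) :=
  (θ.ν.prod lebesgue).withDensity (fun y => (θ.rateQ y : ℝ≥0∞))

/-- Standing assumptions on the deterministic ingredients. -/
structure Admissible (θ : Params E) : Prop where
  sigmaFinite : SigmaFinite θ.ν
  measurable_γ : Measurable θ.γ
  measurable_rateQ : Measurable θ.rateQ
  measurable_rate : Measurable (Function.uncurry θ.rate)
  rateQ_pos : ∀ y, 0 < θ.rateQ y
  p_nonneg : 0 ≤ θ.p
  p_le_one : θ.p ≤ 1
  mean₀_finite : ∀ t, θ.mean₀ (upTo E t) < ∞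
  mean₁_finite : ∀ t, θ.mean₁ (upTo E t) < ∞

end Params

/-- The value of `D` after `k` cluster events, when it starts at `d₀`: an event sets `D` to `1`
if there is no active cluster, and otherwise the `k`-th event sets it to `1 - I_k`. The variable
`I_k`, `k = 1, 2, …`, is `I (k - 1)` here. -/
def activeAfter (d₀ : Bool) (I : ℕ → Bool) : ℕ → Bool
  | 0 => d₀
  | k + 1 => if activeAfter d₀ I k then !(I k) else true

/-- The random ingredients of the model. -/
structure Model (E Ω : Type*) [MeasurableSpace E] where
  /-- single events -/
  N : Ω → Measure (E × ℝ≥0)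
  /-- cluster events -/
  C : Ω → Measure (E × ℝ≥0)
  /-- initial value `D_0` -/
  D₀ : Ω → Bool
  /-- extinction variables; `I k` is the variable belonging to the `(k + 1)`-st cluster event -/
  I : ℕ → Ω → Bool

namespace Model

variable {E Ω : Type*} [MeasurableSpace E]

/-- The observed marked point process `O = N + C`. -/
def O (X : Model E Ω) (ω : Ω) : Measure (E × ℝ≥0) := X.N ω + X.C ω

/-- The number `C(E, t)` of cluster events up to time `t`. -/
def count (X : Model E Ω) (t : ℝ≥0) (ω : Ω) : ℕ := ⌊(X.C ω (upTo E t)).toReal⌋₊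

/-- The process `D`. -/
def D (X : Model E Ω) (t : ℝ≥0) (ω : Ω) : Bool :=
  activeAfter (X.D₀ ω) (fun k => X.I k ω) (X.count t ω)

/-- The state `(h_t, η_t)`: `η_t = ∑_{t_i ≤ t} δ_{(c_i, t_i)}` over the cluster events, and
`h_t = δ_{(D_0, 0)} + ∑_{t_i ≤ t} δ_{(D_{t_i}, t_i)}`. -/
def state (X : Model E Ω) (t : ℝ≥0) (ω : Ω) : State E :=
  (Measure.dirac (X.D₀ ω, 0) +
      ((X.C ω).restrict (upTo E t)).map (fun y => (X.D y.2 ω, y.2)),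
    (X.C ω).restrict (upTo E t))

/-- The state `(h_{t-}, η_{t-})`. -/
def stateLeft (X : Model E Ω) (t : ℝ≥0) (ω : Ω) : State E :=
  (Measure.dirac (X.D₀ ω, 0) +
      ((X.C ω).restrict (before E t)).map (fun y => (X.D y.2 ω, y.2)),
    (X.C ω).restrict (before E t))

/-- The σ-algebra `𝓕ᴼ_t` generated by the observations up to time `t`. -/
abbrev obs (X : Model E Ω) (t : ℝ≥0) : MeasurableSpace Ω :=
  MeasurableSpace.comap (fun ω => (X.O ω).restrict (upTo E t)) inferInstance

/-- The reference model: on `(Ω, 𝓕, Q)`, `N` and `C` are independent Poisson random measures with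
mean measures `γ(u, s) ν(du) ds` and `λ_Q(u, s) ν(du) ds`, the `I_k` are independent
Bernoulli(`p`) variables, `(N, C)`, `D_0` and `(I_k)` are independent, and everything is
adapted to the filtration `ℱ`. -/
structure IsReference {mΩ : MeasurableSpace Ω} (X : Model E Ω) (θ : Params E)
    (ℱ : Filtration ℝ≥0 mΩ) (Q : Measure Ω) : Prop where
  poisson_N : IsPoissonRandomMeasure Q θ.mean₀ X.N
  poisson_C : IsPoissonRandomMeasure Q θ.mean₁ X.C
  measurable_D₀ : Measurable X.D₀
  measurable_I : ∀ k, Measurable (X.I k)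
  bernoulli : ∀ k, Q {ω | X.I k ω = true} = ENNReal.ofReal θ.p
  indep_I : iIndepFun X.I Q
  indep_N_C : IndepFun X.N X.C Q
  indep_D₀_I : IndepFun X.D₀ (fun ω k => X.I k ω) Q
  indep_NC_D₀I : IndepFun (fun ω => (X.N ω, X.C ω)) (fun ω => (X.D₀ ω, fun k => X.I k ω)) Q
  adapted_N : ∀ t, Measurable[ℱ t] (fun ω => (X.N ω).restrict (upTo E t))
  adapted_C : ∀ t, Measurable[ℱ t] (fun ω => (X.C ω).restrict (upTo E t))
  adapted_D : ∀ t, Measurable[ℱ t] (X.D t)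

/-- `L` is an `ℱ`-martingale with càdlàg paths that solves
`L(t) = 1 + ∫_{E × [0,t]} (λ(u,s,h_{s-},η_{s-}) / λ_Q(u,s) - 1) L(s-) [C(du ds) - λ_Q(u,s) ν(du) ds]`.
-/
structure IsLikelihood {mΩ : MeasurableSpace Ω} (X : Model E Ω) (θ : Params E)
    (ℱ : Filtration ℝ≥0 mΩ) (Q : Measure Ω) (L : ℝ≥0 → Ω → ℝ) : Prop where
  martingale : Martingale L ℱ Q
  cadlag : ∀ᵐ ω ∂Q, IsCadlag (fun t => L t ω)
  solves : ∀ᵐ ω ∂Q, ∀ t,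
    IntegrableOn (fun y => ((θ.rate y (X.stateLeft y.2 ω) : ℝ) / θ.rateQ y - 1) *
      Function.leftLim (fun r => L r ω) y.2) (upTo E t) θ.mean₁ ∧
    L t ω = 1 +
      ((∫ y in upTo E t, ((θ.rate y (X.stateLeft y.2 ω) : ℝ) / θ.rateQ y - 1) *
          Function.leftLim (fun r => L r ω) y.2 ∂(X.C ω)) -
        ∫ y in upTo E t, ((θ.rate y (X.stateLeft y.2 ω) : ℝ) / θ.rateQ y - 1) *
          Function.leftLim (fun r => L r ω) y.2 ∂θ.mean₁)

/-- `φ` is (a regular version of) the unnormalized filter: an `𝓕ᴼ`-adapted process of finite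
measures on the states, càdlàg in time, such that
`∫ f dφ_t = E^Q[f(h_t, η_t) L(t) | 𝓕ᴼ_t]` almost surely, whenever this conditional expectation
exists. -/
structure IsUnnormalizedFilter {mΩ : MeasurableSpace Ω} (X : Model E Ω) (Q : Measure Ω)
    (L : ℝ≥0 → Ω → ℝ) (φ : ℝ≥0 → Ω → Measure (State E)) : Prop where
  adapted : ∀ t, Measurable[X.obs t] (φ t)
  finite : ∀ t ω, IsFiniteMeasure (φ t ω)
  cadlag : ∀ ω A, MeasurableSet A → IsCadlag (fun t => (φ t ω).real A)
  condExp : ∀ t (f : State E → ℝ), Measurable f →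
    Integrable (fun ω => f (X.state t ω) * L t ω) Q →
    (fun ω => ∫ x, f x ∂(φ t ω)) =ᵐ[Q] Q[fun ω => f (X.state t ω) * L t ω | X.obs t]

end Model

section Filters

variable {E Ω : Type*} [MeasurableSpace E]

/-- `φ(f, t)`. -/
def unnorm (φ : ℝ≥0 → Ω → Measure (State E)) (ω : Ω) (f : State E → ℝ) (t : ℝ≥0) : ℝ :=
  ∫ x, f x ∂(φ t ω)

/-- `φ(f, t-)`, the left limit at `t` of `r ↦ φ(f, r)`. -/
def unnormLeft (φ : ℝ≥0 → Ω → Measure (State E)) (ω : Ω) (f : State E → ℝ) (t : ℝ≥0) : ℝ :=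
  Function.leftLim (unnorm φ ω f) t

/-- `π(f, t) = φ(f, t) / φ(1, t)`. -/
def norml (φ : ℝ≥0 → Ω → Measure (State E)) (ω : Ω) (f : State E → ℝ) (t : ℝ≥0) : ℝ :=
  unnorm φ ω f t / unnorm φ ω (fun _ => 1) t

/-- `π(f, t-)`, the left limit at `t` of `r ↦ π(f, r)`. -/
def normlLeft (φ : ℝ≥0 → Ω → Measure (State E)) (ω : Ω) (f : State E → ℝ) (t : ℝ≥0) : ℝ :=
  Function.leftLim (norml φ ω f) t

/-- The Zakai equation for `f` at time `t` on the path `ω`: both integrals exist and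
`φ(f, t) = φ(f, 0) - ∫_{E × [0,t]} φ(f [λ(u,s,·,·) - λ_Q(u,s)], s) ν(du) ds
  + ∫_{E × [0,t]} φ(f_new λ(u,s,·,·) / λ_Q(u,s) - f, s-) λ_Q(u,s) / (λ_Q(u,s) + γ(u,s)) O(du ds)`.
-/
def ZakaiAt (θ : Params E) (X : Model E Ω) (φ : ℝ≥0 → Ω → Measure (State E)) (ω : Ω)
    (f : State E → ℝ) (t : ℝ≥0) : Prop :=
  IntegrableOn (fun y => unnorm φ ω (fun x => f x * ((θ.rate y x : ℝ) - θ.rateQ y)) y.2)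
    (upTo E t) (θ.ν.prod lebesgue) ∧
  IntegrableOn (fun y =>
    unnormLeft φ ω (fun x => fNew θ.p f y x * ((θ.rate y x : ℝ) / θ.rateQ y) - f x) y.2 *
      ((θ.rateQ y : ℝ) / (θ.rateQ y + θ.γ y))) (upTo E t) (X.O ω) ∧
  unnorm φ ω f t = unnorm φ ω f 0
    - (∫ y in upTo E t, unnorm φ ω (fun x => f x * ((θ.rate y x : ℝ) - θ.rateQ y)) y.2
        ∂(θ.ν.prod lebesgue))
    + ∫ y in upTo E t,
        unnormLeft φ ω (fun x => fNew θ.p f y x * ((θ.rate y x : ℝ) / θ.rateQ y) - f x) y.2 *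
          ((θ.rateQ y : ℝ) / (θ.rateQ y + θ.γ y)) ∂(X.O ω)

/-- The Kushner–Stratonovich equation for `f` at time `t` on the path `ω`: the denominator
`π(λ(u,s,·,·) + γ(u,s), s-)` is positive at the observed points up to time `t`, both integrals
exist, and
`π(f, t) = π(f, 0) + ∫_{E × [0,t]} [π(f_new λ(u,s,·,·), s-) - π(λ(u,s,·,·), s-) π(f, s-)]
    / π(λ(u,s,·,·) + γ(u,s), s-) O(du ds)
  - ∫_{E × [0,t]} {π(f λ(u,s,·,·), s) - π(f, s) π(λ(u,s,·,·), s)} ν(du) ds`. -/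
def KushnerStratonovichAt (θ : Params E) (X : Model E Ω) (φ : ℝ≥0 → Ω → Measure (State E))
    (ω : Ω) (f : State E → ℝ) (t : ℝ≥0) : Prop :=
  (∀ᵐ y ∂((X.O ω).restrict (upTo E t)),
    0 < normlLeft φ ω (fun x => (θ.rate y x : ℝ) + θ.γ y) y.2) ∧
  IntegrableOn (fun y =>
    (normlLeft φ ω (fun x => fNew θ.p f y x * (θ.rate y x : ℝ)) y.2
      - normlLeft φ ω (fun x => (θ.rate y x : ℝ)) y.2 * normlLeft φ ω f y.2)
      / normlLeft φ ω (fun x => (θ.rate y x : ℝ) + θ.γ y) y.2) (upTo E t) (X.O ω) ∧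
  IntegrableOn (fun y =>
    norml φ ω (fun x => f x * (θ.rate y x : ℝ)) y.2
      - norml φ ω f y.2 * norml φ ω (fun x => (θ.rate y x : ℝ)) y.2)
    (upTo E t) (θ.ν.prod lebesgue) ∧
  norml φ ω f t = norml φ ω f 0
    + (∫ y in upTo E t,
        (normlLeft φ ω (fun x => fNew θ.p f y x * (θ.rate y x : ℝ)) y.2
          - normlLeft φ ω (fun x => (θ.rate y x : ℝ)) y.2 * normlLeft φ ω f y.2)
          / normlLeft φ ω (fun x => (θ.rate y x : ℝ) + θ.γ y) y.2 ∂(X.O ω))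
    - ∫ y in upTo E t,
        (norml φ ω (fun x => f x * (θ.rate y x : ℝ)) y.2
          - norml φ ω f y.2 * norml φ ω (fun x => (θ.rate y x : ℝ)) y.2)
        ∂(θ.ν.prod lebesgue)

end Filters

/-- `P` is a probability measure with `dP = L(t) dQ` on `ℱ_t` for every `t`. -/
structure HasDensity {Ω : Type*} {mΩ : MeasurableSpace Ω} (ℱ : Filtration ℝ≥0 mΩ)
    (Q P : Measure Ω) (L : ℝ≥0 → Ω → ℝ) : Prop where
  isProbabilityMeasure : IsProbabilityMeasure P
  density : ∀ t A, MeasurableSet[ℱ t] A → P A = ∫⁻ ω in A, ENNReal.ofReal (L t ω) ∂Q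

end ClusterFilter

end

set_option linter.unusedSectionVars false
open MeasureTheory ProbabilityTheory Set Filter Topology
open scoped NNReal ENNReal

noncomputable section

/-! Under `Q` the observed process is the superposition of two independent Poisson processes. Given
the observed points up to `t`, each of them is therefore a cluster event with probability `λ_Q /
(λ_Q + γ)`, independently of the others and of the coins `D₀`, `I_k`. So the conditional law of the
state given the observed points comes from a finite recursion: start from the law of the initial
state and apply the random step `stepLaw` at each observed point in order of time. The result,
`obsLaw`, is a kernel on point configurations, and on finite configurations it is a finite
combination of Dirac measures. The thinning property is `sum_splitW_map_stateOf` together with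
`lintegral_poissonPair_split`; the conditional law is `lintegral_obs_state`.

The likelihood equation can be solved path by path. Between cluster events it is the linear equation
`L' = -(∫ (λ - λ_Q) dν) L`, and a cluster event multiplies `L` by `λ / λ_Q`. Hence `L(t)` is almost
surely a functional `weight t` of the state (`ae_likelihood_eq`), and the conditional law reweighted
by it is an explicit filter (`isUnnormalizedFilter`). Every version agrees with it for all times
outside a null set: the measures in question are determined by countably many of their values, and
both versions are right-continuous (`ae_regularPath`).

What remains is deterministic. Along a regular path `obsLaw` is frozen between observed points and
only the weights move, which gives the drift; an observed point applies `stepLaw`, which gives the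
jump. Adding up over the finitely many points yields the Zakai equation (`RegularPath.zakai`). Since
a finitely supported measure integrates every measurable function, one null set serves all `f`,
bounded or not. The equation for `π` is the quotient rule (`RegularPath.kushnerStratonovich`); its
denominators are positive because the total mass, once zero, stays zero. For `P`, the total mass
`φ(1,t)` is the density of `P` on the observed events, and Bayes' formula identifies `π`
(`norml_ae_eq_condExp`).

One difficulty is that `λ` need not be integrable in time. Then `exp(-∫λ)` may drop to zero
discontinuously, while a solution of the likelihood equation is continuous between events. The proof
therefore uses the continuous function `survival` and the set `IsGood` of states on which it
represents the likelihood; existence of `L` forces the true state, and hence almost every state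
under the conditional law, to be good. -/

namespace ClusterFilter

/-! ### Calculus of indefinite integrals on the real line -/

section RealLine

theorem integralFunction_ae_hasDerivAt {f : ℝ → ℝ} {a b : ℝ} (c : ℝ)
    (hf : IntervalIntegrable f volume a b) :
    ∀ᵐ x, x ∈ uIcc a b → HasDerivAt (fun t => c + ∫ s in a..t, f s) (f x) x := by
  filter_upwards [hf.ae_hasDerivAt_integral] with x hx hx'
  exact (hx hx' a left_mem_uIcc).const_add c

theorem integralFunction_absolutelyContinuous {f : ℝ → ℝ} {a b : ℝ} (c : ℝ)
    (hf : IntervalIntegrable f volume a b) :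
    AbsolutelyContinuousOnInterval (fun t => c + ∫ s in a..t, f s) a b := by
  have h1 := hf.absolutelyContinuousOnInterval_intervalIntegral (c := a) left_mem_uIcc
  have h2 : AbsolutelyContinuousOnInterval (fun _ : ℝ => c) a b :=
    (LipschitzWith.const c).lipschitzOnWith.absolutelyContinuousOnInterval
  exact h2.add h1

theorem AbsolutelyContinuousOnInterval.lipschitz_comp {F Ψ : ℝ → ℝ} {a b : ℝ} {K : ℝ≥0}
    (hF : AbsolutelyContinuousOnInterval F a b) (hΨ : LipschitzOnWith K Ψ (F '' uIcc a b)) :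
    AbsolutelyContinuousOnInterval (fun t => Ψ (F t)) a b := by
  rw [absolutelyContinuousOnInterval_iff] at hF ⊢
  intro ε hε
  -- The constant is `K + 1` because `K` may be zero.
  obtain ⟨δ, hδ, h⟩ := hF (ε / (K + 1)) (by positivity)
  refine ⟨δ, hδ, fun I hI hlt => ?_⟩
  calc _ ≤ ∑ i ∈ Finset.range I.1, K * dist (F (I.2 i).1) (F (I.2 i).2) := by
        refine Finset.sum_le_sum fun i hi => ?_
        exact hΨ.dist_le_mul _ (mem_image_of_mem _ (hI.1 i hi).1) _
          (mem_image_of_mem _ (hI.1 i hi).2)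
    _ = K * ∑ i ∈ Finset.range I.1, dist (F (I.2 i).1) (F (I.2 i).2) := by rw [Finset.mul_sum]
    _ ≤ K * (ε / (K + 1)) := by gcongr; exact (h I hI hlt).le
    _ < (K + 1) * (ε / (K + 1)) := by gcongr; linarith
    _ = ε := by field_simp

/-- A Lipschitz image of an absolutely continuous function is absolutely continuous, hence the
integral of its derivative, and the chain rule gives that derivative almost everywhere. -/
theorem integralFunction_comp {f Ψ Ψ' : ℝ → ℝ} {a b c : ℝ} {K : ℝ≥0}
    (hf : IntervalIntegrable f volume a b)
    (hK : LipschitzOnWith K Ψ ((fun t => c + ∫ s in a..t, f s) '' uIcc a b))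
    (hΨ : ∀ t ∈ uIcc a b, HasDerivAt Ψ (Ψ' (c + ∫ s in a..t, f s)) (c + ∫ s in a..t, f s)) :
    Ψ (c + ∫ s in a..b, f s) - Ψ c = ∫ t in a..b, Ψ' (c + ∫ s in a..t, f s) * f t := by
  have hac := AbsolutelyContinuousOnInterval.lipschitz_comp
    (integralFunction_absolutelyContinuous c hf) hK
  have h := hac.integral_deriv_eq_sub
  simp only [intervalIntegral.integral_same, add_zero] at h
  rw [← h]
  apply intervalIntegral.integral_congr_ae
  filter_upwards [integralFunction_ae_hasDerivAt c hf] with x hx hx'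
  have hx' := uIoc_subset_uIcc hx'
  exact ((hΨ x hx').comp x (hx hx')).deriv

theorem integralFunction_mul {f g : ℝ → ℝ} {a b c d : ℝ}
    (hf : IntervalIntegrable f volume a b) (hg : IntervalIntegrable g volume a b) :
    (c + ∫ s in a..b, f s) * (d + ∫ s in a..b, g s) - c * d =
      ∫ t in a..b, (f t * (d + ∫ s in a..t, g s) + (c + ∫ s in a..t, f s) * g t) := by
  have h := (integralFunction_absolutelyContinuous c hf).integral_deriv_mul_eq_sub
    (integralFunction_absolutelyContinuous d hg)
  simp only [intervalIntegral.integral_same, add_zero] at h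
  rw [← h]
  apply intervalIntegral.integral_congr_ae
  filter_upwards [integralFunction_ae_hasDerivAt c hf, integralFunction_ae_hasDerivAt d hg]
    with x hx hx2 hx'
  have hx' := uIoc_subset_uIcc hx'
  rw [(hx hx').deriv, (hx2 hx').deriv]

end RealLine

/-! ### Slabs of marks and times, and Fubini over the marks -/

/-- The set `E × (a, b]`. -/
def slab (E : Type*) (a b : ℝ≥0) : Set (E × ℝ≥0) := univ ×ˢ Ioc a b

section Slab

variable {E : Type*} [MeasurableSpace E]

theorem measurableEmbedding_nnreal_coe : MeasurableEmbedding (fun t : ℝ≥0 => (t : ℝ)) :=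
  MeasurableEmbedding.subtype_coe measurableSet_Ici

theorem map_coe_lebesgue : lebesgue.map (fun t : ℝ≥0 => (t : ℝ)) = volume.restrict (Ici 0) := by
  rw [lebesgue, measurableEmbedding_nnreal_coe.map_comap]
  congr 1
  ext x
  exact ⟨fun ⟨y, hy⟩ => hy ▸ y.2, fun hx => ⟨⟨x, hx⟩, rfl⟩⟩

theorem lebesgue_apply (s : Set ℝ≥0) : lebesgue s = volume ((fun t : ℝ≥0 => (t : ℝ)) '' s) :=
  measurableEmbedding_nnreal_coe.comap_apply _ _

instance : SigmaFinite lebesgue := by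
  refine SigmaFinite.of_map _ measurableEmbedding_nnreal_coe.measurable.aemeasurable ?_
  rw [map_coe_lebesgue]
  infer_instance

instance : NullSingletonClass lebesgue := by
  refine ⟨fun x => ?_⟩
  rw [lebesgue_apply]; simp

theorem coe_preimage_Ioc (a b : ℝ≥0) :
    (fun t : ℝ≥0 => (t : ℝ)) ⁻¹' Ioc (a : ℝ) b = Ioc a b := by
  ext x; simp

theorem measurableSet_slab (a b : ℝ≥0) : MeasurableSet (slab E a b) :=
  MeasurableSet.univ.prod measurableSet_Ioc

theorem measurableSet_upTo (t : ℝ≥0) : MeasurableSet (upTo E t) :=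
  MeasurableSet.univ.prod measurableSet_Iic

theorem measurableSet_before (t : ℝ≥0) : MeasurableSet (before E t) :=
  MeasurableSet.univ.prod measurableSet_Iio

theorem lebesgue_restrict_map (a b : ℝ≥0) :
    (lebesgue.restrict (Ioc a b)).map (fun t : ℝ≥0 => (t : ℝ)) = volume.restrict (Ioc (a:ℝ) b) := by
  rw [← coe_preimage_Ioc, ← measurableEmbedding_nnreal_coe.restrict_map, map_coe_lebesgue,
    Measure.restrict_restrict measurableSet_Ioc]
  congr 1
  ext x
  simp only [mem_inter_iff, mem_Ioc, mem_Ici, and_iff_left_iff_imp, and_imp]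
  intro h _
  exact (a.2.trans_lt h).le

/-- The time density of `f`, integrated over the marks. -/
def bar (ν : Measure E) (f : E × ℝ≥0 → ℝ) (s : ℝ) : ℝ := ∫ u, f (u, s.toNNReal) ∂ν

variable (ν : Measure E) [SigmaFinite ν]

theorem restrict_slab (a b : ℝ≥0) :
    (ν.prod lebesgue).restrict (slab E a b) = ν.prod (lebesgue.restrict (Ioc a b)) := by
  rw [slab, ← Measure.prod_restrict, Measure.restrict_univ]

variable {ν}

theorem slab_integral {f : E × ℝ≥0 → ℝ} {a b : ℝ≥0}
    (hf : IntegrableOn f (slab E a b) (ν.prod lebesgue)) :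
    ∫ y in slab E a b, f y ∂(ν.prod lebesgue) = ∫ s in Ioc (a : ℝ) b, bar ν f s := by
  rw [IntegrableOn, restrict_slab] at hf
  rw [restrict_slab, integral_prod_symm _ hf, ← lebesgue_restrict_map,
    measurableEmbedding_nnreal_coe.integral_map]
  simp only [bar, Real.toNNReal_coe]

theorem slab_intervalIntegrable {f : E × ℝ≥0 → ℝ} {a b : ℝ≥0} (hab : a ≤ b)
    (hf : IntegrableOn f (slab E a b) (ν.prod lebesgue)) :
    IntervalIntegrable (bar ν f) volume a b := by
  rw [IntegrableOn, restrict_slab] at hf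
  rw [intervalIntegrable_iff_integrableOn_Ioc_of_le (by exact_mod_cast hab), IntegrableOn,
    ← lebesgue_restrict_map, measurableEmbedding_nnreal_coe.integrable_map_iff]
  refine hf.integral_prod_right.congr (Eventually.of_forall fun s => ?_)
  simp only [bar, Function.comp_apply, Real.toNNReal_coe]

omit [MeasurableSpace E] in
theorem slab_mono {a b c d : ℝ≥0} (h1 : c ≤ a) (h2 : b ≤ d) : slab E a b ⊆ slab E c d :=
  prod_mono le_rfl (Ioc_subset_Ioc h1 h2)

end Slab

/-! ### Functions of time with a density on marks and times -/

section HasDens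

variable {E : Type*} [MeasurableSpace E]

/-- On `[a, b]` the function `F` is the indefinite integral of `f` over the slabs `E × (a, t]`. -/
def HasDens (ν : Measure E) (F : ℝ≥0 → ℝ) (f : E × ℝ≥0 → ℝ) (a b : ℝ≥0) : Prop :=
  IntegrableOn f (slab E a b) (ν.prod lebesgue) ∧
    ∀ t ∈ Icc a b, F t = F a + ∫ y in slab E a t, f y ∂(ν.prod lebesgue)

namespace HasDens

variable {ν : Measure E} [SigmaFinite ν] {F H : ℝ≥0 → ℝ} {f h : E × ℝ≥0 → ℝ} {a b : ℝ≥0}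

theorem real (hF : HasDens ν F f a b) {t : ℝ≥0} (ht : t ∈ Icc a b) :
    F t = F a + ∫ s in (a:ℝ)..t, bar ν f s := by
  rw [hF.2 t ht, slab_integral (hF.1.mono_set (slab_mono le_rfl ht.2)),
    intervalIntegral.integral_of_le (by exact_mod_cast ht.1)]

theorem of_real (hf : IntegrableOn f (slab E a b) (ν.prod lebesgue))
    (hF : ∀ t ∈ Icc a b, F t = F a + ∫ s in (a:ℝ)..t, bar ν f s) : HasDens ν F f a b := by
  refine ⟨hf, fun t ht => ?_⟩
  rw [hF t ht, slab_integral (hf.mono_set (slab_mono le_rfl ht.2)),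
    intervalIntegral.integral_of_le (by exact_mod_cast ht.1)]

theorem mono_right (hF : HasDens ν F f a b) {c : ℝ≥0} (hc : c ≤ b) : HasDens ν F f a c :=
  ⟨hF.1.mono_set (slab_mono le_rfl hc), fun t ht => hF.2 t ⟨ht.1, ht.2.trans hc⟩⟩

omit [SigmaFinite ν] in
theorem sub_eq (hF : HasDens ν F f a b) {r t : ℝ≥0} (har : a ≤ r) (hrt : r ≤ t) (htb : t ≤ b) :
    F t = F r + ∫ y in slab E r t, f y ∂(ν.prod lebesgue) := by
  rw [hF.2 t ⟨har.trans hrt, htb⟩, hF.2 r ⟨har, hrt.trans htb⟩, add_assoc]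
  congr 1
  rw [← setIntegral_union _ (measurableSet_slab _ _)
    (hF.1.mono_set (slab_mono le_rfl (hrt.trans htb))) (hF.1.mono_set (slab_mono har htb))]
  · rw [slab, slab, slab, ← prod_union, Ioc_union_Ioc_eq_Ioc har hrt]
  · exact Disjoint.set_prod_right (Ioc_disjoint_Ioc_of_le le_rfl) _ _

omit [SigmaFinite ν] in
theorem mono (hF : HasDens ν F f a b) {c d : ℝ≥0} (hc : a ≤ c) (hd : d ≤ b) :
    HasDens ν F f c d :=
  ⟨hF.1.mono_set (slab_mono hc hd), fun _ ht => hF.sub_eq hc ht.1 (ht.2.trans hd)⟩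

theorem congr {F' : ℝ≥0 → ℝ} (hF : HasDens ν F f a b) (hab : a ≤ b)
    (h : ∀ t ∈ Icc a b, F' t = F t) : HasDens ν F' f a b :=
  ⟨hF.1, fun t ht => by rw [h t ht, h a (left_mem_Icc.2 hab), hF.2 t ht]⟩

theorem congr_fun' {F' : ℝ≥0 → ℝ} (hF : HasDens ν F f a b) (h : ∀ t, F' t = F t) :
    HasDens ν F' f a b := by
  rwa [funext h]

theorem congr_dens {f' : E × ℝ≥0 → ℝ} (hF : HasDens ν F f a b)
    (h : ∀ᵐ y ∂(ν.prod lebesgue), y ∈ slab E a b → f y = f' y) : HasDens ν F f' a b := by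
  have hae : f =ᵐ[(ν.prod lebesgue).restrict (slab E a b)] f' :=
    (ae_restrict_iff' (measurableSet_slab _ _)).2 h
  refine ⟨hF.1.congr hae, fun t ht => ?_⟩
  rw [hF.2 t ht]
  congr 1
  exact integral_congr_ae (ae_mono (Measure.restrict_mono (slab_mono le_rfl ht.2) le_rfl) hae)

theorem const (c : ℝ) (a b : ℝ≥0) : HasDens ν (fun _ => c) (fun _ => 0) a b :=
  ⟨integrableOn_zero, fun t _ => by simp⟩

theorem add (hF : HasDens ν F f a b) (hH : HasDens ν H h a b) :
    HasDens ν (fun t => F t + H t) (fun y => f y + h y) a b := by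
  refine ⟨hF.1.add hH.1, fun t ht => ?_⟩
  rw [integral_add (hF.1.mono_set (slab_mono le_rfl ht.2))
    (hH.1.mono_set (slab_mono le_rfl ht.2))]
  simp only [hF.2 t ht, hH.2 t ht]
  ring

theorem const_mul (hF : HasDens ν F f a b) (c : ℝ) :
    HasDens ν (fun t => c * F t) (fun y => c * f y) a b := by
  refine ⟨hF.1.const_mul c, fun t ht => ?_⟩
  rw [integral_const_mul]
  simp only [hF.2 t ht]
  ring

theorem sum {ι : Type*} (s : Finset ι) {F : ι → ℝ≥0 → ℝ} {f : ι → E × ℝ≥0 → ℝ}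
    (hF : ∀ i ∈ s, HasDens ν (F i) (f i) a b) :
    HasDens ν (fun t => ∑ i ∈ s, F i t) (fun y => ∑ i ∈ s, f i y) a b := by
  classical
  induction s using Finset.induction_on with
  | empty => simpa using HasDens.const 0 a b
  | insert i s hi ih =>
    simp only [Finset.sum_insert hi]
    exact (hF i (Finset.mem_insert_self _ _)).add
      (ih fun j hj => hF j (Finset.mem_insert_of_mem hj))

theorem continuousOn (hF : HasDens ν F f a b) : ContinuousOn F (Icc a b) := by
  rcases le_or_gt a b with hab | hab
  swap
  · simp [Icc_eq_empty_of_lt hab]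
  have h1 := intervalIntegral.continuousOn_primitive_interval'
    (slab_intervalIntegrable hab hF.1) (left_mem_uIcc (a := (a:ℝ)) (b := b))
  have h2 : ContinuousOn (fun t : ℝ≥0 => F a + ∫ s in (a:ℝ)..t, bar ν f s) (Icc a b) := by
    refine continuousOn_const.add (h1.comp NNReal.continuous_coe.continuousOn fun t ht => ?_)
    rw [uIcc_of_le (by exact_mod_cast hab)]
    exact ⟨by exact_mod_cast ht.1, by exact_mod_cast ht.2⟩
  exact h2.congr fun t ht => hF.real ht

theorem _root_.ClusterFilter.bar_mul_time (f : E × ℝ≥0 → ℝ) (c : ℝ≥0 → ℝ) (s : ℝ) :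
    bar ν (fun y => f y * c y.2) s = bar ν f s * c s.toNNReal := by
  simp only [bar, integral_mul_const]

theorem _root_.ClusterFilter.integrableOn_slab_mul {f : E × ℝ≥0 → ℝ} {c : ℝ≥0 → ℝ}
    (hf : IntegrableOn f (slab E a b) (ν.prod lebesgue)) (hc : ContinuousOn c (Icc a b)) :
    IntegrableOn (fun y => f y * c y.2) (slab E a b) (ν.prod lebesgue) := by
  obtain ⟨C, hC⟩ := (isCompact_Icc (a := a) (b := b)).exists_bound_of_continuousOn hc
  have hmeas : AEStronglyMeasurable (fun y : E × ℝ≥0 => c y.2)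
      ((ν.prod lebesgue).restrict (slab E a b)) := by
    rw [restrict_slab]
    exact ((hc.mono Ioc_subset_Icc_self).aestronglyMeasurable measurableSet_Ioc).comp_snd
  refine Integrable.mul_bdd (c := C) hf hmeas ?_
  filter_upwards [ae_restrict_mem (measurableSet_slab a b)] with y hy
  exact hC _ (Ioc_subset_Icc_self hy.2)

/-- A factor that depends on time alone leaves the integral over the marks, so this is the product
rule for the time densities `bar`. -/
theorem mul (hF : HasDens ν F f a b) (hH : HasDens ν H h a b) :
    HasDens ν (fun t => F t * H t) (fun y => f y * H y.2 + h y * F y.2) a b := by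
  have hi1 := integrableOn_slab_mul hF.1 hH.continuousOn
  have hi2 := integrableOn_slab_mul hH.1 hF.continuousOn
  refine of_real (hi1.add hi2) fun t ht => ?_
  have hat : (a:ℝ) ≤ t := by exact_mod_cast ht.1
  have key := integralFunction_mul (c := F a) (d := H a)
    (slab_intervalIntegrable ht.1 (hF.mono_right ht.2).1)
    (slab_intervalIntegrable ht.1 (hH.mono_right ht.2).1)
  rw [← hF.real ht, ← hH.real ht] at key
  rw [eq_add_of_sub_eq' key]
  congr 1
  have hs1 := slab_intervalIntegrable ht.1 (hi1.mono_set (slab_mono le_rfl ht.2))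
  have hs2 := slab_intervalIntegrable ht.1 (hi2.mono_set (slab_mono le_rfl ht.2))
  have h1 : ∫ s in (a:ℝ)..t, bar ν (fun y => f y * H y.2 + h y * F y.2) s =
      ∫ s in (a:ℝ)..t, (bar ν (fun y => f y * H y.2) s + bar ν (fun y => h y * F y.2) s) := by
    have e1 := slab_integral ((hi1.add hi2).mono_set (slab_mono le_rfl ht.2))
    have e2 := slab_integral (hi1.mono_set (slab_mono le_rfl ht.2))
    have e3 := slab_integral (hi2.mono_set (slab_mono le_rfl ht.2))
    rw [intervalIntegral.integral_add hs1 hs2]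
    simp only [intervalIntegral.integral_of_le hat]
    rw [← e2, ← e3, ← integral_add (hi1.mono_set (slab_mono le_rfl ht.2))
      (hi2.mono_set (slab_mono le_rfl ht.2))]
    exact e1.symm
  rw [h1]
  refine intervalIntegral.integral_congr fun s hs => ?_
  rw [uIcc_of_le hat] at hs
  have hs0 : ((s.toNNReal : ℝ≥0) : ℝ) = s := Real.coe_toNNReal _ (a.2.trans hs.1)
  have hsm : s.toNNReal ∈ Icc a b := by
    rw [← hs0] at hs
    exact ⟨by exact_mod_cast hs.1, (by exact_mod_cast hs.2 : s.toNNReal ≤ t).trans ht.2⟩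
  simp only [bar_mul_time]
  rw [hF.real hsm, hH.real hsm, hs0]
  ring

theorem comp (hF : HasDens ν F f a b) {Ψ Ψ' : ℝ → ℝ} {K : ℝ≥0}
    (hK : LipschitzOnWith K Ψ (F '' Icc a b)) (hd : ∀ t ∈ Icc a b, HasDerivAt Ψ (Ψ' (F t)) (F t))
    (hc : ContinuousOn (fun t => Ψ' (F t)) (Icc a b)) :
    HasDens ν (fun t => Ψ (F t)) (fun y => f y * Ψ' (F y.2)) a b := by
  have hi := integrableOn_slab_mul hF.1 hc
  refine of_real hi fun t ht => ?_
  have hat : (a:ℝ) ≤ t := by exact_mod_cast ht.1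
  have hmem : ∀ s ∈ uIcc (a:ℝ) t, s.toNNReal ∈ Icc a b ∧
      F s.toNNReal = F a + ∫ s in (a:ℝ)..s, bar ν f s := by
    intro s hs
    rw [uIcc_of_le hat] at hs
    have hs0 : ((s.toNNReal : ℝ≥0) : ℝ) = s := Real.coe_toNNReal _ (a.2.trans hs.1)
    have hsm : s.toNNReal ∈ Icc a b := by
      rw [← hs0] at hs
      exact ⟨by exact_mod_cast hs.1, (by exact_mod_cast hs.2 : s.toNNReal ≤ t).trans ht.2⟩
    refine ⟨hsm, ?_⟩
    rw [hF.real hsm, hs0]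
  have key := integralFunction_comp (Ψ := Ψ) (Ψ' := Ψ') (c := F a) (K := K)
    (slab_intervalIntegrable ht.1 (hF.mono_right ht.2).1)
    (hK.mono (by
      rintro _ ⟨s, hs, rfl⟩
      obtain ⟨h1, h2⟩ := hmem s hs
      exact ⟨_, h1, h2⟩))
    (fun s hs => by
      obtain ⟨h1, h2⟩ := hmem s hs
      rw [← h2]; exact hd _ h1)
  rw [← hF.real ht] at key
  rw [eq_add_of_sub_eq' key]
  congr 1
  refine intervalIntegral.integral_congr fun s hs => ?_
  have hb : bar ν (fun y => f y * Ψ' (F y.2)) s = bar ν f s * Ψ' (F s.toNNReal) :=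
    bar_mul_time f (fun t => Ψ' (F t)) s
  rw [hb, ← (hmem s hs).2, mul_comm]

theorem exp (hF : HasDens ν F f a b) :
    HasDens ν (fun t => Real.exp (F t)) (fun y => f y * Real.exp (F y.2)) a b := by
  -- The exponential is Lipschitz only on bounded sets; a compact range suffices.
  have hcomp : IsCompact (F '' Icc a b) := isCompact_Icc.image_of_continuousOn hF.continuousOn
  obtain ⟨C, hC⟩ := hcomp.isBounded.subset_closedBall 0
  obtain ⟨K, hK⟩ := (Real.contDiff_exp (n := 1)).contDiffOn.exists_lipschitzOnWith
    (by simp) (convex_closedBall (0:ℝ) C) (isCompact_closedBall _ _)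
  exact hF.comp (hK.mono hC) (fun t _ => Real.hasDerivAt_exp _)
    (Real.continuous_exp.comp_continuousOn hF.continuousOn)

theorem inv (hF : HasDens ν F f a b) (hpos : ∀ t ∈ Icc a b, 0 < F t) :
    HasDens ν (fun t => (F t)⁻¹) (fun y => f y * (-((F y.2) ^ 2)⁻¹)) a b := by
  rcases lt_or_ge b a with hab | hab
  · refine ⟨?_, fun t ht => absurd (ht.1.trans ht.2) hab.not_ge⟩
    rw [slab, Ioc_eq_empty_of_le hab.le, prod_empty]
    exact integrableOn_empty
  -- The range lies between the positive minimum and the maximum of `F`, where inversion is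
  -- Lipschitz.
  obtain ⟨t₀, ht₀, hmin⟩ := isCompact_Icc.exists_isMinOn (nonempty_Icc.2 hab) hF.continuousOn
  obtain ⟨t₁, ht₁, hmax⟩ := isCompact_Icc.exists_isMaxOn (nonempty_Icc.2 hab) hF.continuousOn
  have hsub : F '' Icc a b ⊆ Icc (F t₀) (F t₁) := by
    rintro _ ⟨t, ht, rfl⟩; exact ⟨hmin ht, hmax ht⟩
  have hcd : ContDiffOn ℝ 1 (fun x : ℝ => x⁻¹) (Icc (F t₀) (F t₁)) := by
    intro x hx
    exact (contDiffAt_inv ℝ ((hpos _ ht₀).trans_le hx.1).ne').contDiffWithinAt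
  obtain ⟨K, hK⟩ := hcd.exists_lipschitzOnWith (by simp) (convex_Icc _ _) isCompact_Icc
  refine hF.comp (hK.mono hsub) (Ψ' := fun x => -(x ^ 2)⁻¹)
    (fun t ht => hasDerivAt_inv (hpos t ht).ne') ?_
  exact ((hF.continuousOn.pow 2).inv₀ fun t ht => (pow_pos (hpos t ht) 2).ne').neg

end HasDens

end HasDens

/-! ### Exponentials of extended exponents, and induction along the half-line -/

/-- `exp (-b)` for an extended nonnegative real `b`. -/
def negExp (b : ℝ≥0∞) : ℝ := (EReal.exp (-(b : EReal))).toReal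

section NegExp

theorem negExp_top : negExp ∞ = 0 := by simp [negExp]

theorem negExp_ofReal {x : ℝ} (hx : 0 ≤ x) : negExp (ENNReal.ofReal x) = Real.exp (-x) := by
  rw [negExp, EReal.coe_ennreal_ofReal, max_eq_left hx, ← EReal.coe_neg, EReal.exp_coe,
    ENNReal.toReal_ofReal (Real.exp_pos _).le]

theorem negExp_of_ne_top {b : ℝ≥0∞} (hb : b ≠ ∞) : negExp b = Real.exp (-b.toReal) := by
  rw [← negExp_ofReal ENNReal.toReal_nonneg, ENNReal.ofReal_toReal hb]

theorem negExp_zero : negExp 0 = 1 := by simp [negExp_of_ne_top]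

theorem negExp_add (a b : ℝ≥0∞) : negExp (a + b) = negExp a * negExp b := by
  by_cases ha : a = ∞
  · simp [ha, negExp_top]
  by_cases hb : b = ∞
  · simp [hb, negExp_top]
  rw [negExp_of_ne_top ha, negExp_of_ne_top hb, negExp_of_ne_top (by simp [ha, hb]),
    ENNReal.toReal_add ha hb, ← Real.exp_add]
  congr 1; ring

theorem negExp_nonneg (b : ℝ≥0∞) : 0 ≤ negExp b := ENNReal.toReal_nonneg

theorem negExp_antitone : Antitone negExp := by
  intro a b hab
  obtain ⟨c, rfl⟩ := le_iff_exists_add.1 hab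
  rw [negExp_add]
  refine mul_le_of_le_one_right (negExp_nonneg _) ?_
  by_cases hc : c = ∞
  · simp [hc, negExp_top]
  · rw [negExp_of_ne_top hc, Real.exp_le_one_iff]
    simp

theorem continuous_negExp : Continuous negExp := by
  have h1 : Continuous fun b : ℝ≥0∞ => EReal.exp (-(b : EReal)) :=
    ENNReal.continuous_exp.comp (continuous_neg.comp continuous_coe_ennreal_ereal)
  have h2 : ∀ b : ℝ≥0∞, EReal.exp (-(b : EReal)) ≠ ∞ := by
    intro b h
    rw [EReal.exp_eq_top_iff] at h
    simp at h
  exact continuous_iff_continuousAt.2 fun b =>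
    ContinuousAt.comp (f := fun b : ℝ≥0∞ => EReal.exp (-(b : EReal)))
      (ENNReal.continuousAt_toReal (h2 b)) h1.continuousAt

theorem measurable_negExp : Measurable negExp := continuous_negExp.measurable

end NegExp

/-- Induction along the half-line `[0, ∞)`. -/
theorem nnreal_induction {P : ℝ≥0 → Prop} (h0 : P 0)
    (hleft : ∀ t, 0 < t → (∀ r < t, P r) → P t)
    (hright : ∀ t, P t → ∀ᶠ r in 𝓝[>] t, P r) (t : ℝ≥0) : P t := by
  by_contra hcon
  set S : Set ℝ≥0 := {t | ¬ P t} with hS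
  have hne : S.Nonempty := ⟨t, hcon⟩
  -- The infimum of the failures is not a failure, by `hleft`; then `hright` keeps failures away
  -- from it on the right.
  set s := sInf S with hs
  have hlow : ∀ r < s, P r := fun r hr => by
    by_contra h
    exact (csInf_le (OrderBot.bddBelow S) h).not_gt hr
  have hPs : P s := by
    rcases eq_or_lt_of_le (zero_le (a := s)) with h | h
    · rwa [← h]
    · exact hleft s h hlow
  have hev := hright s hPs
  obtain ⟨u, hu, hu'⟩ := mem_nhdsGT_iff_exists_Ioo_subset.1 hev
  obtain ⟨v, hvS, hv⟩ := exists_lt_of_csInf_lt hne (show sInf S < u from hu)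
  rcases eq_or_lt_of_le (csInf_le (OrderBot.bddBelow S) hvS) with h | h
  · exact hvS (h ▸ hPs)
  · exact hvS (hu' ⟨h, hv⟩)

/-! ### Accumulated intensity and the survival function -/

section Cumulative

variable {E : Type*} [MeasurableSpace E] {ν : Measure E} [SigmaFinite ν]

theorem time_null {N : Set ℝ≥0} (hN : lebesgue N = 0) :
    (ν.prod lebesgue) (univ ×ˢ N) = 0 := by
  rw [Measure.prod_prod, hN, mul_zero]

theorem ae_time {p : ℝ≥0 → Prop} (hp : ∀ᵐ s ∂lebesgue, p s) :
    ∀ᵐ y ∂(ν.prod lebesgue), p y.2 := by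
  refine measure_mono_null ?_ (time_null (ν := ν) (N := {s | ¬ p s}) hp)
  intro y hy
  exact ⟨mem_univ _, hy⟩

theorem ae_time_ne (t : ℝ≥0) : ∀ᵐ y ∂(ν.prod lebesgue), y.2 ≠ t :=
  ae_time (p := fun s => s ≠ t) (measure_mono_null (fun s hs => by simpa using hs)
    (measure_singleton t))

theorem slab_zero_ae_eq (t : ℝ≥0) : slab E 0 t =ᵐ[ν.prod lebesgue] upTo E t := by
  filter_upwards [ae_time_ne (ν := ν) 0] with y hy
  refine propext ⟨fun h => ⟨h.1, h.2.2⟩, fun h => ⟨h.1, pos_iff_ne_zero.2 hy, h.2⟩⟩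

theorem before_ae_eq (t : ℝ≥0) : before E t =ᵐ[ν.prod lebesgue] upTo E t := by
  filter_upwards [ae_time_ne (ν := ν) t] with y hy
  refine propext ⟨fun h => ⟨h.1, (mem_Iio.1 h.2).le⟩, fun h => ⟨h.1, lt_of_le_of_ne (mem_Iic.1 h.2) hy⟩⟩

theorem tendsto_measure_upTo_left (m : Measure (E × ℝ≥0)) {t : ℝ≥0} (ht : 0 < t) :
    Tendsto (fun r => m (upTo E r)) (𝓝[<] t) (𝓝 (m (before E t))) := by
  have hmono : Monotone fun r => m (upTo E r) := fun r s hrs =>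
    measure_mono (prod_mono le_rfl (Iic_subset_Iic.2 hrs))
  obtain ⟨u, hu, hut, hul⟩ := exists_seq_strictMono_tendsto' ht
  have hunion : before E t = ⋃ n, upTo E (u n) := by
    ext y
    simp only [before, upTo, mem_prod, mem_univ, true_and, mem_Iio, mem_iUnion, mem_Iic]
    constructor
    · intro h
      obtain ⟨n, hn⟩ := (hul.eventually (lt_mem_nhds h)).exists
      exact ⟨n, hn.le⟩
    · rintro ⟨n, hn⟩
      exact hn.trans_lt (hut n).2
  have h1 : Tendsto (fun n => m (upTo E (u n))) atTop (𝓝 (m (before E t))) := by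
    rw [hunion]
    exact tendsto_measure_iUnion_atTop fun i j hij => hmono.comp hu.monotone hij |> fun _ =>
      prod_mono le_rfl (Iic_subset_Iic.2 (hu.monotone hij))
  have h2 := hmono.tendsto_nhdsLT t
  have hu' : Tendsto u atTop (𝓝[<] t) :=
    tendsto_nhdsWithin_iff.2 ⟨hul, Eventually.of_forall fun n => (hut n).2⟩
  rwa [← tendsto_nhds_unique h1 (h2.comp hu')] at h2

/-- Monotone accumulation of a nonnegative density over `E × [0, t]`. -/
def cum (ν : Measure E) (g : E × ℝ≥0 → ℝ≥0) (t : ℝ≥0) : ℝ≥0∞ :=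
  ∫⁻ y in upTo E t, g y ∂(ν.prod lebesgue)

variable {g : E × ℝ≥0 → ℝ≥0}

theorem cum_mono : Monotone (cum ν g) := fun _ _ hrs =>
  lintegral_mono_set (prod_mono le_rfl (Iic_subset_Iic.2 hrs))

theorem measurable_cum : Measurable (cum ν g) := cum_mono.measurable

/-- Left continuity is continuity of a measure from below, so it includes the value `∞`. Right
continuity may fail: the accumulated intensity can jump from a finite value to `∞`. -/
theorem cum_tendsto_left {t : ℝ≥0} (ht : 0 < t) :
    Tendsto (cum ν g) (𝓝[<] t) (𝓝 (cum ν g t)) := by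
  have h := tendsto_measure_upTo_left ((ν.prod lebesgue).withDensity fun y => (g y : ℝ≥0∞)) ht
  simp only [withDensity_apply _ (measurableSet_upTo _),
    withDensity_apply _ (measurableSet_before _)] at h
  rwa [setLIntegral_congr (before_ae_eq (ν := ν) t)] at h

theorem upTo_eq_union {a t : ℝ≥0} (h : a ≤ t) : upTo E t = upTo E a ∪ slab E a t := by
  rw [upTo, upTo, slab, ← prod_union, Iic_union_Ioc_eq_Iic h]

theorem disjoint_upTo_slab (a t : ℝ≥0) : Disjoint (upTo E a) (slab E a t) :=
  Disjoint.set_prod_right (Iic_disjoint_Ioc le_rfl) _ _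

theorem cum_add_slab {a t : ℝ≥0} (h : a ≤ t) :
    cum ν g t = cum ν g a + ∫⁻ y in slab E a t, g y ∂(ν.prod lebesgue) := by
  rw [cum, upTo_eq_union h, lintegral_union (measurableSet_slab _ _) (disjoint_upTo_slab _ _)]
  rfl

theorem cum_zero : cum ν g 0 = 0 := by
  rw [cum, ← setLIntegral_congr (slab_zero_ae_eq (ν := ν) 0)]
  simp [slab]

theorem integrableOn_slab_coe {a b : ℝ≥0} (hg : Measurable g)
    (hfin : ∫⁻ y in slab E a b, g y ∂(ν.prod lebesgue) ≠ ∞) :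
    IntegrableOn (fun y => (g y : ℝ)) (slab E a b) (ν.prod lebesgue) := by
  refine ⟨hg.coe_nnreal_real.aestronglyMeasurable, ?_⟩
  rw [hasFiniteIntegral_iff_ofReal (Eventually.of_forall fun y => (g y).coe_nonneg)]
  simpa using hfin.lt_top

theorem hasDens_integral {f : E × ℝ≥0 → ℝ} {a b : ℝ≥0}
    (hf : IntegrableOn f (slab E a b) (ν.prod lebesgue)) :
    HasDens ν (fun t => ∫ y in slab E a t, f y ∂(ν.prod lebesgue)) f a b :=
  ⟨hf, fun t _ => by simp [slab]⟩

theorem integral_slab_coe {a b : ℝ≥0} (hg : Measurable g) :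
    ∫ y in slab E a b, (g y : ℝ) ∂(ν.prod lebesgue) =
      (∫⁻ y in slab E a b, g y ∂(ν.prod lebesgue)).toReal := by
  rw [integral_eq_lintegral_of_nonneg_ae (Eventually.of_forall fun y => (g y).coe_nonneg)
    hg.coe_nnreal_real.aestronglyMeasurable]
  simp

theorem hasDens_negExp_of_finite {a b : ℝ≥0} (hg : Measurable g)
    (hfin : ∫⁻ y in slab E a b, g y ∂(ν.prod lebesgue) ≠ ∞) :
    HasDens ν (fun t => negExp (∫⁻ y in slab E a t, g y ∂(ν.prod lebesgue)))
      (fun y => -(g y * negExp (∫⁻ z in slab E a y.2, g z ∂(ν.prod lebesgue)))) a b := by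
  rcases lt_or_ge b a with hab | hab
  · refine ⟨?_, fun t ht => absurd (ht.1.trans ht.2) hab.not_ge⟩
    rw [slab, Ioc_eq_empty_of_le hab.le, prod_empty]
    exact integrableOn_empty
  have hle : ∀ t ≤ b, ∫⁻ y in slab E a t, g y ∂(ν.prod lebesgue) ≠ ∞ := fun t ht =>
    ne_top_of_le_ne_top hfin (lintegral_mono_set (slab_mono le_rfl ht))
  have h := ((hasDens_integral (integrableOn_slab_coe hg hfin)).const_mul (-1)).exp
  have heq : ∀ t ≤ b, Real.exp (-1 * ∫ y in slab E a t, (g y : ℝ) ∂(ν.prod lebesgue)) =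
      negExp (∫⁻ y in slab E a t, g y ∂(ν.prod lebesgue)) := fun t ht => by
    rw [negExp_of_ne_top (hle t ht), integral_slab_coe hg, neg_one_mul]
  refine (h.congr hab fun t ht => (heq t ht.2).symm).congr_dens
    (Eventually.of_forall fun y hy => ?_)
  rw [heq _ hy.2.2]
  ring

/-- For an integrable intensity the integral equals `1 - exp(-∫g)`. In general `g` is cut off at
height `n` and to a set of marks of finite measure; the cut-off lowers the accumulated intensity and
so only enlarges the exponential factor. Monotone convergence finishes the argument. -/
theorem lintegral_mul_negExp_le_one (hg : Measurable g) (t : ℝ≥0) :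
    ∫⁻ y in upTo E t, g y * ENNReal.ofReal (negExp (cum ν g y.2)) ∂(ν.prod lebesgue) ≤ 1 := by
  rw [← setLIntegral_congr (slab_zero_ae_eq (ν := ν) t)]
  set gn : ℕ → E × ℝ≥0 → ℝ≥0 := fun n y =>
    (spanningSets ν n ×ˢ univ).indicator (fun y => min (g y) n) y with hgn
  have hmeasS : ∀ n, MeasurableSet (spanningSets ν n ×ˢ (univ : Set ℝ≥0)) := fun n =>
    (measurableSet_spanningSets ν n).prod MeasurableSet.univ
  have hmeas : ∀ n, Measurable (gn n) := fun n =>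
    (hg.min measurable_const).indicator (hmeasS n)
  have hle : ∀ n y, gn n y ≤ g y := fun n y => by
    simp only [hgn, indicator]
    split_ifs
    · exact min_le_left _ _
    · exact zero_le
  have hmonon : ∀ y, Monotone fun n => gn n y := by
    intro y m n hmn
    simp only [hgn, indicator]
    split_ifs with h1 h2 h2
    · exact min_le_min le_rfl (by exact_mod_cast hmn)
    · exact absurd ⟨monotone_spanningSets ν hmn h1.1, mem_univ _⟩ h2
    · exact zero_le
    · exact le_rfl
  have hsup : ∀ y, ⨆ n, (gn n y : ℝ≥0∞) = g y := by
    intro y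
    refine le_antisymm (iSup_le fun n => by exact_mod_cast hle n y) ?_
    obtain ⟨n₁, hn₁⟩ : ∃ n, y.1 ∈ spanningSets ν n := by
      have := mem_univ y.1
      rwa [← iUnion_spanningSets ν, mem_iUnion] at this
    obtain ⟨n₂, hn₂⟩ := exists_nat_ge (g y)
    refine le_iSup_of_le (max n₁ n₂) ?_
    have h1 : y.1 ∈ spanningSets ν (max n₁ n₂) := monotone_spanningSets ν (le_max_left _ _) hn₁
    have h2 : g y ≤ ((max n₁ n₂ : ℕ) : ℝ≥0) := hn₂.trans (by exact_mod_cast le_max_right _ _)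
    simp only [hgn, indicator, mem_prod, h1, mem_univ, and_true, if_true, min_eq_left h2, le_refl]
  have hfin : ∀ n, ∫⁻ y in slab E 0 t, gn n y ∂(ν.prod lebesgue) ≠ ∞ := by
    intro n
    have h1 : ∫⁻ y in slab E 0 t, gn n y ∂(ν.prod lebesgue) ≤
        ∫⁻ y in slab E 0 t, (spanningSets ν n ×ˢ univ).indicator (fun _ => (n : ℝ≥0∞)) y
          ∂(ν.prod lebesgue) := by
      refine lintegral_mono fun y => ?_
      simp only [hgn, indicator]
      split_ifs
      · exact_mod_cast min_le_right _ _
      · simp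
    refine ne_top_of_le_ne_top ?_ h1
    rw [lintegral_indicator (hmeasS n), setLIntegral_const, Measure.restrict_apply (hmeasS n),
      slab, prod_inter_prod, Measure.prod_prod]
    refine ENNReal.mul_ne_top (by simp) (ENNReal.mul_ne_top ?_ ?_)
    · rw [inter_univ]; exact (measure_spanningSets_lt_top ν n).ne
    · rw [univ_inter, lebesgue_apply]
      refine ne_top_of_le_ne_top (measure_Icc_lt_top (a := (0:ℝ)) (b := t)).ne (measure_mono ?_)
      rintro _ ⟨s, hs, rfl⟩
      exact ⟨s.2, by exact_mod_cast hs.2⟩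
  have hn : ∀ n, ∫⁻ y in slab E 0 t, gn n y * ENNReal.ofReal (negExp (cum ν g y.2))
      ∂(ν.prod lebesgue) ≤ 1 := by
    intro n
    have hd := hasDens_negExp_of_finite (hmeas n) (hfin n)
    have hi := hd.2 t ⟨zero_le, le_rfl⟩
    calc _ ≤ ∫⁻ y in slab E 0 t, ENNReal.ofReal
          (gn n y * negExp (∫⁻ z in slab E 0 y.2, gn n z ∂(ν.prod lebesgue)))
          ∂(ν.prod lebesgue) := by
          refine lintegral_mono fun y => ?_
          rw [ENNReal.ofReal_mul (gn n y).coe_nonneg, ENNReal.ofReal_coe_nnreal]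
          gcongr
          refine negExp_antitone ?_
          rw [cum, ← setLIntegral_congr (slab_zero_ae_eq (ν := ν) y.2)]
          exact lintegral_mono fun z => ENNReal.coe_le_coe.2 (hle n z)
      _ = ENNReal.ofReal (∫ y in slab E 0 t,
          (gn n y * negExp (∫⁻ z in slab E 0 y.2, gn n z ∂(ν.prod lebesgue)))
          ∂(ν.prod lebesgue)) := by
          rw [ofReal_integral_eq_lintegral_ofReal]
          · simpa [IntegrableOn] using hd.1.neg
          · exact Eventually.of_forall fun y => mul_nonneg (gn n y).coe_nonneg (negExp_nonneg _)
      _ ≤ ENNReal.ofReal 1 := by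
          refine ENNReal.ofReal_le_ofReal ?_
          rw [integral_neg] at hi
          beta_reduce at hi
          have h0 : negExp (∫⁻ y in slab E 0 0, (gn n y : ℝ≥0∞) ∂(ν.prod lebesgue)) = 1 := by
            simp [slab, negExp_zero]
          have hpos := negExp_nonneg (∫⁻ y in slab E 0 t, (gn n y : ℝ≥0∞) ∂(ν.prod lebesgue))
          rw [h0] at hi
          linarith
      _ = 1 := by simp
  have hlim : ∫⁻ y in slab E 0 t, g y * ENNReal.ofReal (negExp (cum ν g y.2)) ∂(ν.prod lebesgue) =
      ⨆ n, ∫⁻ y in slab E 0 t, gn n y * ENNReal.ofReal (negExp (cum ν g y.2))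
        ∂(ν.prod lebesgue) := by
    rw [← lintegral_iSup]
    · refine lintegral_congr fun y => ?_
      rw [← ENNReal.iSup_mul, hsup]
    · intro n
      exact (hmeas n).coe_nnreal_ennreal.mul
        (measurable_negExp.comp (measurable_cum.comp measurable_snd)).ennreal_ofReal
    · intro m n hmn y
      have : gn m y ≤ gn n y := hmonon y hmn
      dsimp only
      gcongr
  rw [hlim]
  exact iSup_le hn

/-- `1 - ∫ g exp (-cum g)`: the continuous version of `exp (-cum g)`. -/
def survival (ν : Measure E) (g : E × ℝ≥0 → ℝ≥0) (t : ℝ≥0) : ℝ :=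
  1 - (∫⁻ y in upTo E t, g y * ENNReal.ofReal (negExp (cum ν g y.2)) ∂(ν.prod lebesgue)).toReal

/-- The bound by one makes the density integrable for every measurable `g`. Hence `survival` is
continuous without any assumption; it equals `exp(-cum)` while `cum` is finite, and may stay
positive after `cum` has jumped to `∞`. -/
theorem hasDens_survival (hg : Measurable g) (b : ℝ≥0) :
    HasDens ν (survival ν g) (fun y => -(g y * negExp (cum ν g y.2))) 0 b := by
  have hm : Measurable fun y : E × ℝ≥0 => (g y * negExp (cum ν g y.2) : ℝ) :=
    hg.coe_nnreal_real.mul (measurable_negExp.comp (measurable_cum.comp measurable_snd))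
  have hnn : ∀ y, (0:ℝ) ≤ g y * negExp (cum ν g y.2) := fun y =>
    mul_nonneg (g y).coe_nonneg (negExp_nonneg _)
  have hof : ∀ y, ENNReal.ofReal (g y * negExp (cum ν g y.2)) =
      g y * ENNReal.ofReal (negExp (cum ν g y.2)) := fun y => by
    rw [ENNReal.ofReal_mul (g y).coe_nonneg, ENNReal.ofReal_coe_nnreal]
  have hint : IntegrableOn (fun y => (g y * negExp (cum ν g y.2) : ℝ)) (slab E 0 b)
      (ν.prod lebesgue) := by
    refine ⟨hm.aestronglyMeasurable, ?_⟩
    rw [hasFiniteIntegral_iff_ofReal (Eventually.of_forall hnn)]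
    simp only [hof]
    rw [setLIntegral_congr (slab_zero_ae_eq (ν := ν) b)]
    exact (lintegral_mul_negExp_le_one hg b).trans_lt ENNReal.one_lt_top
  have heq : ∀ t, survival ν g t =
      1 - ∫ y in slab E 0 t, (g y * negExp (cum ν g y.2) : ℝ) ∂(ν.prod lebesgue) := by
    intro t
    rw [survival, integral_eq_lintegral_of_nonneg_ae (Eventually.of_forall hnn)
      hm.aestronglyMeasurable]
    simp only [hof]
    rw [setLIntegral_congr (slab_zero_ae_eq (ν := ν) t)]
  refine ⟨hint.neg, fun t ht => ?_⟩
  rw [heq, heq, integral_neg]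
  simp [slab]
  ring

theorem continuous_survival (hg : Measurable g) : Continuous (survival ν g) := by
  refine continuous_iff_continuousAt.2 fun t => ?_
  refine ((hasDens_survival hg (t + 1)).continuousOn t ⟨zero_le, le_self_add⟩).continuousAt ?_
  exact mem_of_superset (Iio_mem_nhds (lt_add_of_pos_right t one_pos))
    fun s hs => ⟨zero_le, (mem_Iio.1 hs).le⟩

theorem survival_zero : survival ν g 0 = 1 := by
  rw [survival, ← setLIntegral_congr (slab_zero_ae_eq (ν := ν) 0)]
  simp [slab]

theorem survival_nonneg (hg : Measurable g) (t : ℝ≥0) : 0 ≤ survival ν g t := by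
  rw [survival, sub_nonneg, ← ENNReal.toReal_one]
  exact ENNReal.toReal_mono ENNReal.one_ne_top (lintegral_mul_negExp_le_one hg t)

theorem survival_antitone (hg : Measurable g) : Antitone (survival ν g) := by
  intro s t hst
  rw [survival, survival]
  refine sub_le_sub_left (ENNReal.toReal_mono ?_ ?_) _
  · exact ne_top_of_le_ne_top ENNReal.one_ne_top (lintegral_mul_negExp_le_one hg t)
  · exact lintegral_mono_set (prod_mono le_rfl (Iic_subset_Iic.2 hst))

/-- Uniqueness for `R' = -g R`, where `g ≥ 0` need not be integrable. -/
theorem HasDens.eq_mul_negExp {R : ℝ≥0 → ℝ} {a b : ℝ≥0} (hg : Measurable g)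
    (hR : HasDens ν R (fun y => -(g y * R y.2)) a b) {t : ℝ≥0} (ht : t ∈ Icc a b) :
    R t = R a * negExp (∫⁻ y in slab E a t, g y ∂(ν.prod lebesgue)) := by
  replace hR := hR.mono_right ht.2
  have hat := ht.1
  clear ht
  by_cases hfin : ∫⁻ y in slab E a t, g y ∂(ν.prod lebesgue) = ∞
  · rw [hfin, negExp_top, mul_zero]
    by_contra hne
    have hsq := hR.mul hR
    -- `R²` is nonincreasing, so `|R| ≥ |R t|` on the whole interval. If `R t` were nonzero, `g |R|`
    -- would not be integrable.
    have hlow : ∀ s ∈ Icc a t, |R t| ≤ |R s| := by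
      intro s hs
      have h := hsq.sub_eq hs.1 hs.2 le_rfl
      have hneg : ∫ y in slab E s t, (-(g y * R y.2) * R y.2 + -(g y * R y.2) * R y.2)
          ∂(ν.prod lebesgue) ≤ 0 := by
        refine integral_nonpos fun y => ?_
        have : 0 ≤ (g y : ℝ) * (R y.2 * R y.2) := mul_nonneg (g y).coe_nonneg (mul_self_nonneg _)
        simp only [Pi.zero_apply]
        nlinarith
      exact sq_le_sq.1 (by nlinarith)
    have hi := hR.1.2
    rw [hasFiniteIntegral_iff_norm] at hi
    have hge : ENNReal.ofReal |R t| * ∫⁻ y in slab E a t, g y ∂(ν.prod lebesgue) ≤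
        ∫⁻ y in slab E a t, ENNReal.ofReal ‖-(g y * R y.2)‖ ∂(ν.prod lebesgue) := by
      rw [← lintegral_const_mul _ hg.coe_nnreal_ennreal]
      refine setLIntegral_mono' (measurableSet_slab _ _) fun y hy => ?_
      rw [norm_neg, norm_mul, ENNReal.ofReal_mul (norm_nonneg _), mul_comm]
      simp only [Real.norm_eq_abs, NNReal.abs_eq, ENNReal.ofReal_coe_nnreal]
      exact mul_le_mul_right (ENNReal.ofReal_le_ofReal (hlow _ ⟨hy.2.1.le, hy.2.2⟩)) _
    rw [hfin, ENNReal.mul_top (by simpa using hne)] at hge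
    exact (hge.trans_lt hi).ne rfl
  -- With a finite integral of `g` the integrating factor works: `R exp(∫g)` has density zero.
  · have hd := ((hasDens_integral (integrableOn_slab_coe hg hfin))).exp
    have hm := (hR.mul hd).2 t ⟨hat, le_rfl⟩
    have h0 : ∀ y : E × ℝ≥0,
        -(g y * R y.2) * Real.exp (∫ z in slab E a y.2, (g z : ℝ) ∂(ν.prod lebesgue)) +
        g y * Real.exp (∫ z in slab E a y.2, (g z : ℝ) ∂(ν.prod lebesgue)) * R y.2 = 0 := by
      intro y; ring
    simp only [h0, integral_zero, add_zero] at hm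
    rw [negExp_of_ne_top hfin, ← integral_slab_coe hg, Real.exp_neg]
    rw [eq_mul_inv_iff_mul_eq₀ (Real.exp_ne_zero _), hm]
    simp [slab]

end Cumulative

theorem measurable_of_forall_eq {α β : Type*} [MeasurableSpace α] [MeasurableSpace β]
    {f g : α → β} (hf : Measurable f) (h : ∀ a, g a = f a) : Measurable g := by
  rwa [funext h]

/-! ### Measurability of operations on configurations and states -/

section FinPart

variable {A : Type*} [MeasurableSpace A]

/-- The identity kernel on finite measures, and zero on infinite ones. -/
def finPart (A : Type*) [MeasurableSpace A] : Kernel (Measure A) A :=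
  Kernel.sum fun n : ℕ =>
    { toFun := fun m => open Classical in
        if m univ < ∞ ∧ ⌊(m univ).toReal⌋₊ = n then m else 0
      measurable' := by
        refine Measurable.ite ?_ measurable_id measurable_const
        have h : Measurable fun m : Measure A => m univ := Measure.measurable_coe MeasurableSet.univ
        exact (h measurableSet_Iio).inter
          ((Nat.measurable_floor.comp h.ennreal_toReal) (measurableSet_singleton n)) }

theorem finPart_of_lt {m : Measure A} (hm : m univ < ∞) : finPart A m = m := by
  classical
  ext s hs
  rw [finPart, Kernel.sum_apply' _ _ hs, tsum_eq_single ⌊(m univ).toReal⌋₊]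
  · simp [Kernel.coe_mk, hm]
  · intro n hn
    simp [Kernel.coe_mk, hm, hn.symm]

theorem finPart_of_finite (m : Measure A) [IsFiniteMeasure m] : finPart A m = m :=
  finPart_of_lt (measure_lt_top m _)

theorem finPart_of_not_lt {m : Measure A} (hm : ¬ m univ < ∞) : finPart A m = 0 := by
  classical
  ext s hs
  rw [finPart, Kernel.sum_apply' _ _ hs]
  simp [Kernel.coe_mk, hm]

/-- The piece with index `n` has mass at most `n + 1`. S-finiteness makes integrals against a
variable finite measure measurable in that measure; the identity kernel on all measures would not be
s-finite. -/
instance : IsSFiniteKernel (finPart A) := by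
  classical
  refine @Kernel.isSFiniteKernel_sum _ _ _ _ _ _ _ fun n => ?_
  refine @Kernel.IsFiniteKernel.isSFiniteKernel _ _ _ _ _ ⟨⟨(n : ℝ≥0∞) + 1, by finiteness, ?_⟩⟩
  intro m
  simp only [Kernel.coe_mk]
  split_ifs with h
  · rw [← ENNReal.ofReal_toReal h.1.ne]
    refine (ENNReal.ofReal_le_ofReal (Nat.lt_floor_add_one _).le).trans ?_
    rw [h.2, ENNReal.ofReal_add (by positivity) zero_le_one]
    simp
  · simp

theorem measurable_finPart_restrict :
    Measurable fun p : ℝ≥0 × Measure (A × ℝ≥0) =>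
      (finPart (A × ℝ≥0) p.2).restrict (univ ×ˢ Iio p.1) := by
  refine Measure.measurable_of_measurable_coe _ fun B hB => ?_
  simp only [Measure.restrict_apply hB]
  have hS : MeasurableSet {q : (ℝ≥0 × Measure (A × ℝ≥0)) × (A × ℝ≥0) |
      q.2 ∈ B ∧ q.2.2 < q.1.1} := by
    have h2 : MeasurableSet {q : (ℝ≥0 × Measure (A × ℝ≥0)) × (A × ℝ≥0) | q.2.2 < q.1.1} :=
      measurableSet_lt (measurable_snd.comp measurable_snd) (measurable_fst.comp measurable_fst)
    exact (measurable_snd hB).inter h2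
  have h := Kernel.measurable_kernel_prodMk_left
    (κ := (finPart (A × ℝ≥0)).comap (Prod.snd : ℝ≥0 × Measure (A × ℝ≥0) → _) measurable_snd) hS
  refine measurable_of_forall_eq h fun p => ?_
  rw [Kernel.comap_apply]
  congr 1
  ext z
  simp

theorem measurable_finPart_before :
    Measurable fun p : Measure (A × ℝ≥0) × (A × ℝ≥0) =>
      finPart (A × ℝ≥0) p.1 (before A p.2.2) := by
  have h := (Measure.measurable_coe (MeasurableSet.univ (α := A × ℝ≥0))).comp
    ((measurable_finPart_restrict (A := A)).comp
      ((measurable_snd.comp measurable_snd).prodMk measurable_fst :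
        Measurable fun p : Measure (A × ℝ≥0) × (A × ℝ≥0) => (p.2.2, p.1)))
  refine measurable_of_forall_eq h fun p => ?_
  simp [before]

end FinPart

section Trunc

variable {E : Type*} [MeasurableSpace E]

/-- The part of the state strictly before time `s`. -/
def trunc (s : ℝ≥0) (x : State E) : State E :=
  ((finPart _ x.1).restrict (before Bool s), (finPart _ x.2).restrict (before E s))

theorem measurable_trunc : Measurable fun p : ℝ≥0 × State E => trunc p.1 p.2 := by
  refine Measurable.prodMk ?_ ?_
  · exact measurable_finPart_restrict.comp
      (measurable_fst.prodMk (measurable_fst.comp measurable_snd))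
  · exact measurable_finPart_restrict.comp
      (measurable_fst.prodMk (measurable_snd.comp measurable_snd))

theorem measurable_addPoint (d : Bool) :
    Measurable fun p : (E × ℝ≥0) × State E => addPoint d p.1 p.2 := by
  refine Measurable.prodMk ?_ ?_
  · refine (measurable_fst.comp measurable_snd).add ?_
    exact Measure.measurable_dirac.comp
      (measurable_const.prodMk (measurable_snd.comp measurable_fst))
  · exact (measurable_snd.comp measurable_snd).add (Measure.measurable_dirac.comp measurable_fst)

theorem measurable_active : Measurable (active : State E → ℝ) := by
  classical
  have hset : MeasurableSet {x : State E | ∃ r : ℚ≥0, x.1 ({true} ×ˢ Ici (r : ℝ≥0)) ≠ 0 ∧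
      x.1 ({false} ×ˢ Ici (r : ℝ≥0)) = 0} := by
    simp only [ofPred_exists]
    refine MeasurableSet.iUnion fun r => ?_
    have h : ∀ b : Bool, Measurable fun x : State E => x.1 ({b} ×ˢ Ici (r : ℝ≥0)) := fun b =>
      (Measure.measurable_coe ((measurableSet_singleton b).prod measurableSet_Ici)).comp
        measurable_fst
    exact ((h true) (measurableSet_singleton 0)).compl.inter ((h false) (measurableSet_singleton 0))
  unfold active
  refine Measurable.ite ?_ measurable_const measurable_const
  convert hset

theorem active_eq_zero_or_one (x : State E) : active x = 0 ∨ active x = 1 := by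
  classical
  unfold active
  split_ifs <;> simp

theorem measurable_fNew {p : ℝ} {f : State E → ℝ} (hf : Measurable f) (y : E × ℝ≥0) :
    Measurable (fNew p f y) := by
  have h : ∀ d, Measurable fun x : State E => f (addPoint d y x) := fun d =>
    hf.comp ((measurable_addPoint d).comp (measurable_const.prodMk measurable_id))
  exact ((measurable_const.sub measurable_active).mul (h true)).add
    (measurable_active.mul (((h false).const_mul _).add ((h true).const_mul _)))

end Trunc

/-! ### The likelihood as a functional of the state, and the random step at an observed point -/

namespace Params

variable {E : Type*} [MeasurableSpace E] (θ : Params E)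

/-- The intensity along the history recorded in the state `x`. -/
def rateAt (x : State E) (y : E × ℝ≥0) : ℝ≥0 := θ.rate y (trunc y.2 x)

/-- The accumulated reference intensity. -/
def cumQ (t : ℝ≥0) : ℝ := (θ.mean₁ (upTo E t)).toReal

/-- The continuous part of the likelihood. -/
def surv (t : ℝ≥0) (x : State E) : ℝ := survival θ.ν (θ.rateAt x) t

/-- The likelihood ratio of the event `y`. -/
def ratio (x : State E) (y : E × ℝ≥0) : ℝ := θ.rateAt x y / θ.rateQ y

/-- Exponent of the inverse jump factors that are larger than one. -/
def jumpPos (x : State E) : ℝ≥0∞ := ∫⁻ y, ENNReal.ofReal (Real.log (θ.ratio x y)) ∂(finPart _ x.2)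

/-- `-log`, with the value `∞` at zero. -/
def negLog (a : ℝ) : ℝ≥0∞ := if a = 0 then ∞ else ENNReal.ofReal (-Real.log a)

/-- Exponent of the jump factors that are smaller than one. -/
def jumpNeg (x : State E) : ℝ≥0∞ := ∫⁻ y, negLog (θ.ratio x y) ∂(finPart _ x.2)

/-- The product of the likelihood ratios of the cluster events. -/
def jumps (x : State E) : ℝ := (negExp (θ.jumpPos x))⁻¹ * negExp (θ.jumpNeg x)

/-- The likelihood as a functional of the state. -/
def weight (t : ℝ≥0) (x : State E) : ℝ := θ.jumps x * Real.exp (θ.cumQ t) * θ.surv t x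

variable {θ}

theorem Admissible.measurable_rateAt_uncurry (hθ : θ.Admissible) :
    Measurable fun q : State E × (E × ℝ≥0) => θ.rateAt q.1 q.2 :=
  hθ.measurable_rate.comp (measurable_snd.prodMk
    (measurable_trunc.comp ((measurable_snd.comp measurable_snd).prodMk measurable_fst)))

theorem Admissible.measurable_rateAt (hθ : θ.Admissible) (x : State E) :
    Measurable (θ.rateAt x) := hθ.measurable_rateAt_uncurry.comp measurable_prodMk_left

theorem Admissible.measurable_rate_left (hθ : θ.Admissible) (y : E × ℝ≥0) :
    Measurable (θ.rate y) := hθ.measurable_rate.comp measurable_prodMk_left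

theorem Admissible.measurable_cum (hθ : θ.Admissible) :
    Measurable fun q : State E × ℝ≥0 => cum θ.ν (θ.rateAt q.1) q.2 := by
  have := hθ.sigmaFinite
  have h : Measurable fun q : (State E × ℝ≥0) × (E × ℝ≥0) =>
      {z : (State E × ℝ≥0) × (E × ℝ≥0) | z.2.2 ≤ z.1.2}.indicator
        (fun z => (θ.rateAt z.1.1 z.2 : ℝ≥0∞)) q := by
    refine Measurable.indicator ?_ ?_
    · exact (hθ.measurable_rateAt_uncurry.comp
        ((measurable_fst.comp measurable_fst).prodMk measurable_snd)).coe_nnreal_ennreal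
    · exact measurableSet_le (measurable_snd.comp measurable_snd)
        (measurable_snd.comp measurable_fst)
  refine measurable_of_forall_eq (h.lintegral_prod_right' (ν := θ.ν.prod lebesgue)) fun q => ?_
  rw [cum, ← lintegral_indicator (measurableSet_upTo _)]
  refine lintegral_congr fun y => ?_
  simp [indicator, upTo]

theorem Admissible.measurable_cum_left (hθ : θ.Admissible) (t : ℝ≥0) :
    Measurable fun x : State E => cum θ.ν (θ.rateAt x) t :=
  hθ.measurable_cum.comp measurable_prodMk_right

theorem Admissible.measurable_surv (hθ : θ.Admissible) (t : ℝ≥0) : Measurable (θ.surv t) := by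
  have := hθ.sigmaFinite
  have h : Measurable fun q : State E × (E × ℝ≥0) => (θ.rateAt q.1 q.2 : ℝ≥0∞) *
      ENNReal.ofReal (negExp (cum θ.ν (θ.rateAt q.1) q.2.2)) :=
    hθ.measurable_rateAt_uncurry.coe_nnreal_ennreal.mul
      (measurable_negExp.comp (hθ.measurable_cum.comp
        (measurable_fst.prodMk (measurable_snd.comp measurable_snd)))).ennreal_ofReal
  exact measurable_const.sub
    (h.lintegral_prod_right' (ν := (θ.ν.prod lebesgue).restrict (upTo E t))).ennreal_toReal

theorem Admissible.measurable_ratio (hθ : θ.Admissible) :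
    Measurable fun q : State E × (E × ℝ≥0) => θ.ratio q.1 q.2 :=
  hθ.measurable_rateAt_uncurry.coe_nnreal_real.div
    (hθ.measurable_rateQ.comp measurable_snd).coe_nnreal_real

theorem measurable_negLog : Measurable negLog := by
  refine Measurable.ite (measurableSet_singleton 0) measurable_const ?_
  exact Real.measurable_log.neg.ennreal_ofReal

/-- A product over the points of a random configuration becomes measurable once it is written with
exponentials of integrals against the configuration. Ratios above and below one are kept apart, so
that both integrals have nonnegative integrands and a ratio equal to zero contributes `exp(-∞)`. -/
theorem Admissible.measurable_jumps (hθ : θ.Admissible) : Measurable θ.jumps := by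
  set κ : Kernel (State E) (E × ℝ≥0) := (finPart (E × ℝ≥0)).comap Prod.snd measurable_snd with hκ
  have h1 : Measurable θ.jumpPos := by
    refine measurable_of_forall_eq (Measurable.lintegral_kernel_prod_right' (κ := κ)
      (hθ.measurable_ratio.log.ennreal_ofReal)) fun x => ?_
    rfl
  have h2 : Measurable θ.jumpNeg := by
    refine measurable_of_forall_eq (Measurable.lintegral_kernel_prod_right' (κ := κ)
      (measurable_negLog.comp hθ.measurable_ratio)) fun x => ?_
    rfl
  exact (measurable_negExp.comp h1).inv.mul (measurable_negExp.comp h2)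

theorem Admissible.measurable_weight (hθ : θ.Admissible) (t : ℝ≥0) : Measurable (θ.weight t) :=
  (hθ.measurable_jumps.mul_const _).mul (hθ.measurable_surv t)

theorem jumps_nonneg (x : State E) : 0 ≤ θ.jumps x :=
  mul_nonneg (inv_nonneg.2 (negExp_nonneg _)) (negExp_nonneg _)

theorem Admissible.surv_nonneg (hθ : θ.Admissible) (t : ℝ≥0) (x : State E) : 0 ≤ θ.surv t x := by
  have := hθ.sigmaFinite
  exact survival_nonneg (hθ.measurable_rateAt x) t

theorem Admissible.weight_nonneg (hθ : θ.Admissible) (t : ℝ≥0) (x : State E) :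
    0 ≤ θ.weight t x :=
  mul_nonneg (mul_nonneg (jumps_nonneg x) (Real.exp_pos _).le) (hθ.surv_nonneg t x)

variable (θ)

/-- Probability that an observed point is a single event, under the reference measure. -/
def keepW (y : E × ℝ≥0) : ℝ≥0 := θ.γ y / (θ.rateQ y + θ.γ y)

/-- Probability that an observed point is a cluster event, under the reference measure. -/
def joinW (y : E × ℝ≥0) : ℝ≥0 := θ.rateQ y / (θ.rateQ y + θ.γ y)

/-- The law of the state after a cluster event. -/
def clusterStep (y : E × ℝ≥0) (x : State E) : Measure (State E) :=
  ENNReal.ofReal (1 - active x) • Measure.dirac (addPoint true y x) +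
    ENNReal.ofReal (active x) • (ENNReal.ofReal θ.p • Measure.dirac (addPoint false y x) +
      ENNReal.ofReal (1 - θ.p) • Measure.dirac (addPoint true y x))

/-- The law of the state after an observed point. -/
def stepLaw (y : E × ℝ≥0) (x : State E) : Measure (State E) :=
  (θ.keepW y : ℝ≥0∞) • Measure.dirac x + (θ.joinW y : ℝ≥0∞) • θ.clusterStep y x

variable {θ}

theorem Admissible.keepW_add_joinW (hθ : θ.Admissible) (y : E × ℝ≥0) :
    θ.keepW y + θ.joinW y = 1 := by
  rw [keepW, joinW, ← add_div, add_comm, div_self]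
  exact (add_pos_of_pos_of_nonneg (hθ.rateQ_pos y) zero_le).ne'

theorem measurable_clusterStep :
    Measurable fun q : (E × ℝ≥0) × State E => θ.clusterStep q.1 q.2 := by
  have hd : ∀ d, Measurable fun q : (E × ℝ≥0) × State E =>
      Measure.dirac (addPoint d q.1 q.2) := fun d =>
    Measure.measurable_dirac.comp (measurable_addPoint d)
  have ha : Measurable fun q : (E × ℝ≥0) × State E => active q.2 :=
    measurable_active.comp measurable_snd
  refine Measure.measurable_of_measurable_coe _ fun s hs => ?_
  simp only [clusterStep, Measure.coe_add, Measure.coe_smul, Pi.add_apply, Pi.smul_apply,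
    smul_eq_mul]
  have hds := fun d => (Measure.measurable_coe hs).comp (hd d)
  exact ((measurable_const.sub ha).ennreal_ofReal.mul (hds true)).add
    (ha.ennreal_ofReal.mul (((hds false).const_mul _).add ((hds true).const_mul _)))

theorem Admissible.measurable_stepLaw (hθ : θ.Admissible) :
    Measurable fun q : (E × ℝ≥0) × State E => θ.stepLaw q.1 q.2 := by
  have hk : Measurable θ.keepW := hθ.measurable_γ.div (hθ.measurable_rateQ.add hθ.measurable_γ)
  have hj : Measurable θ.joinW := hθ.measurable_rateQ.div (hθ.measurable_rateQ.add hθ.measurable_γ)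
  refine Measure.measurable_of_measurable_coe _ fun s hs => ?_
  simp only [stepLaw, Measure.coe_add, Measure.coe_smul, Pi.add_apply, Pi.smul_apply,
    smul_eq_mul]
  exact ((hk.comp measurable_fst).coe_nnreal_ennreal.mul ((Measure.measurable_coe hs).comp
      (Measure.measurable_dirac.comp measurable_snd))).add
    ((hj.comp measurable_fst).coe_nnreal_ennreal.mul ((Measure.measurable_coe hs).comp
      measurable_clusterStep))

theorem Admissible.isProbabilityMeasure_clusterStep (hθ : θ.Admissible) (y : E × ℝ≥0)
    (x : State E) : IsProbabilityMeasure (θ.clusterStep y x) := by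
  have hp : ENNReal.ofReal θ.p + ENNReal.ofReal (1 - θ.p) = 1 := by
    rw [← ENNReal.ofReal_add hθ.p_nonneg (sub_nonneg.2 hθ.p_le_one)]
    simp
  refine ⟨?_⟩
  rcases active_eq_zero_or_one x with h | h <;> simp [clusterStep, h, hp]

theorem Admissible.isProbabilityMeasure_stepLaw (hθ : θ.Admissible) (y : E × ℝ≥0)
    (x : State E) : IsProbabilityMeasure (θ.stepLaw y x) := by
  have := hθ.isProbabilityMeasure_clusterStep y x
  refine ⟨?_⟩
  simp only [stepLaw, Measure.coe_add, Measure.coe_smul, Pi.add_apply, Pi.smul_apply,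
    measure_univ, smul_eq_mul, mul_one]
  exact_mod_cast hθ.keepW_add_joinW y

/-- `stepLaw` as a kernel. -/
def Admissible.stepKernel (hθ : θ.Admissible) : Kernel ((E × ℝ≥0) × State E) (State E) :=
  ⟨fun q => θ.stepLaw q.1 q.2, hθ.measurable_stepLaw⟩

instance (hθ : θ.Admissible) : IsMarkovKernel hθ.stepKernel :=
  ⟨fun q => hθ.isProbabilityMeasure_stepLaw q.1 q.2⟩

end Params

/-! ### Finitely supported measures and finite counting measures -/

section Atomic

variable {α β : Type*} [MeasurableSpace α] [MeasurableSpace β]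

/-- Finite nonnegative combinations of Dirac measures. -/
def IsAtomic (κ : Measure α) : Prop :=
  κ ∈ Submodule.span ℝ≥0 (range (Measure.dirac : α → Measure α))

namespace IsAtomic

theorem dirac (x : α) : IsAtomic (Measure.dirac x) := Submodule.subset_span ⟨x, rfl⟩

theorem add {κ η : Measure α} (hκ : IsAtomic κ) (hη : IsAtomic η) : IsAtomic (κ + η) :=
  Submodule.add_mem _ hκ hη

theorem smul {κ : Measure α} (hκ : IsAtomic κ) (c : ℝ≥0) : IsAtomic ((c : ℝ≥0∞) • κ) :=
  Submodule.smul_mem _ c hκ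

theorem zero : IsAtomic (0 : Measure α) := Submodule.zero_mem _

theorem exists_sum {κ : Measure α} (hκ : IsAtomic κ) :
    ∃ (s : Finset α) (w : α → ℝ≥0), (∀ x ∈ s, w x ≠ 0) ∧
      κ = ∑ x ∈ s, (w x : ℝ≥0∞) • Measure.dirac x := by
  obtain ⟨c, hc⟩ := Finsupp.mem_span_range_iff_exists_finsupp.1 hκ
  exact ⟨c.support, c, fun x hx => Finsupp.mem_support_iff.1 hx, hc.symm⟩

theorem isFiniteMeasure {κ : Measure α} (hκ : IsAtomic κ) : IsFiniteMeasure κ := by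
  obtain ⟨s, w, -, rfl⟩ := hκ.exists_sum
  refine ⟨?_⟩
  simp [ENNReal.sum_lt_top]

theorem induction {P : Measure α → Prop} (hd : ∀ x, P (Measure.dirac x)) (h0 : P 0)
    (ha : ∀ κ η, IsAtomic κ → IsAtomic η → P κ → P η → P (κ + η))
    (hs : ∀ (c : ℝ≥0) κ, IsAtomic κ → P κ → P ((c : ℝ≥0∞) • κ)) {κ : Measure α}
    (hκ : IsAtomic κ) : P κ := by
  refine Submodule.span_induction (p := fun κ _ => P κ) ?_ h0 ?_ ?_ hκ
  · rintro _ ⟨x, rfl⟩; exact hd x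
  · intro κ η h1 h2; exact ha κ η h1 h2
  · intro c κ h; exact hs c κ h

theorem bind {κ : Measure α} (hκ : IsAtomic κ) {f : α → Measure β} (hf : Measurable f)
    (h : ∀ x, IsAtomic (f x)) : IsAtomic (κ.bind f) := by
  refine hκ.induction (P := fun κ => IsAtomic (κ.bind f)) ?_ ?_ ?_ ?_
  · intro x; rw [Measure.dirac_bind hf]; exact h x
  · simpa using zero
  · intro κ η _ _ h1 h2
    have : (κ + η).bind f = κ.bind f + η.bind f := by
      rw [Measure.bind, Measure.bind, Measure.bind, Measure.map_add _ _ hf]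
      ext s hs
      simp [Measure.join_apply hs]
    rw [this]; exact h1.add h2
  · intro c κ _ h1
    rw [Measure.bind_smul]
    exact h1.smul c

theorem map {κ : Measure α} (hκ : IsAtomic κ) {f : α → β} (hf : Measurable f) :
    IsAtomic (κ.map f) := by
  rw [← Measure.bind_dirac_eq_map _ hf]
  exact hκ.bind (Measure.measurable_dirac.comp hf) fun x => dirac _

theorem prod {κ : Measure α} (hκ : IsAtomic κ) {η : Measure β} (hη : IsAtomic η) :
    IsAtomic (κ.prod η) := by
  have := hη.isFiniteMeasure
  refine hκ.induction (P := fun κ => IsAtomic (κ.prod η)) ?_ ?_ ?_ ?_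
  · intro x; rw [Measure.dirac_prod]; exact hη.map measurable_prodMk_left
  · simpa using zero
  · intro κ κ' hκ hκ' h1 h2
    have := hκ.isFiniteMeasure
    have := hκ'.isFiniteMeasure
    rw [Measure.add_prod]; exact h1.add h2
  · intro c κ hκ h1
    have := hκ.isFiniteMeasure
    rw [Measure.prod_smul_left]; exact h1.smul c

/-- This is the source of the uniformity in `f`: no bound on the function is needed, and the
exceptional null set will not depend on it. -/
theorem integrable {κ : Measure α} (hκ : IsAtomic κ) {f : α → ℝ} (hf : Measurable f) :
    Integrable f κ := by
  refine hκ.induction (P := fun κ => Integrable f κ) ?_ ?_ ?_ ?_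
  · intro x
    refine ⟨hf.aestronglyMeasurable, ?_⟩
    rw [HasFiniteIntegral, lintegral_dirac' _ hf.enorm]
    exact enorm_lt_top
  · exact integrable_zero_measure
  · intro κ η _ _ h1 h2; exact h1.add_measure h2
  · intro c κ _ h1; exact h1.smul_measure ENNReal.coe_ne_top

end IsAtomic

theorem integral_sum_dirac {s : Finset α} {w : α → ℝ≥0} {f : α → ℝ} (hf : Measurable f) :
    ∫ x, f x ∂(∑ x ∈ s, (w x : ℝ≥0∞) • Measure.dirac x) = ∑ x ∈ s, (w x : ℝ) * f x := by
  rw [integral_finsetSum_measure fun x _ => ((IsAtomic.dirac x).smul (w x)).integrable hf]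
  refine Finset.sum_congr rfl fun x _ => ?_
  rw [integral_smul_measure, integral_dirac' _ _ hf.stronglyMeasurable]
  simp

end Atomic

section Counting

variable {α : Type*} [MeasurableSpace α]

/-- Finite counting measures. -/
def IsCounting (m : Measure α) : Prop := ∃ s : Multiset α, m = (s.map Measure.dirac).sum

namespace IsCounting

theorem induction {P : Measure α → Prop} (h0 : P 0)
    (hd : ∀ x m, IsCounting m → P m → P (Measure.dirac x + m)) {m : Measure α}
    (hm : IsCounting m) : P m := by
  obtain ⟨s, rfl⟩ := hm
  induction s using Multiset.induction_on with
  | empty => simpa using h0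
  | cons x s ih =>
    rw [Multiset.map_cons, Multiset.sum_cons]
    exact hd x _ ⟨s, rfl⟩ ih

theorem zero : IsCounting (0 : Measure α) := ⟨0, by simp⟩

theorem dirac (x : α) : IsCounting (Measure.dirac x) := ⟨{x}, by simp⟩

theorem add {m n : Measure α} (hm : IsCounting m) (hn : IsCounting n) : IsCounting (m + n) := by
  obtain ⟨s, rfl⟩ := hm
  obtain ⟨t, rfl⟩ := hn
  exact ⟨s + t, by simp⟩

theorem isAtomic {m : Measure α} (hm : IsCounting m) : IsAtomic m :=
  hm.induction IsAtomic.zero fun x _ _ h => (IsAtomic.dirac x).add h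

theorem isFiniteMeasure {m : Measure α} (hm : IsCounting m) : IsFiniteMeasure m :=
  hm.isAtomic.isFiniteMeasure

theorem restrict {m : Measure α} (hm : IsCounting m) {S : Set α} (hS : MeasurableSet S) :
    IsCounting (m.restrict S) := by
  classical
  refine hm.induction (P := fun m => IsCounting (m.restrict S)) (by simpa using zero)
    fun x m _ h => ?_
  rw [Measure.restrict_add, restrict_dirac' hS]
  split_ifs
  · exact (dirac x).add h
  · simpa using h

theorem exists_nat {m : Measure α} (hm : IsCounting m) {S : Set α} (hS : MeasurableSet S) :
    ∃ n : ℕ, m S = n := by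
  refine hm.induction (P := fun m => ∃ n : ℕ, m S = n) ⟨0, by simp⟩ fun x m _ h => ?_
  obtain ⟨n, hn⟩ := h
  by_cases hx : x ∈ S
  · exact ⟨n + 1, by simp [hS, hx, hn, add_comm]⟩
  · exact ⟨n, by simp [hS, hx, hn]⟩

theorem integrable [MeasurableSingletonClass α] {m : Measure α} (hm : IsCounting m) (f : α → ℝ) :
    Integrable f m :=
  hm.induction (P := fun m => Integrable f m) integrable_zero_measure fun _ _ _ h =>
    (integrable_dirac (by finiteness)).add_measure h

/-- Every atom has mass at least one. -/
theorem ae_one_le [MeasurableSingletonClass α] {m : Measure α} (hm : IsCounting m) :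
    ∀ᵐ y ∂m, 1 ≤ m {y} := by
  refine hm.induction (P := fun m => ∀ᵐ y ∂m, 1 ≤ m {y}) (by simp) fun x m _ h => ?_
  rw [ae_add_measure_iff]
  constructor
  · rw [ae_dirac_eq]
    simp
  · filter_upwards [h] with y hy
    exact hy.trans (by simp)

theorem eq_dirac_of_singleton [MeasurableSingletonClass α] {m : Measure α} (hm : IsCounting m)
    (h1 : m univ = 1) : ∃ y, m = Measure.dirac y := by
  obtain ⟨s, rfl⟩ := hm
  have hcard : ((s.map (Measure.dirac : α → Measure α)).sum) univ = (s.card : ℝ≥0∞) := by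
    clear h1
    induction s using Multiset.induction_on with
    | empty => simp
    | cons x s ih => simp [ih, add_comm]
  rw [hcard] at h1
  have : s.card = 1 := by exact_mod_cast h1
  obtain ⟨y, rfl⟩ := Multiset.card_eq_one.1 this
  exact ⟨y, by simp⟩

end IsCounting

end Counting

/-! ### The filter recursion along the observed points -/

section PathLaw

variable {A : Type*} [MeasurableSpace A]

/-- The points of a finite counting measure that have exactly `k` predecessors. -/
def ptKernel (A : Type*) [MeasurableSpace A] (k : ℕ) : Kernel (Measure (A × ℝ≥0)) (A × ℝ≥0) :=
  open Classical in
  Kernel.withDensity (finPart _) fun m y => if finPart _ m (before A y.2) = k then 1 else 0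

instance (k : ℕ) : IsSFiniteKernel (ptKernel A k) := by
  unfold ptKernel
  exact Kernel.IsSFiniteKernel.withDensity _ fun m y => by split_ifs <;> simp

theorem measurableSet_before_eq (m : Measure (A × ℝ≥0)) [IsFiniteMeasure m] (k : ℕ) :
    MeasurableSet {y : A × ℝ≥0 | m (before A y.2) = k} := by
  have h := (measurable_finPart_before (A := A)).comp (measurable_prodMk_left (x := m))
  have h2 := h (measurableSet_singleton (k : ℝ≥0∞))
  simp only [preimage, Function.comp_apply, finPart_of_finite] at h2
  exact h2

theorem ptKernel_apply (m : Measure (A × ℝ≥0)) [IsFiniteMeasure m] (k : ℕ) :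
    ptKernel A k m = m.restrict {y | m (before A y.2) = k} := by
  classical
  rw [ptKernel, Kernel.withDensity_apply]
  · simp only [finPart_of_finite]
    rw [← withDensity_indicator_one (measurableSet_before_eq m k)]
    refine withDensity_congr_ae ?_
    refine Eventually.of_forall fun y => ?_
    simp [indicator]
  · refine Measurable.ite ?_ measurable_const measurable_const
    exact measurable_finPart_before (measurableSet_singleton (k : ℝ≥0∞))

variable {E : Type*} [MeasurableSpace E] {θ : Params E}

/-- The conditional law of the state given the first `k` observed points. -/
def Params.Admissible.pathLaw (hθ : θ.Admissible) (ρ : Measure (State E)) :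
    ℕ → Kernel (Measure (E × ℝ≥0)) (State E)
  | 0 => Kernel.const _ ρ
  | k + 1 => hθ.stepKernel ∘ₖ (ptKernel E k ×ₖ Params.Admissible.pathLaw hθ ρ k)

variable (hθ : θ.Admissible) (ρ : Measure (State E)) [IsFiniteMeasure ρ]

instance (k : ℕ) : IsSFiniteKernel (hθ.pathLaw ρ k) := by
  induction k with
  | zero => unfold Params.Admissible.pathLaw; infer_instance
  | succ k ih => unfold Params.Admissible.pathLaw; infer_instance

theorem pathLaw_succ (k : ℕ) (m : Measure (E × ℝ≥0)) :
    hθ.pathLaw ρ (k + 1) m = ((ptKernel E k m).prod (hθ.pathLaw ρ k m)).bind hθ.stepKernel := by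
  rw [Params.Admissible.pathLaw, Kernel.comp_apply, Kernel.prod_apply]

theorem pathLaw_congr {m n : Measure (E × ℝ≥0)} {k : ℕ}
    (h : ∀ j < k, ptKernel E j m = ptKernel E j n) : hθ.pathLaw ρ k m = hθ.pathLaw ρ k n := by
  induction k with
  | zero => rfl
  | succ k ih => rw [pathLaw_succ, pathLaw_succ, ih fun j hj => h j (hj.trans k.lt_succ_self),
      h k k.lt_succ_self]

theorem before_mono {s t : ℝ≥0} (h : s ≤ t) : before A s ⊆ before A t :=
  prod_mono le_rfl (Iio_subset_Iio h)

/-- The first `k` steps use only points with fewer than `k` predecessors. If at least `k` points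
precede `s`, all of those points lie before `s`, and their predecessors are not lost by the
restriction. -/
theorem pathLaw_restrict_before {m : Measure (E × ℝ≥0)} [IsFiniteMeasure m] {s : ℝ≥0} {k : ℕ}
    (hk : k ≤ m (before E s)) :
    hθ.pathLaw ρ k (m.restrict (before E s)) = hθ.pathLaw ρ k m := by
  refine pathLaw_congr _ _ fun j hj => ?_
  have hj' : (j : ℝ≥0∞) < m (before E s) := lt_of_lt_of_le (by exact_mod_cast hj) hk
  rw [ptKernel_apply, ptKernel_apply, Measure.restrict_restrict (measurableSet_before_eq _ _)]
  congr 1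
  ext y
  simp only [mem_inter_iff, mem_ofPred_eq, Measure.restrict_apply (measurableSet_before _)]
  constructor
  · rintro ⟨h1, h2⟩
    rwa [inter_eq_left.2 (before_mono (mem_Iio.1 h2.2).le)] at h1
  · intro h
    have hys : y.2 < s := by
      by_contra hcon
      exact (h ▸ hj').not_ge (measure_mono (before_mono (not_lt.1 hcon)))
    refine ⟨?_, mem_univ _, hys⟩
    rwa [inter_eq_left.2 (before_mono hys.le)]

theorem before_lt_univ [MeasurableSingletonClass A] {m : Measure (A × ℝ≥0)} (hm : IsCounting m) :
    ∀ᵐ y ∂m, m (before A y.2) < m univ := by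
  have := hm.isFiniteMeasure
  filter_upwards [hm.ae_one_le] with y hy
  have hsub : before A y.2 ⊆ {y}ᶜ := fun z hz h => by
    rw [mem_singleton_iff.1 h] at hz
    exact lt_irrefl _ (mem_Iio.1 hz.2)
  calc m (before A y.2) ≤ m {y}ᶜ := measure_mono hsub
    _ < m {y}ᶜ + 1 := ENNReal.lt_add_right (measure_ne_top _ _) one_ne_zero
    _ ≤ m {y}ᶜ + m {y} := by gcongr
    _ = m univ := by rw [add_comm, measure_add_measure_compl (measurableSet_singleton y)]

/-- The last point is the only one with exactly `k` predecessors, since each earlier point has fewer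
than the `k` points of `m` before it. Thus step `k + 1` is a single application of `stepLaw`. -/
theorem pathLaw_add_dirac [MeasurableSingletonClass E] {m : Measure (E × ℝ≥0)}
    (hm : IsCounting m) {k : ℕ} (hk : m univ = k) {y : E × ℝ≥0} (hy : ∀ᵐ z ∂m, z.2 < y.2) :
    hθ.pathLaw ρ (k + 1) (m + Measure.dirac y) = (hθ.pathLaw ρ k m).bind (θ.stepLaw y) := by
  classical
  have := hm.isFiniteMeasure
  have hb : m (before E y.2) = k := by
    rw [← hk]
    refine measure_congr (eventuallyEq_univ.2 ?_)
    filter_upwards [hy] with z hz using ⟨mem_univ _, hz⟩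
  have hrest : (m + Measure.dirac y).restrict (before E y.2) = m := by
    rw [Measure.restrict_add, restrict_dirac' (measurableSet_before _), if_neg, add_zero]
    · refine Measure.restrict_eq_self_of_ae_mem ?_
      filter_upwards [hy] with z hz using ⟨mem_univ _, hz⟩
    · exact fun h => lt_irrefl _ (mem_Iio.1 h.2)
  have h1 : hθ.pathLaw ρ k (m + Measure.dirac y) = hθ.pathLaw ρ k m := by
    have h := pathLaw_restrict_before hθ ρ (m := m + Measure.dirac y) (s := y.2) (k := k)
      (by rw [Measure.add_apply, hb]; exact le_self_add)
    rw [← h, hrest]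
  have hS := measurableSet_before_eq (m + Measure.dirac y) k
  have hdy : ∀ z : E × ℝ≥0, z.2 ≤ y.2 → (m + Measure.dirac y) (before E z.2) =
      m (before E z.2) := fun z hz => by
    rw [Measure.add_apply, Measure.dirac_apply' _ (measurableSet_before _), indicator_of_notMem,
      add_zero]
    exact fun h => (not_lt.2 hz) h.2
  have h2 : ptKernel E k (m + Measure.dirac y) = Measure.dirac y := by
    rw [ptKernel_apply, Measure.restrict_add, restrict_dirac' hS, if_pos]
    · rw [Measure.restrict_eq_zero.2, zero_add]
      refine measure_mono_null (t := {z | ¬ (m (before E z.2) < m univ ∧ z.2 < y.2)}) ?_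
        ((before_lt_univ hm).and hy)
      intro z hz hcon
      rw [mem_ofPred_eq, hdy z hcon.2.le] at hz
      exact hcon.1.ne (hz.trans hk.symm)
    · rw [mem_ofPred_eq, hdy y le_rfl, hb]
  rw [pathLaw_succ, h1, h2, Measure.dirac_prod, Measure.bind, Measure.map_map
    hθ.stepKernel.measurable measurable_prodMk_left]
  rfl

/-- The conditional law of the state given the observed points. -/
def Params.Admissible.obsLaw (hθ : θ.Admissible) (ρ : Measure (State E)) [IsFiniteMeasure ρ] :
    Kernel (Measure (E × ℝ≥0)) (State E) :=
  open Classical in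
  Kernel.sum fun k : ℕ => Kernel.withDensity (hθ.pathLaw ρ k)
    fun m _ => if m univ = k then 1 else 0

theorem measurable_ite_univ (k : ℕ) : open Classical in
    Measurable (Function.uncurry fun (m : Measure (E × ℝ≥0)) (_ : State E) =>
      if m univ = k then (1 : ℝ≥0∞) else 0) := by
  refine Measurable.ite ?_ measurable_const measurable_const
  exact ((Measure.measurable_coe MeasurableSet.univ).comp measurable_fst)
    (measurableSet_singleton (k : ℝ≥0∞))

instance : IsSFiniteKernel (hθ.obsLaw ρ) := by
  unfold Params.Admissible.obsLaw
  refine @Kernel.isSFiniteKernel_sum _ _ _ _ _ _ _ fun n => ?_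
  exact Kernel.IsSFiniteKernel.withDensity _ fun m y => by split_ifs <;> simp

theorem obsLaw_apply {m : Measure (E × ℝ≥0)} {k : ℕ} (hk : m univ = k) :
    hθ.obsLaw ρ m = hθ.pathLaw ρ k m := by
  classical
  ext s hs
  rw [Params.Admissible.obsLaw, Kernel.sum_apply' _ _ hs, tsum_eq_single k]
  · rw [Kernel.withDensity_apply' _ (measurable_ite_univ k)]
    simp [hk]
  · intro n hn
    rw [Kernel.withDensity_apply' _ (measurable_ite_univ n)]
    have : (k : ℝ≥0∞) ≠ n := by exact_mod_cast hn.symm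
    simp [hk, this]

theorem Params.isAtomic_stepLaw (y : E × ℝ≥0) (x : State E) : IsAtomic (θ.stepLaw y x) :=
  ((IsAtomic.dirac x).smul _).add ((((IsAtomic.dirac _).smul _).add
    ((((IsAtomic.dirac _).smul _).add ((IsAtomic.dirac _).smul _)).smul _)).smul _)

variable {ρ}

theorem isAtomic_pathLaw (hρ : IsAtomic ρ) {m : Measure (E × ℝ≥0)} (hm : IsCounting m) (k : ℕ) :
    IsAtomic (hθ.pathLaw ρ k m) := by
  have := hm.isFiniteMeasure
  induction k with
  | zero => simpa [Params.Admissible.pathLaw] using hρ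
  | succ k ih =>
    rw [pathLaw_succ, ptKernel_apply]
    exact ((hm.restrict (measurableSet_before_eq m k)).isAtomic.prod ih).bind
      hθ.stepKernel.measurable fun q => Params.isAtomic_stepLaw _ _

theorem isAtomic_obsLaw (hρ : IsAtomic ρ) {m : Measure (E × ℝ≥0)} (hm : IsCounting m) :
    IsAtomic (hθ.obsLaw ρ m) := by
  obtain ⟨k, hk⟩ := hm.exists_nat MeasurableSet.univ
  rw [obsLaw_apply hθ ρ hk]
  exact isAtomic_pathLaw hθ hρ hm k

end PathLaw

theorem nnreal_coe_nnratCast (q : ℚ≥0) : ((q : ℝ≥0) : ℝ) = (q : ℝ) := by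
  rw [NNRat.cast_def, NNRat.cast_def]
  push_cast
  rfl

theorem exists_nnrat_between {a b : ℝ≥0} (h : a < b) : ∃ q : ℚ≥0, a < (q : ℝ≥0) ∧ (q : ℝ≥0) < b := by
  obtain ⟨q, h1, h2⟩ := exists_rat_btwn (NNReal.coe_lt_coe.2 h)
  have hq : 0 ≤ q := by exact_mod_cast a.2.trans h1.le
  lift q to ℚ≥0 using hq
  refine ⟨q, ?_, ?_⟩
  · rw [← NNReal.coe_lt_coe, nnreal_coe_nnratCast]
    exact_mod_cast h1
  · rw [← NNReal.coe_lt_coe, nnreal_coe_nnratCast]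
    exact_mod_cast h2

/-! ### How the state, the indicator of activity and the weight respond to a new point -/

section StateLemmas

variable {E : Type*} [MeasurableSpace E]

/-- The state `x` is finite and carries no points after time `t`. -/
structure EndsBy (t : ℝ≥0) (x : State E) : Prop where
  fst_lt : x.1 univ < ∞
  snd_lt : x.2 univ < ∞
  fst_null : x.1 (univ ×ˢ Ioi t) = 0
  snd_null : x.2 (univ ×ˢ Ioi t) = 0

theorem measurableSet_endsBy (t : ℝ≥0) : MeasurableSet {x : State E | EndsBy t x} := by
  have h1 : ∀ B, MeasurableSet B → Measurable fun x : State E => x.1 B := fun B hB =>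
    (Measure.measurable_coe hB).comp measurable_fst
  have h2 : ∀ B, MeasurableSet B → Measurable fun x : State E => x.2 B := fun B hB =>
    (Measure.measurable_coe hB).comp measurable_snd
  have : {x : State E | EndsBy t x} = ({x | x.1 univ ∈ Iio ∞} ∩ {x | x.2 univ ∈ Iio ∞}) ∩
      ({x | x.1 (univ ×ˢ Ioi t) ∈ ({0} : Set ℝ≥0∞)} ∩
        {x | x.2 (univ ×ˢ Ioi t) ∈ ({0} : Set ℝ≥0∞)}) := by
    ext x
    exact ⟨fun h => ⟨⟨h.1, h.2⟩, h.3, h.4⟩, fun h => ⟨h.1.1, h.1.2, h.2.1, h.2.2⟩⟩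
  rw [this]
  exact ((h1 _ MeasurableSet.univ measurableSet_Iio).inter
    (h2 _ MeasurableSet.univ measurableSet_Iio)).inter
    ((h1 _ (MeasurableSet.univ.prod measurableSet_Ioi) (measurableSet_singleton 0)).inter
      (h2 _ (MeasurableSet.univ.prod measurableSet_Ioi) (measurableSet_singleton 0)))

theorem compl_before (A : Type*) (s : ℝ≥0) : (before A s)ᶜ = univ ×ˢ Ici s := by
  ext y; simp [before]

theorem restrict_before_of_null {A : Type*} [MeasurableSpace A] {m : Measure (A × ℝ≥0)}
    {s : ℝ≥0} (h : m (univ ×ˢ Ici s) = 0) : m.restrict (before A s) = m :=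
  Measure.restrict_eq_self_of_ae_mem (by rwa [← compl_before] at h)

theorem EndsBy.mono {s t : ℝ≥0} {x : State E} (h : EndsBy s x) (hst : s ≤ t) : EndsBy t x :=
  ⟨h.1, h.2, measure_mono_null (prod_mono le_rfl (Ioi_subset_Ioi hst)) h.3,
    measure_mono_null (prod_mono le_rfl (Ioi_subset_Ioi hst)) h.4⟩

theorem EndsBy.fst_Ici {s t : ℝ≥0} {x : State E} (h : EndsBy s x) (hst : s < t) :
    x.1 (univ ×ˢ Ici t) = 0 :=
  measure_mono_null (prod_mono le_rfl (Ici_subset_Ioi.2 hst)) h.3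

theorem EndsBy.snd_Ici {s t : ℝ≥0} {x : State E} (h : EndsBy s x) (hst : s < t) :
    x.2 (univ ×ˢ Ici t) = 0 :=
  measure_mono_null (prod_mono le_rfl (Ici_subset_Ioi.2 hst)) h.4

theorem EndsBy.trunc_eq {s t : ℝ≥0} {x : State E} (h : EndsBy s x) (hst : s < t) :
    trunc t x = x := by
  rw [trunc, finPart_of_lt h.1, finPart_of_lt h.2, restrict_before_of_null (h.fst_Ici hst),
    restrict_before_of_null (h.snd_Ici hst)]

theorem EndsBy.addPoint {s : ℝ≥0} {x : State E} (h : EndsBy s x) {y : E × ℝ≥0}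
    (hy : s ≤ y.2) (d : Bool) : EndsBy y.2 (addPoint d y x) := by
  have h' := h.mono hy
  refine ⟨?_, ?_, ?_, ?_⟩
  · simpa [ClusterFilter.addPoint] using h.1
  · simpa [ClusterFilter.addPoint] using h.2
  · rw [ClusterFilter.addPoint, Measure.add_apply, h'.3,
      Measure.dirac_apply' _ (MeasurableSet.univ.prod measurableSet_Ioi)]
    simp
  · rw [ClusterFilter.addPoint, Measure.add_apply, h'.4,
      Measure.dirac_apply' _ (MeasurableSet.univ.prod measurableSet_Ioi)]
    simp

theorem trunc_addPoint {s : ℝ≥0} {x : State E} (h1 : x.1 univ < ∞) (h2 : x.2 univ < ∞)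
    {y : E × ℝ≥0} (hs : s ≤ y.2) (d : Bool) : trunc s (addPoint d y x) = trunc s x := by
  classical
  have h1' : (addPoint d y x).1 univ < ∞ := by simpa [addPoint] using h1
  have h2' : (addPoint d y x).2 univ < ∞ := by simpa [addPoint] using h2
  rw [trunc, trunc, finPart_of_lt h1, finPart_of_lt h2, finPart_of_lt h1', finPart_of_lt h2',
    addPoint, Measure.restrict_add, Measure.restrict_add,
    restrict_dirac' (measurableSet_before _), restrict_dirac' (measurableSet_before _),
    if_neg, if_neg, add_zero, add_zero]
  · exact fun h => hs.not_gt h.2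
  · exact fun h => hs.not_gt h.2

theorem active_addPoint {x : State E} {y : E × ℝ≥0} {r : ℝ≥0} (hr : r < y.2)
    (hx : x.1 (univ ×ˢ Ici r) = 0) (d : Bool) :
    active (addPoint d y x) = if d then 1 else 0 := by
  classical
  have hxb : ∀ (b : Bool) (q : ℝ≥0), r ≤ q → x.1 ({b} ×ˢ Ici q) = 0 := fun b q hq =>
    measure_mono_null (prod_mono (subset_univ _) (Ici_subset_Ici.2 hq)) hx
  have hms : ∀ (b : Bool) (q : ℝ≥0), MeasurableSet (({b} : Set Bool) ×ˢ Ici q) := fun b q =>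
    (measurableSet_singleton b).prod measurableSet_Ici
  -- From the rational time `q` on, the new atom is the only atom of `h`, so its mark decides.
  obtain ⟨q, hq1, hq2⟩ := exists_nnrat_between hr
  cases d
  · simp only [active, Bool.false_eq_true, if_false, ite_eq_right_iff, one_ne_zero, imp_false,
      not_exists, not_and]
    intro q' h1 h2
    simp only [addPoint, Measure.add_apply, Measure.dirac_apply' _ (hms _ _), add_eq_zero,
      indicator_apply_eq_zero, mem_prod, mem_singleton_iff, true_and, mem_Ici, Pi.one_apply,
      one_ne_zero, imp_false, not_le] at h2
    apply h1
    have hrq : r ≤ q' := (hr.trans h2.2).le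
    simp [addPoint, hxb true q' hrq, hms]
  · simp only [active, if_true]
    rw [if_pos]
    refine ⟨q, ?_, ?_⟩
    · simp [addPoint, hms, hq2.le]
    · simp [addPoint, hms, hxb false q hq1.le]

namespace Params

variable {θ : Params E}

theorem rateAt_addPoint {x : State E} (h1 : x.1 univ < ∞) (h2 : x.2 univ < ∞)
    {y z : E × ℝ≥0} (hs : z.2 ≤ y.2) (d : Bool) :
    θ.rateAt (addPoint d y x) z = θ.rateAt x z := by
  rw [rateAt, rateAt, trunc_addPoint h1 h2 hs]

theorem cum_addPoint {x : State E} (h1 : x.1 univ < ∞) (h2 : x.2 univ < ∞)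
    {y : E × ℝ≥0} {t : ℝ≥0} (hs : t ≤ y.2) (d : Bool) :
    cum θ.ν (θ.rateAt (addPoint d y x)) t = cum θ.ν (θ.rateAt x) t := by
  refine setLIntegral_congr_fun (measurableSet_upTo _) fun z hz => ?_
  rw [rateAt_addPoint h1 h2 ((mem_Iic.1 hz.2).trans hs)]

theorem surv_addPoint {x : State E} (h1 : x.1 univ < ∞) (h2 : x.2 univ < ∞)
    {y : E × ℝ≥0} {t : ℝ≥0} (hs : t ≤ y.2) (d : Bool) :
    θ.surv t (addPoint d y x) = θ.surv t x := by
  rw [surv, surv, survival, survival]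
  congr 2
  refine setLIntegral_congr_fun (measurableSet_upTo _) fun z hz => ?_
  have hz' := (mem_Iic.1 hz.2).trans hs
  rw [rateAt_addPoint h1 h2 hz', cum_addPoint h1 h2 hz']

theorem ratio_addPoint {x : State E} (h1 : x.1 univ < ∞) (h2 : x.2 univ < ∞)
    {y z : E × ℝ≥0} (hs : z.2 ≤ y.2) (d : Bool) :
    θ.ratio (addPoint d y x) z = θ.ratio x z := by
  rw [ratio, ratio, rateAt_addPoint h1 h2 hs]

theorem inv_negExp_mul_negExp {a : ℝ} (ha : 0 ≤ a) :
    (negExp (ENNReal.ofReal (Real.log a)))⁻¹ * negExp (negLog a) = a := by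
  rcases eq_or_lt_of_le ha with h | h
  -- For `a = 0` the convention `log 0 = 0` makes the first factor one, and the zero comes from
  -- `negLog 0 = ∞`.
  · simp [negLog, ← h, negExp_top]
  rw [negLog, if_neg h.ne']
  rcases le_total 0 (Real.log a) with h1 | h1
  · rw [negExp_ofReal h1, ENNReal.ofReal_of_nonpos (neg_nonpos.2 h1), negExp_zero, mul_one,
      Real.exp_neg, inv_inv, Real.exp_log h]
  · rw [negExp_ofReal (neg_nonneg.2 h1), ENNReal.ofReal_of_nonpos h1, negExp_zero, inv_one,
      one_mul, neg_neg, Real.exp_log h]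

theorem ratio_nonneg (x : State E) (y : E × ℝ≥0) : 0 ≤ θ.ratio x y :=
  div_nonneg (NNReal.coe_nonneg _) (NNReal.coe_nonneg _)

theorem Admissible.measurable_ratio_left (hθ : θ.Admissible) (x : State E) :
    Measurable (θ.ratio x) := hθ.measurable_ratio.comp measurable_prodMk_left

theorem Admissible.jumps_addPoint (hθ : θ.Admissible) {x : State E} {y : E × ℝ≥0}
    (h1 : x.1 univ < ∞) (h2 : x.2 univ < ∞) (hx : ∀ᵐ z ∂x.2, z.2 ≤ y.2) (d : Bool) :
    θ.jumps (addPoint d y x) = θ.jumps x * θ.ratio x y := by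
  have h2' : (addPoint d y x).2 univ < ∞ := by simpa [addPoint] using h2
  have key : ∀ F : ℝ → ℝ≥0∞, Measurable F →
      ∫⁻ z, F (θ.ratio (addPoint d y x) z) ∂(finPart _ (addPoint d y x).2) =
        ∫⁻ z, F (θ.ratio x z) ∂(finPart _ x.2) + F (θ.ratio x y) := by
    intro F hF
    rw [finPart_of_lt h2', finPart_of_lt h2]
    show ∫⁻ z, F (θ.ratio (addPoint d y x) z) ∂(x.2 + Measure.dirac y) = _
    rw [lintegral_add_measure, lintegral_dirac' y (f := fun z => F (θ.ratio (addPoint d y x) z))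
        (hF.comp (hθ.measurable_ratio_left _)),
      ratio_addPoint h1 h2 le_rfl]
    congr 1
    refine lintegral_congr_ae ?_
    filter_upwards [hx] with z hz
    rw [ratio_addPoint h1 h2 hz]
  rw [jumps, jumps, jumpPos, jumpNeg,
    key (fun a => ENNReal.ofReal (Real.log a)) Real.measurable_log.ennreal_ofReal,
    key negLog measurable_negLog, negExp_add, negExp_add]
  conv_rhs => rw [← inv_negExp_mul_negExp (ratio_nonneg (θ := θ) x y)]
  rw [mul_inv, jumpPos, jumpNeg]
  ring

/-- The intensities read the state strictly before the current time. A new last point therefore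
leaves the continuous part and all earlier jump factors unchanged and only contributes its own
ratio. -/
theorem Admissible.weight_addPoint (hθ : θ.Admissible) {x : State E} {y : E × ℝ≥0} {s : ℝ≥0}
    (hx : EndsBy s x) (hs : s < y.2) (d : Bool) :
    θ.weight y.2 (addPoint d y x) = θ.weight y.2 x * ((θ.rate y x : ℝ) / θ.rateQ y) := by
  have hx2 : ∀ᵐ z ∂x.2, z.2 ≤ y.2 := by
    refine measure_mono_null (fun z hz => ?_) hx.4
    exact ⟨mem_univ _, hs.trans (not_le.1 hz)⟩
  rw [weight, weight, hθ.jumps_addPoint hx.1 hx.2 hx2, surv_addPoint hx.1 hx.2 le_rfl, ratio,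
    rateAt, hx.trunc_eq hs]
  ring

theorem mean₁_upTo (t : ℝ≥0) :
    θ.mean₁ (upTo E t) = cum θ.ν θ.rateQ t := by
  rw [mean₁, withDensity_apply _ (measurableSet_upTo _), cum]

theorem Admissible.hasDens_cumQ (hθ : θ.Admissible) (a b : ℝ≥0) :
    HasDens θ.ν θ.cumQ (fun y => (θ.rateQ y : ℝ)) a b := by
  have := hθ.sigmaFinite
  have hfin : ∀ t, cum θ.ν θ.rateQ t ≠ ∞ := fun t => by
    rw [← mean₁_upTo]; exact (hθ.mean₁_finite t).ne
  have hle : ∀ t, a ≤ t → ∫⁻ y in slab E a t, θ.rateQ y ∂(θ.ν.prod lebesgue) ≠ ∞ := by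
    intro t hat h
    have := cum_add_slab (ν := θ.ν) (g := θ.rateQ) hat
    rw [h] at this
    exact hfin t (by simp [this])
  rcases lt_or_ge b a with hab | hab
  · refine ⟨?_, fun t ht => absurd (ht.1.trans ht.2) hab.not_ge⟩
    rw [slab, Ioc_eq_empty_of_le hab.le, prod_empty]
    exact integrableOn_empty
  refine ⟨integrableOn_slab_coe hθ.measurable_rateQ (hle b hab), fun t ht => ?_⟩
  rw [integral_slab_coe hθ.measurable_rateQ, cumQ, cumQ, mean₁_upTo, mean₁_upTo,
    cum_add_slab ht.1, ENNReal.toReal_add (hfin a) (hle t ht.1)]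

theorem Admissible.continuous_surv (hθ : θ.Admissible) (x : State E) :
    Continuous fun t => θ.surv t x := by
  have := hθ.sigmaFinite
  exact continuous_survival (hθ.measurable_rateAt x)

theorem Admissible.continuous_cumQ (hθ : θ.Admissible) : Continuous θ.cumQ := by
  have := hθ.sigmaFinite
  refine continuous_iff_continuousAt.2 fun t => ?_
  refine ((hθ.hasDens_cumQ 0 (t + 1)).continuousOn t ⟨zero_le, le_self_add⟩).continuousAt ?_
  exact mem_of_superset (Iio_mem_nhds (lt_add_of_pos_right t one_pos))
    fun s hs => ⟨zero_le, (mem_Iio.1 hs).le⟩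

theorem Admissible.continuous_weight (hθ : θ.Admissible) (x : State E) :
    Continuous fun t => θ.weight t x :=
  (continuous_const.mul (Real.continuous_exp.comp hθ.continuous_cumQ)).mul (hθ.continuous_surv x)

/-- The density of `surv` contains `exp(-cum)`; only where this coincides with `surv` does the
linear equation with rate `λ - λ_Q` hold. If the jump product vanishes, both sides are zero anyway.
-/
theorem Admissible.hasDens_weight (hθ : θ.Admissible) {x : State E} {a b : ℝ≥0}
    (hx : EndsBy a x)
    (hgood : θ.jumps x = 0 ∨ ∀ t ∈ Ioo a b, θ.surv t x = negExp (cum θ.ν (θ.rateAt x) t)) :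
    HasDens θ.ν (fun t => θ.weight t x)
      (fun y => -(((θ.rate y x : ℝ) - θ.rateQ y) * θ.weight y.2 x)) a b := by
  have := hθ.sigmaFinite
  rcases hgood with h0 | hgood
  · have hw : ∀ t, θ.weight t x = 0 := fun t => by rw [weight, h0]; ring
    simp only [hw, mul_zero, neg_zero]
    exact HasDens.const 0 a b
  have h1 : HasDens θ.ν (fun t => θ.surv t x) (fun y => -(θ.rate y x * θ.surv y.2 x)) a b := by
    refine ((hasDens_survival (hθ.measurable_rateAt x) b).mono (zero_le) le_rfl).congr_dens ?_
    -- Goodness is available on the open interval only; the endpoint `b` is a null set of times.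
    filter_upwards [ae_time_ne (ν := θ.ν) b] with y hy hys
    rw [← hgood _ ⟨hys.2.1, lt_of_le_of_ne hys.2.2 hy⟩, rateAt, hx.trunc_eq hys.2.1]
  have h2 := (((hθ.hasDens_cumQ a b).exp.mul h1).const_mul (θ.jumps x))
  refine HasDens.congr_dens (HasDens.congr_fun' h2 fun t => ?_) (Eventually.of_forall fun y _ => ?_)
  · rw [weight]; ring
  · rw [weight]; ring

end Params

end StateLemmas

/-! ### Uniqueness of the law of a pair of random measures -/

section FamilyExt

variable {α : Type*} [MeasurableSpace α]

/-- The values of a pair of measures on the measurable sets. -/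
def evalAll (α : Type*) [MeasurableSpace α] (p : Bool → Measure α) :
    Bool × {s : Set α // MeasurableSet s} → ℝ≥0∞ := fun q => p q.1 q.2

theorem measurable_evalAll : Measurable (evalAll α) :=
  measurable_pi_lambda _ fun q => (Measure.measurable_coe q.2.2).comp (measurable_pi_apply q.1)

/-- The σ-algebra on measures is by definition generated by evaluations on measurable sets, so a law
of random measures is a law on a product space and finite-dimensional distributions suffice. -/
theorem exists_preimage_evalAll {S : Set (Bool → Measure α)} (hS : MeasurableSet S) :
    ∃ T, MeasurableSet T ∧ evalAll α ⁻¹' T = S := by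
  have hle : (inferInstance : MeasurableSpace (Bool → Measure α)) ≤
      MeasurableSpace.comap (evalAll α) inferInstance := by
    have h : @Measurable _ _ (MeasurableSpace.comap (evalAll α) inferInstance) inferInstance
        (id : (Bool → Measure α) → _) := by
      refine @measurable_pi_lambda _ _ _ (MeasurableSpace.comap (evalAll α) inferInstance) _ _
        fun c => ?_
      refine @Measure.measurable_of_measurable_coe _ _ _
        (MeasurableSpace.comap (evalAll α) inferInstance) _ fun s hs => ?_
      have h1 : @Measurable _ _ (MeasurableSpace.comap (evalAll α) inferInstance) _ (evalAll α) :=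
        comap_measurable _
      exact (measurable_pi_apply (c, (⟨s, hs⟩ : {s : Set α // MeasurableSet s}))).comp h1
    intro s hs
    exact h hs
  exact hle S hS

theorem map_evalAll_ext {P P' : Measure (Bool → Measure α)}
    (h : P.map (evalAll α) = P'.map (evalAll α)) : P = P' := by
  ext S hS
  obtain ⟨T, hT, rfl⟩ := exists_preimage_evalAll hS
  rw [← Measure.map_apply measurable_evalAll hT, h, Measure.map_apply measurable_evalAll hT]

/-- Finite values of the two measures on the sets of a finite family, as real numbers. -/
def cellVec {n : ℕ} (A : Fin n → Set α) (p : Bool → Measure α) : Bool × Fin n → ℝ :=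
  fun q => (p q.1 (A q.2)).toReal

theorem measurable_cellVec {n : ℕ} {A : Fin n → Set α} (hA : ∀ i, MeasurableSet (A i)) :
    Measurable (cellVec A) :=
  measurable_pi_lambda _ fun q =>
    ((Measure.measurable_coe (hA q.2)).comp (measurable_pi_apply q.1)).ennreal_toReal

/-- The character `exp (i ⟨t, cellVec⟩)`. -/
def cellChar {n : ℕ} (A : Fin n → Set α) (t : Bool → Fin n → ℝ) (p : Bool → Measure α) : ℂ :=
  ∏ c, ∏ i, Complex.exp ((t c i * (p c (A i)).toReal : ℝ) * Complex.I)

theorem map_cellVec_ext {P P' : Measure (Bool → Measure α)} [IsFiniteMeasure P]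
    [IsFiniteMeasure P'] {n : ℕ} {A : Fin n → Set α} (hA : ∀ i, MeasurableSet (A i))
    (h : ∀ t, ∫ p, cellChar A t p ∂P = ∫ p, cellChar A t p ∂P') :
    P.map (cellVec A) = P'.map (cellVec A) := by
  refine Measure.ext_of_charFunDual (funext fun l => ?_)
  have key : ∀ V : Measure (Bool → Measure α), charFunDual (V.map (cellVec A)) l =
      ∫ p, cellChar A (fun c i => l (Pi.single (c, i) 1)) p ∂V := by
    intro V
    rw [charFunDual_apply, integral_map (measurable_cellVec hA).aemeasurable
      (by fun_prop)]
    refine integral_congr_ae (Eventually.of_forall fun p => ?_)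
    have hl : l (cellVec A p) = ∑ c, ∑ i, l (Pi.single (c, i) 1) * (p c (A i)).toReal := by
      rw [← Fintype.sum_prod_type', ← ContinuousLinearMap.coe_coe,
        LinearMap.pi_apply_eq_sum_univ]
      refine Finset.sum_congr rfl fun q _ => ?_
      simp only [cellVec, smul_eq_mul, ContinuousLinearMap.coe_coe]
      rw [mul_comm]
      congr 2
      ext j
      simp [Pi.single_apply, eq_comm]
    beta_reduce
    rw [hl, cellChar]
    simp_rw [← Complex.exp_sum]
    congr 1
    push_cast
    simp_rw [Finset.sum_mul]
  rw [key, key, h]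

/-- Finitely many sets are unions of the disjoint cells of the finite algebra they generate. Joint
characters on disjoint families therefore determine all finite-dimensional distributions; finiteness
of the masses lets the values be read as real numbers. -/
theorem measure_family_ext {P P' : Measure (Bool → Measure α)} [IsFiniteMeasure P]
    [IsFiniteMeasure P'] (hP : ∀ᵐ p ∂P, ∀ c, p c univ < ∞) (hP' : ∀ᵐ p ∂P', ∀ c, p c univ < ∞)
    (h : ∀ (n : ℕ) (A : Fin n → Set α), (∀ i, MeasurableSet (A i)) →
      Pairwise (fun i j => Disjoint (A i) (A j)) →
      ∀ t, ∫ p, cellChar A t p ∂P = ∫ p, cellChar A t p ∂P') : P = P' := by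
  classical
  refine map_evalAll_ext (IsProjectiveLimit.unique
    (P := fun I : Finset (Bool × {s : Set α // MeasurableSet s}) =>
      (P.map (evalAll α)).map I.restrict)
    (fun I => rfl) fun I => ?_)
  set J : Finset {s : Set α // MeasurableSet s} := I.image Prod.snd with hJ
  -- The cells are indexed by membership patterns: which of the sets in `J` contain the point.
  obtain ⟨n, ⟨e⟩⟩ := Finite.exists_equiv_fin (J → Bool)
  set A : Fin n → Set α := fun k => ⋂ j : J, if e.symm k j then (j.1 : Set α) else (j.1 : Set α)ᶜ
    with hAdef
  have hA : ∀ k, MeasurableSet (A k) := fun k =>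
    MeasurableSet.iInter fun j => by
      split_ifs
      · exact j.1.2
      · exact j.1.2.compl
  have hmem : ∀ x : α, ∀ k, x ∈ A k ↔ k = e (fun j : J => decide (x ∈ (j.1 : Set α))) := by
    intro x k
    rw [← Equiv.symm_apply_eq, funext_iff]
    simp only [hAdef, mem_iInter]
    refine forall_congr' fun j => ?_
    by_cases hx : x ∈ (j.1 : Set α) <;> by_cases hk : e.symm k j <;> simp [hx, hk]
  have hdisj : Pairwise (fun i j => Disjoint (A i) (A j)) := by
    intro i j hij
    rw [Set.disjoint_left]
    intro x hi hj
    exact hij (((hmem x i).1 hi).trans ((hmem x j).1 hj).symm)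
  have hlaw := map_cellVec_ext hA (h n A hA hdisj)
  have hsum : ∀ (m : Measure α) (j : J), m j.1 = ∑ k, if e.symm k j then m (A k) else 0 := by
    intro m j
    rw [← Finset.sum_filter, ← measure_biUnion_finset]
    · congr 1
      ext x
      simp only [Finset.mem_filter, Finset.mem_univ, true_and, mem_iUnion, exists_prop, hmem]
      constructor
      · intro hx
        exact ⟨_, by simpa using hx, rfl⟩
      · rintro ⟨k, hk, rfl⟩
        simpa using hk
    · intro i _ k _ hik
      exact hdisj hik
    · intro k _; exact hA k
  set g : (Bool × Fin n → ℝ) → (I → ℝ≥0∞) := fun v i =>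
    ∑ k, if e.symm k ⟨i.1.2, Finset.mem_image_of_mem _ i.2⟩ then ENNReal.ofReal (v (i.1.1, k)) else 0
    with hg
  have hgm : Measurable g := by
    refine measurable_pi_lambda _ fun i => Finset.measurable_sum _ fun k _ => ?_
    split_ifs
    · exact (measurable_pi_apply _).ennreal_ofReal
    · exact measurable_const
  have key : ∀ V : Measure (Bool → Measure α), (∀ᵐ p ∂V, ∀ c, p c univ < ∞) →
      (V.map (evalAll α)).map I.restrict = (V.map (cellVec A)).map g := by
    intro V hR
    rw [Measure.map_map (Finset.measurable_restrict I) measurable_evalAll,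
      Measure.map_map hgm (measurable_cellVec hA)]
    refine Measure.map_congr ?_
    filter_upwards [hR] with p hp
    ext i
    simp only [Function.comp_apply, Finset.restrict, evalAll, hg, cellVec]
    rw [hsum (p i.1.1) ⟨i.1.2, Finset.mem_image_of_mem _ i.2⟩]
    refine Finset.sum_congr rfl fun k _ => ?_
    rw [ENNReal.ofReal_toReal ((measure_mono (subset_univ _)).trans_lt (hp _)).ne]
  rw [key P' hP', ← hlaw]
  exact (key P hP).symm

end FamilyExt

/-! ### Independent Poisson processes as a Poisson number of labelled points -/

section PoissonPair

variable {α : Type*} [MeasurableSpace α]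

/-- The pair of counting measures with points `y i` in the component `b i`. -/
def pairConfig {n : ℕ} (b : Fin n → Bool) (y : Fin n → α) (c : Bool) : Measure α :=
  ∑ i, if b i = c then Measure.dirac (y i) else 0

theorem measurable_pairConfig {n : ℕ} (b : Fin n → Bool) :
    Measurable (pairConfig b : (Fin n → α) → Bool → Measure α) := by
  refine measurable_pi_lambda _ fun c => ?_
  refine Measure.measurable_of_measurable_coe _ fun s hs => ?_
  simp only [pairConfig, Measure.coe_finsetSum, Finset.sum_apply]
  refine Finset.measurable_sum _ fun i _ => ?_
  split_ifs
  · exact (Measure.measurable_coe hs).comp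
      (Measure.measurable_dirac.comp (measurable_pi_apply i))
  · exact measurable_const

/-- The law of a pair of independent Poisson processes with finite mean measures. -/
def poissonPair (μ : Bool → Measure α) : Measure (Bool → Measure α) :=
  Measure.sum fun n : ℕ =>
    ENNReal.ofReal (Real.exp (-(∑ c, (μ c).real univ)) / n.factorial) •
      ∑ b : Fin n → Bool, (Measure.pi fun i => μ (b i)).map (pairConfig b)

variable {μ : Bool → Measure α} [∀ c, IsFiniteMeasure (μ c)]

theorem sum_pi_univ (n : ℕ) :
    (∑ b : Fin n → Bool, (Measure.pi fun i => μ (b i)).map (pairConfig b)) univ =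
      ENNReal.ofReal ((∑ c, (μ c).real univ) ^ n) := by
  rw [Fintype.sum_pow, ENNReal.ofReal_sum_of_nonneg fun b _ => by positivity,
    Measure.coe_finsetSum, Finset.sum_apply]
  refine Finset.sum_congr rfl fun b _ => ?_
  rw [Measure.map_apply (measurable_pairConfig b) MeasurableSet.univ, preimage_univ,
    Measure.pi_univ, ENNReal.ofReal_prod_of_nonneg fun i _ => by positivity]
  simp

instance : IsProbabilityMeasure (poissonPair μ) := by
  refine ⟨?_⟩
  set M := ∑ c, (μ c).real univ with hM
  have hM0 : 0 ≤ M := Finset.sum_nonneg fun c _ => by positivity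
  have hsum : HasSum (fun n : ℕ => Real.exp (-M) / n.factorial * M ^ n) 1 := by
    have h := (NormedSpace.expSeries_div_hasSum_exp M).mul_left (Real.exp (-M))
    rw [← Real.exp_eq_exp_ℝ, ← Real.exp_add, neg_add_cancel, Real.exp_zero] at h
    have e : (fun n : ℕ => Real.exp (-M) / n.factorial * M ^ n) =
        fun n : ℕ => Real.exp (-M) * (M ^ n / n.factorial) := funext fun n => by ring
    rwa [e]
  rw [poissonPair, Measure.sum_apply _ MeasurableSet.univ]
  simp only [Measure.smul_apply, smul_eq_mul, sum_pi_univ]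
  rw [← ENNReal.ofReal_one, ← hsum.tsum_eq, ENNReal.ofReal_tsum_of_nonneg _ hsum.summable]
  · refine tsum_congr fun n => ?_
    rw [ENNReal.ofReal_mul (by positivity)]
  · intro n; positivity

theorem pairConfig_lt_top {n : ℕ} (b : Fin n → Bool) (y : Fin n → α) (c : Bool) (s : Set α) :
    pairConfig b y c s < ∞ := by
  simp only [pairConfig, Measure.coe_finsetSum, Finset.sum_apply]
  refine ENNReal.sum_lt_top.2 fun i _ => ?_
  split_ifs
  · exact measure_lt_top _ _
  · simp

theorem ae_poissonPair {p : (Bool → Measure α) → Prop}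
    (h : ∀ n (b : Fin n → Bool), ∀ᵐ z ∂(Measure.pi fun i => μ (b i)).map (pairConfig b), p z) :
    ∀ᵐ z ∂(poissonPair μ), p z := by
  rw [poissonPair, Measure.ae_sum_iff]
  intro n
  refine Measure.ae_smul_measure ?_ _
  rw [ae_iff, Measure.coe_finsetSum, Finset.sum_apply]
  exact Finset.sum_eq_zero fun b _ => h n b

theorem measurable_cellChar {n : ℕ} {A : Fin n → Set α} (hA : ∀ i, MeasurableSet (A i))
    (t : Bool → Fin n → ℝ) : Measurable (cellChar A t) := by
  refine Finset.measurable_prod _ fun c _ => Finset.measurable_prod _ fun i _ => ?_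
  have h := ((Measure.measurable_coe (hA i)).comp
    (measurable_pi_apply (X := fun _ : Bool => Measure α) c)).ennreal_toReal.const_mul (t c i)
  exact Complex.measurable_exp.comp ((Complex.measurable_ofReal.comp h).mul_const _)

theorem norm_cellChar {n : ℕ} (A : Fin n → Set α) (t : Bool → Fin n → ℝ) (p : Bool → Measure α) :
    ‖cellChar A t p‖ = 1 := by
  rw [cellChar]
  simp only [norm_prod, Complex.norm_exp_ofReal_mul_I, Finset.prod_const_one]

/-- The character of a single point. -/
def pointChar {n : ℕ} (A : Fin n → Set α) (t : Fin n → ℝ) (y : α) : ℂ :=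
  ∏ k, Complex.exp ((t k * (A k).indicator 1 y : ℝ) * Complex.I)

theorem cellChar_pairConfig {m : ℕ} {A : Fin m → Set α} (hA : ∀ i, MeasurableSet (A i))
    (t : Bool → Fin m → ℝ) {n : ℕ} (b : Fin n → Bool) (y : Fin n → α) :
    cellChar A t (pairConfig b y) = ∏ i, pointChar A (t (b i)) (y i) := by
  have hval : ∀ c k, (pairConfig b y c (A k)).toReal =
      ∑ i, if b i = c then (A k).indicator (1 : α → ℝ) (y i) else 0 := by
    intro c k
    simp only [pairConfig, Measure.coe_finsetSum, Finset.sum_apply]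
    rw [ENNReal.toReal_sum]
    · refine Finset.sum_congr rfl fun i _ => ?_
      split_ifs
      · rw [Measure.dirac_apply' _ (hA k)]
        by_cases h : y i ∈ A k <;> simp [h]
      · simp
    · intro i _
      split_ifs
      · exact measure_ne_top _ _
      · simp
  have hexp : ∀ c k, Complex.exp ((t c k * (pairConfig b y c (A k)).toReal : ℝ) * Complex.I) =
      ∏ i, if b i = c then
        Complex.exp ((t c k * (A k).indicator (1 : α → ℝ) (y i) : ℝ) * Complex.I) else 1 := by
    intro c k
    rw [hval, Finset.mul_sum, Complex.ofReal_sum, Finset.sum_mul, Complex.exp_sum]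
    refine Finset.prod_congr rfl fun i _ => ?_
    split_ifs <;> simp
  rw [cellChar]
  simp_rw [hexp]
  have : ∀ c, ∏ k, ∏ i, (if b i = c then
        Complex.exp ((t c k * (A k).indicator (1 : α → ℝ) (y i) : ℝ) * Complex.I) else 1) =
      ∏ i, if b i = c then pointChar A (t c) (y i) else 1 := by
    intro c
    rw [Finset.prod_comm]
    refine Finset.prod_congr rfl fun i _ => ?_
    split_ifs
    · rfl
    · simp
  simp_rw [this]
  rw [Finset.prod_comm]
  refine Finset.prod_congr rfl fun i _ => ?_
  rw [Finset.prod_ite_eq Finset.univ (b i)]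
  simp

theorem integral_pointChar {m : ℕ} {A : Fin m → Set α} (hA : ∀ i, MeasurableSet (A i))
    (hd : Pairwise (fun i j => Disjoint (A i) (A j))) (t : Fin m → ℝ) (μ : Measure α)
    [IsFiniteMeasure μ] :
    ∫ y, pointChar A t y ∂μ =
      μ.real univ + ∑ k, μ.real (A k) * (Complex.exp (t k * Complex.I) - 1) := by
  have hpt : ∀ y, pointChar A t y = 1 + ∑ k, (A k).indicator
      (fun _ => Complex.exp (t k * Complex.I) - 1) y := by
    intro y
    by_cases hy : ∃ k, y ∈ A k
    · obtain ⟨k, hk⟩ := hy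
      have hne : ∀ j, j ≠ k → y ∉ A j := fun j hj h => Set.disjoint_left.1 (hd hj) h hk
      rw [pointChar, Finset.prod_eq_single k, Finset.sum_eq_single k]
      · simp [hk]
      · intro j _ hj; simp [hne j hj]
      · simp
      · intro j _ hj; simp [hne j hj]
      · simp
    · push Not at hy
      simp [pointChar, hy]
  simp_rw [hpt]
  rw [integral_add (integrable_const _), integral_finsetSum]
  · congr 1
    · simp
    · refine Finset.sum_congr rfl fun k _ => ?_
      rw [integral_indicator_const _ (hA k)]
      simp
  · intro k _; exact (integrable_const _).indicator (hA k)
  · exact integrable_finsetSum _ fun k _ => (integrable_const _).indicator (hA k)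

/-- The character is multiplicative over the points, so the configurations with `n` points
contribute the `n`-th term of an exponential series in the integral of the one-point character.
Since the cells are disjoint, that integral is linear in their masses. -/
theorem integral_cellChar_poissonPair {m : ℕ} {A : Fin m → Set α} (hA : ∀ i, MeasurableSet (A i))
    (hd : Pairwise (fun i j => Disjoint (A i) (A j))) (t : Bool → Fin m → ℝ) :
    ∫ p, cellChar A t p ∂(poissonPair μ) =
      ∏ c, ∏ k, Complex.exp ((μ c).real (A k) * (Complex.exp (t c k * Complex.I) - 1)) := by
  set M := ∑ c, (μ c).real univ with hM
  have hint : ∀ (R₀ : Measure (Bool → Measure α)) [IsFiniteMeasure R₀],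
      Integrable (cellChar A t) R₀ := fun R₀ _ =>
    Integrable.of_bound (measurable_cellChar hA t).aestronglyMeasurable 1
      (Eventually.of_forall fun p => (norm_cellChar A t p).le)
  have h1 := hasSum_integral_measure (hint (poissonPair μ))
  have h2 : ∀ n : ℕ, ∫ p, cellChar A t p ∂(ENNReal.ofReal (Real.exp (-M) / n.factorial) •
      ∑ b : Fin n → Bool, (Measure.pi fun i => μ (b i)).map (pairConfig b)) =
      Complex.exp (-M) * ((∑ c, ∫ y, pointChar A (t c) y ∂(μ c)) ^ n / n.factorial) := by
    intro n
    rw [integral_smul_measure, ENNReal.toReal_ofReal (by positivity),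
      integral_finsetSum_measure, Fintype.sum_pow]
    · have : ∀ b : Fin n → Bool, ∫ p, cellChar A t p ∂((Measure.pi fun i => μ (b i)).map
          (pairConfig b)) = ∏ i, ∫ y, pointChar A (t (b i)) y ∂(μ (b i)) := by
        intro b
        rw [integral_map (measurable_pairConfig b).aemeasurable
          (measurable_cellChar hA t).aestronglyMeasurable]
        simp_rw [cellChar_pairConfig hA]
        exact integral_fintype_prod_eq_prod fun i y => pointChar A (t (b i)) y
      simp_rw [this]
      rw [Complex.real_smul]
      push_cast
      ring
    · intro b _
      have := Measure.isFiniteMeasure_map (Measure.pi fun i => μ (b i)) (pairConfig b)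
      exact hint _
  have h3 := ((NormedSpace.expSeries_div_hasSum_exp
    (∑ c, ∫ y, pointChar A (t c) y ∂(μ c))).mul_left (Complex.exp (-M)))
  rw [← Complex.exp_eq_exp_ℂ, ← Complex.exp_add] at h3
  rw [← funext h2] at h3
  have h4 : ∫ p, cellChar A t p ∂(poissonPair μ) = _ := h1.unique h3
  rw [h4]
  simp_rw [integral_pointChar hA hd]
  simp_rw [← Complex.exp_sum]
  congr 1
  rw [Finset.sum_add_distrib, hM]
  push_cast
  ring

variable {Ω : Type*} {mΩ : MeasurableSpace Ω}

/-- Both laws have the same characters on disjoint cells. The gain is an explicit representation by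
labelled points, in which thinning can be computed. -/
theorem map_eq_poissonPair {Q : Measure Ω} [IsProbabilityMeasure Q] {ξ : Ω → Bool → Measure α}
    (hm : Measurable ξ) (hfin : ∀ ω c, ξ ω c univ < ∞)
    (hind : IndepFun (fun ω => ξ ω true) (fun ω => ξ ω false) Q)
    (hlaw : ∀ c B, MeasurableSet B → Q.map (fun ω => ξ ω c B) =
      (poissonMeasure (μ c B).toNNReal).map (fun n : ℕ => (n : ℝ≥0∞)))
    (hindep : ∀ c (n : ℕ) (B : Fin n → Set α), (∀ i, MeasurableSet (B i)) →
      Pairwise (fun i j => Disjoint (B i) (B j)) → iIndepFun (fun i ω => ξ ω c (B i)) Q) :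
    Q.map ξ = poissonPair μ := by
  have hP : IsProbabilityMeasure (Q.map ξ) := Measure.isProbabilityMeasure_map hm.aemeasurable
  have hfinset : MeasurableSet {p : Bool → Measure α | ∀ c, p c univ < ∞} := by
    rw [show {p : Bool → Measure α | ∀ c, p c univ < ∞} = ⋂ c, {p | p c univ ∈ Iio ∞} by
      ext p; simp]
    exact MeasurableSet.iInter fun c => ((Measure.measurable_coe MeasurableSet.univ).comp
      (measurable_pi_apply c)) measurableSet_Iio
  refine measure_family_ext ?_ ?_ fun n A hA hd t => ?_
  · rw [ae_map_iff hm.aemeasurable hfinset]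
    exact Eventually.of_forall fun ω c => hfin ω c
  · refine ae_poissonPair fun n b => ?_
    rw [ae_map_iff (measurable_pairConfig b).aemeasurable hfinset]
    exact Eventually.of_forall fun y c => pairConfig_lt_top b y c univ
  rw [integral_cellChar_poissonPair hA hd, integral_map hm.aemeasurable
    (measurable_cellChar hA t).aestronglyMeasurable]
  have hmc : ∀ c, Measurable fun ω => ξ ω c := fun c => (measurable_pi_apply c).comp hm
  have hone : ∀ c k, ∫ ω, Complex.exp ((t c k * (ξ ω c (A k)).toReal : ℝ) * Complex.I) ∂Q =
      Complex.exp ((μ c).real (A k) * (Complex.exp (t c k * Complex.I) - 1)) := by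
    intro c k
    have hmk : Measurable fun ω => ξ ω c (A k) := (Measure.measurable_coe (hA k)).comp (hmc c)
    have hmF : Measurable fun x : ℝ≥0∞ => Complex.exp ((t c k * x.toReal : ℝ) * Complex.I) :=
      Complex.measurable_exp.comp ((Complex.measurable_ofReal.comp
        (ENNReal.measurable_toReal.const_mul _)).mul_const _)
    have e1 : ∫ ω, Complex.exp ((t c k * (ξ ω c (A k)).toReal : ℝ) * Complex.I) ∂Q =
        ∫ x : ℝ≥0∞, Complex.exp ((t c k * x.toReal : ℝ) * Complex.I)
          ∂(Q.map fun ω => ξ ω c (A k)) :=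
      (integral_map hmk.aemeasurable hmF.aestronglyMeasurable).symm
    have e2 := charFun_map_cast_poissonMeasure (μ c (A k)).toNNReal (t c k)
    rw [charFun_apply, integral_map .of_discrete (by fun_prop)] at e2
    rw [e1, hlaw c _ (hA k), integral_map .of_discrete hmF.aestronglyMeasurable]
    rw [show ((μ c).real (A k) : ℂ) = ((μ c (A k)).toNNReal : ℂ) from rfl, ← e2]
    refine integral_congr_ae (Eventually.of_forall fun j => ?_)
    simp [mul_comm]
  have hcell : ∀ c, ∫ ω, ∏ k, Complex.exp ((t c k * (ξ ω c (A k)).toReal : ℝ) * Complex.I) ∂Q =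
      ∏ k, Complex.exp ((μ c).real (A k) * (Complex.exp (t c k * Complex.I) - 1)) := by
    intro c
    have h := (hindep c n A hA hd).integral_fun_prod_comp
      (f := fun k (x : ℝ≥0∞) => Complex.exp ((t c k * x.toReal : ℝ) * Complex.I))
      (fun k => ((Measure.measurable_coe (hA k)).comp (hmc c)).aemeasurable)
      (fun k => (Complex.measurable_exp.comp ((Complex.measurable_ofReal.comp
        (ENNReal.measurable_toReal.const_mul _)).mul_const _)).aestronglyMeasurable)
    rw [h]
    exact Finset.prod_congr rfl fun k _ => hone c k
  have hmp : ∀ c, Measurable fun m : Measure α =>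
      ∏ k, Complex.exp ((t c k * (m (A k)).toReal : ℝ) * Complex.I) := fun c =>
    Finset.measurable_prod _ fun k _ => Complex.measurable_exp.comp
      ((Complex.measurable_ofReal.comp
        ((Measure.measurable_coe (hA k)).ennreal_toReal.const_mul _)).mul_const _)
  have hsplit := hind.integral_fun_comp_mul_comp (hmc true).aemeasurable (hmc false).aemeasurable
    (hmp true).aestronglyMeasurable (hmp false).aestronglyMeasurable
  simp only [cellChar, Fintype.prod_bool]
  rw [hsplit, hcell, hcell]

end PoissonPair

/-! ### Product measures and labelled points -/

section Products

variable {α : Type*} [MeasurableSpace α]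

theorem lintegral_pi_prod {n : ℕ} (μ : Fin n → Measure α) [∀ i, SigmaFinite (μ i)]
    {f : Fin n → α → ℝ≥0∞} (hf : ∀ i, Measurable (f i)) :
    ∫⁻ x, ∏ i, f i (x i) ∂(Measure.pi μ) = ∏ i, ∫⁻ y, f i y ∂(μ i) := by
  induction n with
  | zero => simp
  | succ n ih =>
    rw [← (measurePreserving_piFinSuccAbove μ 0).symm.lintegral_comp_emb
      (MeasurableEquiv.measurableEmbedding _)]
    simp_rw [MeasurableEquiv.piFinSuccAbove_symm_apply, Fin.insertNthEquiv,
      Fin.prod_univ_succ, Fin.insertNth_zero]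
    simp only [Fin.zero_succAbove, Equiv.coe_fn_mk, Fin.cons_zero, Fin.cons_succ]
    have h := lintegral_prod_mul (μ := μ 0) (ν := Measure.pi fun j : Fin n => μ j.succ)
      (hf 0).aemeasurable (g := fun x : Fin n → α => ∏ i, f i.succ (x i))
      (Finset.measurable_prod _ fun (i : Fin n) _ =>
        (hf i.succ).comp (measurable_pi_apply i)).aemeasurable
    rw [ih (fun j : Fin n => μ j.succ) fun i => hf i.succ] at h
    exact h

theorem pi_withDensity_prod {n : ℕ} (μ : Measure α) [IsFiniteMeasure μ] {w : Fin n → α → ℝ≥0∞}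
    (hw : ∀ i, Measurable (w i)) [∀ i, SigmaFinite (μ.withDensity (w i))] :
    Measure.pi (fun i => μ.withDensity (w i)) =
      (Measure.pi fun _ : Fin n => μ).withDensity fun x => ∏ i, w i (x i) := by
  refine Measure.pi_eq fun s hs => ?_
  rw [withDensity_apply _ (MeasurableSet.univ_pi hs),
    ← lintegral_indicator (MeasurableSet.univ_pi hs)]
  have h : ∀ x : Fin n → α, (univ.pi s).indicator (fun x => ∏ i, w i (x i)) x =
      ∏ i, (s i).indicator (w i) (x i) := by
    intro x
    by_cases hx : x ∈ univ.pi s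
    · rw [indicator_of_mem hx]
      exact Finset.prod_congr rfl fun i _ => (indicator_of_mem (hx i (mem_univ i)) _).symm
    · rw [indicator_of_notMem hx]
      simp only [Set.mem_pi, mem_univ, true_imp_iff, not_forall] at hx
      obtain ⟨i, hi⟩ := hx
      exact (Finset.prod_eq_zero (Finset.mem_univ i) (indicator_of_notMem hi _)).symm
  simp_rw [h]
  rw [lintegral_pi_prod _ fun i => (hw i).indicator (hs i)]
  refine Finset.prod_congr rfl fun i _ => ?_
  rw [withDensity_apply _ (hs i), lintegral_indicator (hs i)]

theorem ae_pi_forall {n : ℕ} (μ : Measure α) [IsFiniteMeasure μ] {p : α → Prop}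
    (hp : ∀ᵐ x ∂μ, p x) : ∀ᵐ x ∂(Measure.pi fun _ : Fin n => μ), ∀ i, p (x i) :=
  ae_all_iff.2 fun i => Measure.tendsto_eval_ae_ae (μ := fun _ : Fin n => μ) (i := i) hp

/-- For each pair of indices one coordinate is split off; given the others, its value under `g` hits
a prescribed point with measure zero. -/
theorem ae_pi_injective {n : ℕ} (μ : Measure α) [IsFiniteMeasure μ] {g : α → ℝ≥0}
    (hg : Measurable g) (h0 : ∀ t, μ {x | g x = t} = 0) :
    ∀ᵐ x ∂(Measure.pi fun _ : Fin n => μ), Function.Injective fun i => g (x i) := by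
  have key : ∀ i j : Fin n, i ≠ j → ∀ᵐ x ∂(Measure.pi fun _ : Fin n => μ), g (x i) ≠ g (x j) := by
    intro i j hij
    cases n with
    | zero => exact i.elim0
    | succ n =>
      obtain ⟨k, rfl⟩ := Fin.exists_succAbove_eq hij.symm
      have hmp := measurePreserving_piFinSuccAbove (fun _ : Fin (n + 1) => μ) i
      have hms : MeasurableSet {z : α × (Fin n → α) | g z.1 ≠ g (z.2 k)} :=
        (measurableSet_eq_fun (hg.comp measurable_fst)
          (hg.comp ((measurable_pi_apply k).comp measurable_snd))).compl
      have hprod : ∀ᵐ z ∂(μ.prod (Measure.pi fun _ : Fin n => μ)), g z.1 ≠ g (z.2 k) := by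
        have hswap : ∀ᵐ z ∂((Measure.pi fun _ : Fin n => μ).prod μ), g z.2 ≠ g (z.1 k) := by
          refine (Measure.ae_prod_iff_ae_ae ?_).2 (Eventually.of_forall fun x => ?_)
          · exact (measurableSet_eq_fun (hg.comp measurable_snd)
              (hg.comp ((measurable_pi_apply k).comp measurable_fst))).compl
          · exact measure_mono_null (fun z hz => not_not.1 hz) (h0 (g (x k)))
        rw [← Measure.prod_swap]
        exact (ae_map_iff measurable_swap.aemeasurable hms).2 hswap
      exact hmp.quasiMeasurePreserving.ae hprod
  filter_upwards [ae_all_iff.2 fun i => ae_all_iff.2 fun j => ae_all_iff.2 fun h => key i j h]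
    with x hx i j hij
  by_contra hne
  exact hx i j hne hij

theorem sum_fin_succ_fun {M : Type*} [AddCommMonoid M] {n : ℕ} (F : (Fin (n + 1) → Bool) → M) :
    ∑ b, F b = ∑ b : Fin n → Bool, (F (Fin.snoc b false) + F (Fin.snoc b true)) := by
  rw [← (Fin.snocEquiv fun _ : Fin (n + 1) => Bool).sum_comp F, Fintype.sum_prod_type_right]
  refine Finset.sum_congr rfl fun b _ => ?_
  simp [Fin.snocEquiv, add_comm]

theorem pairConfig_snoc {n : ℕ} (b : Fin n → Bool) (d : Bool) (y : Fin (n + 1) → α) (c : Bool) :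
    pairConfig (Fin.snoc b d : Fin (n + 1) → Bool) y c =
      pairConfig b (fun i => y i.castSucc) c + if d = c then Measure.dirac (y (Fin.last n)) else 0 := by
  rw [pairConfig, Fin.sum_univ_castSucc]
  simp [pairConfig]

theorem pairConfig_comp {n : ℕ} (b : Fin n → Bool) (y : Fin n → α) (σ : Equiv.Perm (Fin n))
    (c : Bool) : pairConfig (b ∘ σ) (y ∘ σ) c = pairConfig b y c := by
  rw [pairConfig, pairConfig]
  exact Equiv.sum_comp σ fun i => if b i = c then Measure.dirac (y i) else 0

theorem pairConfig_add {n : ℕ} (b : Fin n → Bool) (y : Fin n → α) :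
    pairConfig b y true + pairConfig b y false = ∑ i, Measure.dirac (y i) := by
  rw [pairConfig, pairConfig, ← Finset.sum_add_distrib]
  refine Finset.sum_congr rfl fun i _ => ?_
  cases b i <;> simp

end Products

theorem measurable_finPart_upTo {A : Type*} [MeasurableSpace A] :
    Measurable fun p : Measure (A × ℝ≥0) × (A × ℝ≥0) =>
      finPart (A × ℝ≥0) p.1 (upTo A p.2.2) := by
  have hS : MeasurableSet {q : (Measure (A × ℝ≥0) × (A × ℝ≥0)) × (A × ℝ≥0) |
      q.2.2 ≤ q.1.2.2} :=
    measurableSet_le (measurable_snd.comp measurable_snd)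
      (measurable_snd.comp (measurable_snd.comp measurable_fst))
  have h := Kernel.measurable_kernel_prodMk_left
    (κ := (finPart (A × ℝ≥0)).comap (Prod.fst : Measure (A × ℝ≥0) × (A × ℝ≥0) → _)
      measurable_fst) hS
  refine measurable_of_forall_eq h fun p => ?_
  rw [Kernel.comap_apply]
  congr 1
  ext z
  simp [upTo]

theorem measurable_activeAfter (k : ℕ) :
    Measurable fun q : Bool × (ℕ → Bool) => activeAfter q.1 q.2 k := by
  induction k with
  | zero => exact measurable_fst
  | succ k ih =>
    have h1 : Measurable fun q : Bool × (ℕ → Bool) => q.2 k :=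
      (measurable_pi_apply k).comp measurable_snd
    have h2 : Measurable fun r : Bool × Bool => if r.1 then !r.2 else true := .of_discrete
    exact h2.comp (ih.prodMk h1)

theorem activeAfter_congr {d : Bool} {I J : ℕ → Bool} {k : ℕ} (h : ∀ i < k, I i = J i) :
    activeAfter d I k = activeAfter d J k := by
  induction k with
  | zero => rfl
  | succ k ih => rw [activeAfter, activeAfter, ih fun i hi => h i (hi.trans k.lt_succ_self),
      h k k.lt_succ_self]

/-! ### The state as a function of the coins and the cluster events -/

section StateOf

variable {E : Type*} [MeasurableSpace E]

/-- The mark recorded at the point `y` when the cluster events are the points of `c`. -/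
def markOf (q : Bool × (ℕ → Bool)) (c : Measure (E × ℝ≥0)) (y : E × ℝ≥0) : Bool × ℝ≥0 :=
  (activeAfter q.1 q.2 ⌊(finPart _ c (upTo E y.2)).toReal⌋₊, y.2)

/-- The state recorded when the cluster events are the points of `c`. -/
def stateOf (q : Bool × (ℕ → Bool)) (c : Measure (E × ℝ≥0)) : State E :=
  (Measure.dirac (q.1, 0) + (finPart _ c).map (markOf q c), c)

theorem measurable_markOf_uncurry :
    Measurable fun p : ((Bool × (ℕ → Bool)) × Measure (E × ℝ≥0)) × (E × ℝ≥0) =>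
      markOf p.1.1 p.1.2 p.2 := by
  have hn : Measurable fun p : ((Bool × (ℕ → Bool)) × Measure (E × ℝ≥0)) × (E × ℝ≥0) =>
      ⌊(finPart _ p.1.2 (upTo E p.2.2)).toReal⌋₊ :=
    Nat.measurable_floor.comp ((measurable_finPart_upTo (A := E)).comp
      ((measurable_snd.comp measurable_fst).prodMk measurable_snd)).ennreal_toReal
  have ha : Measurable fun r : (Bool × (ℕ → Bool)) × ℕ => activeAfter r.1.1 r.1.2 r.2 :=
    measurable_from_prod_countable_left fun k => measurable_activeAfter k
  exact (ha.comp ((measurable_fst.comp measurable_fst).prodMk hn)).prodMk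
    (measurable_snd.comp measurable_snd)

theorem measurable_markOf (q : Bool × (ℕ → Bool)) (c : Measure (E × ℝ≥0)) :
    Measurable (markOf q c) :=
  measurable_markOf_uncurry.comp (measurable_prodMk_left (x := (q, c)))

theorem measurable_stateOf :
    Measurable fun p : (Bool × (ℕ → Bool)) × Measure (E × ℝ≥0) => stateOf p.1 p.2 := by
  refine Measurable.prodMk ?_ measurable_snd
  refine (Measure.measurable_dirac.comp
    ((measurable_fst.comp measurable_fst).prodMk measurable_const)).add ?_
  refine Measure.measurable_of_measurable_coe _ fun B hB => ?_
  have h := Kernel.measurable_kernel_prodMk_left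
    (κ := (finPart (E × ℝ≥0)).comap
      (Prod.snd : (Bool × (ℕ → Bool)) × Measure (E × ℝ≥0) → _) measurable_snd)
    (measurable_markOf_uncurry hB)
  refine measurable_of_forall_eq h fun p => ?_
  rw [Measure.map_apply (measurable_markOf _ _) hB, Kernel.comap_apply]
  rfl

theorem measurable_stateOf_comp {α : Type*} [MeasurableSpace α] {f : α → Bool × (ℕ → Bool)}
    {g : α → Measure (E × ℝ≥0)} (hf : Measurable f) (hg : Measurable g) :
    Measurable fun a => stateOf (f a) (g a) :=
  Measurable.comp (g := fun p : (Bool × (ℕ → Bool)) × Measure (E × ℝ≥0) => stateOf p.1 p.2)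
    (f := fun a => (f a, g a)) measurable_stateOf (hf.prodMk hg)

/-- The mark of a point depends on the number of cluster events up to its own time. Earlier points
do not see the new one, which is number `j + 1`. -/
theorem stateOf_add_dirac {c : Measure (E × ℝ≥0)} [IsFiniteMeasure c] {j : ℕ} (hj : c univ = j)
    {y : E × ℝ≥0} (hc : ∀ᵐ z ∂c, z.2 < y.2) (q : Bool × (ℕ → Bool)) :
    stateOf q (c + Measure.dirac y) =
      addPoint (activeAfter q.1 q.2 (j + 1)) y (stateOf q c) := by
  have hcy : c (upTo E y.2) = j := by
    rw [← hj]
    refine measure_congr (eventuallyEq_univ.2 ?_)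
    filter_upwards [hc] with z hz using ⟨mem_univ _, hz.le⟩
  rw [stateOf, stateOf, addPoint, finPart_of_finite, finPart_of_finite, Prod.mk.injEq]
  refine ⟨?_, rfl⟩
  rw [Measure.map_add _ _ (measurable_markOf _ _), Measure.map_dirac' (measurable_markOf _ _),
    ← add_assoc]
  congr 2
  · refine Measure.map_congr ?_
    filter_upwards [hc] with z hz
    rw [markOf, markOf, finPart_of_finite, finPart_of_finite, Measure.add_apply,
      Measure.dirac_apply' _ (measurableSet_upTo _), indicator_of_notMem, add_zero]
    exact fun h => (mem_Iic.1 h.2).not_gt hz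
  · rw [markOf, finPart_of_finite, Measure.add_apply, hcy,
      Measure.dirac_apply' _ (measurableSet_upTo _), indicator_of_mem]
    · have : ((j : ℝ≥0∞) + 1).toReal = ((j + 1 : ℕ) : ℝ) := by
        rw [ENNReal.toReal_add (by simp) (by simp)]; simp
      simp only [Pi.one_apply, this, Nat.floor_natCast]
    · exact ⟨mem_univ _, mem_Iic.2 le_rfl⟩

/-- `c` consists of `j` points with distinct positive times, the last one no later than `s`. -/
inductive Chain : ℕ → ℝ≥0 → Measure (E × ℝ≥0) → Prop
  | nil : Chain 0 0 0
  | snoc {j : ℕ} {s : ℝ≥0} {c : Measure (E × ℝ≥0)} (y : E × ℝ≥0) :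
      Chain j s c → s < y.2 → Chain (j + 1) y.2 (c + Measure.dirac y)
  | mono {j : ℕ} {s t : ℝ≥0} {c : Measure (E × ℝ≥0)} : Chain j s c → s ≤ t → Chain j t c

namespace Chain

variable {j : ℕ} {s : ℝ≥0} {c : Measure (E × ℝ≥0)}

theorem isCounting (h : Chain j s c) : IsCounting c := by
  induction h with
  | nil => exact IsCounting.zero
  | snoc y _ _ ih => exact ih.add (IsCounting.dirac y)
  | mono _ _ ih => exact ih

theorem univ_eq (h : Chain j s c) : c univ = j := by
  induction h with
  | nil => simp
  | snoc y _ _ ih => simp [ih]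
  | mono _ _ ih => exact ih

theorem ae_le (h : Chain j s c) : ∀ᵐ z ∂c, z.2 ≤ s := by
  induction h with
  | nil => simp
  | snoc y _ hs ih =>
    rw [ae_add_measure_iff]
    refine ⟨ih.mono fun z hz => hz.trans hs.le, ?_⟩
    exact (ae_dirac_iff (measurableSet_le measurable_snd measurable_const)).2 le_rfl
  | mono _ hst ih => exact ih.mono fun z hz => hz.trans hst

theorem ae_lt (h : Chain j s c) {t : ℝ≥0} (hst : s < t) : ∀ᵐ z ∂c, z.2 < t :=
  h.ae_le.mono fun _ hz => hz.trans_lt hst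

theorem stateOf_snoc (h : Chain j s c) {y : E × ℝ≥0} (hs : s < y.2) (q : Bool × (ℕ → Bool)) :
    stateOf q (c + Measure.dirac y) =
      addPoint (activeAfter q.1 q.2 (j + 1)) y (stateOf q c) := by
  have := h.isCounting.isFiniteMeasure
  exact stateOf_add_dirac h.univ_eq (h.ae_lt hs) q

theorem stateOf_zero (q : Bool × (ℕ → Bool)) :
    stateOf q (0 : Measure (E × ℝ≥0)) = (Measure.dirac (q.1, 0), 0) := by
  rw [stateOf, finPart_of_finite, Measure.map_zero, add_zero]

theorem endsBy (h : Chain j s c) (q : Bool × (ℕ → Bool)) : EndsBy s (stateOf q c) := by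
  induction h with
  | nil =>
    rw [stateOf_zero]
    refine ⟨by simp, by simp, ?_, by simp⟩
    rw [Measure.dirac_apply' _ (MeasurableSet.univ.prod measurableSet_Ioi)]
    simp
  | snoc y h hs ih =>
    rw [h.stateOf_snoc hs]
    exact ih.addPoint hs.le _
  | mono _ hst ih => exact ih.mono hst

theorem active_stateOf (h : Chain j s c) (q : Bool × (ℕ → Bool)) :
    active (stateOf q c) = if activeAfter q.1 q.2 j then 1 else 0 := by
  classical
  induction h with
  | nil =>
    rw [stateOf_zero, activeAfter]
    have hms : ∀ (b : Bool) (q : ℝ≥0), MeasurableSet (({b} : Set Bool) ×ˢ Ici q) := fun b q =>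
      (measurableSet_singleton b).prod measurableSet_Ici
    rcases q with ⟨d, I⟩
    cases d
    · simp only [active, Bool.false_eq_true, if_false, ite_eq_right_iff, one_ne_zero, imp_false]
      rintro ⟨r, h1, -⟩
      simp [hms] at h1
    · simp only [active, if_true]
      rw [if_pos]
      exact ⟨0, by simp, by simp⟩
  | snoc y h hs ih =>
    rw [h.stateOf_snoc hs]
    obtain ⟨r, hr1, hr2⟩ := exists_between hs
    exact active_addPoint hr2 ((h.endsBy q).fst_Ici hr1) _
  | mono _ _ ih => exact ih

theorem stateOf_congr (h : Chain j s c) {q q' : Bool × (ℕ → Bool)} (h1 : q.1 = q'.1)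
    (h2 : ∀ i < j, q.2 i = q'.2 i) : stateOf q c = stateOf q' c := by
  induction h with
  | nil => rw [stateOf_zero, stateOf_zero, h1]
  | snoc y h hs ih =>
    rw [h.stateOf_snoc hs, h.stateOf_snoc hs, ih fun i hi => h2 i (hi.trans (Nat.lt_succ_self _)),
      h1, activeAfter_congr h2]
  | mono _ _ ih => exact ih h2

end Chain

end StateOf

/-! ### Averaging over labels reproduces the filter recursion -/

section ClusterLaw

variable {E : Type*} [MeasurableSpace E] {θ : Params E}

/-- The properties of the law of the pair `(D₀, (I_k))` under the reference measure. -/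
structure IsCoinLaw (p : ℝ) (κ : Measure (Bool × (ℕ → Bool))) : Prop where
  isProbabilityMeasure : IsProbabilityMeasure κ
  coin : ∀ j, κ.map (fun q => q.2 j) =
    ENNReal.ofReal p • Measure.dirac true + ENNReal.ofReal (1 - p) • Measure.dirac false
  indep : ∀ j (f : Bool → (Finset.range j → Bool) → State E),
    Measurable (fun q : Bool × (ℕ → Bool) => f q.1 (fun i => q.2 i)) →
    κ.map (fun q => (f q.1 (fun i => q.2 i), q.2 j)) =
      (κ.map fun q => f q.1 (fun i => q.2 i)).prod (κ.map fun q => q.2 j)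

theorem measurable_stateOf_left (c : Measure (E × ℝ≥0)) :
    Measurable fun q : Bool × (ℕ → Bool) => stateOf q c :=
  measurable_stateOf_comp measurable_id measurable_const

theorem Params.measurable_clusterStep_left (y : E × ℝ≥0) : Measurable (θ.clusterStep y) :=
  Measurable.comp (g := fun q : (E × ℝ≥0) × State E => θ.clusterStep q.1 q.2)
    (f := fun x => (y, x)) Params.measurable_clusterStep measurable_prodMk_left

theorem Params.Admissible.measurable_stepLaw_left (hθ : θ.Admissible) (y : E × ℝ≥0) :
    Measurable (θ.stepLaw y) :=
  Measurable.comp (g := fun q : (E × ℝ≥0) × State E => θ.stepLaw q.1 q.2)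
    (f := fun x => (y, x)) hθ.measurable_stepLaw measurable_prodMk_left

/-- The state after a cluster event, when the extinction variable is given. -/
def coinStep (y : E × ℝ≥0) (r : State E × Bool) : State E :=
  addPoint (open Classical in if active r.1 = 1 then !r.2 else true) y r.1

theorem measurable_coinStep (y : E × ℝ≥0) : Measurable (coinStep y) := by
  classical
  have hA : ∀ d, Measurable fun x : State E => addPoint d y x := fun d =>
    (measurable_addPoint d).comp (measurable_const.prodMk measurable_id)
  have : ∀ b, Measurable fun x : State E => coinStep y (x, b) := by
    intro b
    have hset : MeasurableSet {x : State E | active x = 1} :=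
      measurable_active (measurableSet_singleton 1)
    refine measurable_of_forall_eq (f := fun x : State E =>
      if active x = 1 then addPoint (!b) y x else addPoint true y x)
      (Measurable.ite hset (hA !b) (hA true)) fun x => ?_
    simp only [coinStep]
    split_ifs <;> rfl
  exact measurable_from_prod_countable_left this

theorem Chain.stateOf_eq_coinStep {j : ℕ} {s : ℝ≥0} {c : Measure (E × ℝ≥0)}
    (h : Chain j s c) {y : E × ℝ≥0} (hs : s < y.2) (q : Bool × (ℕ → Bool)) :
    stateOf q (c + Measure.dirac y) = coinStep y (stateOf q c, q.2 j) := by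
  rw [h.stateOf_snoc hs, coinStep, activeAfter]
  simp only [h.active_stateOf q]
  cases activeAfter q.1 q.2 j <;> simp

/-- The state after `j` cluster events is a function of `D₀` and the first `j` coins, hence
independent of the coin with index `j`. -/
theorem Chain.map_stateOf_prod {κ : Measure (Bool × (ℕ → Bool))}
    (hκ : IsCoinLaw (E := E) θ.p κ) {j : ℕ} {s : ℝ≥0} {c : Measure (E × ℝ≥0)}
    (h : Chain j s c) :
    κ.map (fun q => (stateOf q c, q.2 j)) = (κ.map fun q => stateOf q c).prod
      (ENNReal.ofReal θ.p • Measure.dirac true + ENNReal.ofReal (1 - θ.p) • Measure.dirac false) := by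
  classical
  -- The coins from index `j` on are set to `false`; the state does not look at them.
  have hfS : ∀ q : Bool × (ℕ → Bool), stateOf (q.1, fun i => if hi : i ∈ Finset.range j then
      (fun i : Finset.range j => q.2 i) ⟨i, hi⟩ else false) c = stateOf q c := fun q =>
    h.stateOf_congr rfl fun i hi => by simp [hi]
  have hind := hκ.indep j (fun d v =>
    stateOf (d, fun i => if hi : i ∈ Finset.range j then v ⟨i, hi⟩ else false) c)
    (measurable_of_forall_eq (measurable_stateOf_left c) hfS)
  rw [hκ.coin] at hind
  simp_rw [hfS] at hind
  exact hind

theorem map_coinStep (hθ : θ.Admissible) (y : E × ℝ≥0) (η : Measure (State E)) [IsFiniteMeasure η] :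
    (η.prod (ENNReal.ofReal θ.p • Measure.dirac true +
      ENNReal.ofReal (1 - θ.p) • Measure.dirac false)).map (coinStep y) =
      η.bind (θ.clusterStep y) := by
  have hGm := measurable_coinStep y
  ext B hB
  rw [Measure.map_apply hGm hB, Measure.prod_apply (hGm hB),
    Measure.bind_apply hB (Params.measurable_clusterStep_left y).aemeasurable]
  refine lintegral_congr fun x => ?_
  have hpq : ENNReal.ofReal θ.p + ENNReal.ofReal (1 - θ.p) = 1 := by
    rw [← ENNReal.ofReal_add hθ.p_nonneg (sub_nonneg.2 hθ.p_le_one)]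
    simp
  simp only [Params.clusterStep, Measure.add_apply, Measure.smul_apply, smul_eq_mul]
  rw [Measure.dirac_apply' _ (measurable_prodMk_left (hGm hB)),
    Measure.dirac_apply' _ (measurable_prodMk_left (hGm hB)), Measure.dirac_apply' _ hB,
    Measure.dirac_apply' _ hB]
  have hpre : ∀ b, (Prod.mk x ⁻¹' (coinStep y ⁻¹' B)).indicator (1 : Bool → ℝ≥0∞) b =
      B.indicator 1 (coinStep y (x, b)) := fun b => rfl
  rw [hpre, hpre]
  rcases active_eq_zero_or_one x with hx | hx
  · simp only [coinStep, hx, zero_ne_one, if_false, sub_zero, ENNReal.ofReal_one, one_mul,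
      ENNReal.ofReal_zero, zero_mul, add_zero]
    rw [← add_mul, hpq, one_mul]
  · simp only [coinStep, hx, if_true, sub_self, ENNReal.ofReal_zero, zero_mul, zero_add,
      ENNReal.ofReal_one, one_mul, Bool.not_true, Bool.not_false]

/-- Each cluster event consumes a fresh coin, so the law of the state moves by the Markov kernel
`clusterStep`. -/
theorem IsCoinLaw.map_stateOf_add_dirac (hθ : θ.Admissible) {κ : Measure (Bool × (ℕ → Bool))}
    (hκ : IsCoinLaw (E := E) θ.p κ) {j : ℕ} {s : ℝ≥0} {c : Measure (E × ℝ≥0)}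
    (h : Chain j s c) {y : E × ℝ≥0} (hs : s < y.2) :
    κ.map (fun q => stateOf q (c + Measure.dirac y)) =
      (κ.map fun q => stateOf q c).bind (θ.clusterStep y) := by
  have hprob := hκ.isProbabilityMeasure
  have hS := measurable_stateOf_left c
  have hqj : Measurable fun q : Bool × (ℕ → Bool) => q.2 j :=
    (measurable_pi_apply j).comp measurable_snd
  rw [← map_coinStep hθ, ← h.map_stateOf_prod hκ,
    Measure.map_map (measurable_coinStep y) (hS.prodMk hqj)]
  congr 1
  funext q
  exact h.stateOf_eq_coinStep hs q

variable (hθ : θ.Admissible)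

theorem bind_add_left {α β : Type*} [MeasurableSpace α] [MeasurableSpace β] {m n : Measure α}
    {f : α → Measure β} (hf : Measurable f) : (m + n).bind f = m.bind f + n.bind f := by
  ext s hs
  rw [Measure.add_apply, Measure.bind_apply hs hf.aemeasurable,
    Measure.bind_apply hs hf.aemeasurable, Measure.bind_apply hs hf.aemeasurable,
    lintegral_add_measure]

theorem bind_finsetSum {ι α β : Type*} [MeasurableSpace α] [MeasurableSpace β] (s : Finset ι)
    {m : ι → Measure α} {f : α → Measure β} (hf : Measurable f) :
    (∑ i ∈ s, m i).bind f = ∑ i ∈ s, (m i).bind f := by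
  classical
  induction s using Finset.induction_on with
  | empty => simp
  | insert i s hi ih => rw [Finset.sum_insert hi, Finset.sum_insert hi, bind_add_left hf, ih]

theorem bind_stepLaw (hθ : θ.Admissible) (y : E × ℝ≥0) (η : Measure (State E)) :
    η.bind (θ.stepLaw y) =
      (θ.keepW y : ℝ≥0∞) • η + (θ.joinW y : ℝ≥0∞) • η.bind (θ.clusterStep y) := by
  have hcs := Params.measurable_clusterStep_left (θ := θ) y
  ext B hB
  have h1 : Measurable fun a : State E => Measure.dirac a B :=
    (Measure.measurable_coe hB).comp Measure.measurable_dirac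
  have h2 : Measurable fun a : State E => θ.clusterStep y a B :=
    (Measure.measurable_coe hB).comp hcs
  rw [Measure.bind_apply hB (hθ.measurable_stepLaw_left y).aemeasurable]
  simp only [Params.stepLaw, Measure.add_apply, Measure.smul_apply, smul_eq_mul]
  rw [lintegral_add_left (h1.const_mul _), lintegral_const_mul _ h1, lintegral_const_mul _ h2,
    Measure.bind_apply hB hcs.aemeasurable,
    ← Measure.bind_apply hB Measure.measurable_dirac.aemeasurable, Measure.bind_dirac]

/-- The probability that a point is a cluster event (`true`) or not (`false`). -/
def Params.splitW (θ : Params E) (b : Bool) (y : E × ℝ≥0) : ℝ≥0 :=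
  if b then θ.joinW y else θ.keepW y

theorem isCounting_sum_dirac {α : Type*} [MeasurableSpace α] {n : ℕ} (y : Fin n → α) :
    IsCounting (∑ i, Measure.dirac (y i)) :=
  ⟨Finset.univ.val.map y, by rw [Multiset.map_map]; rfl⟩

theorem sum_dirac_univ {α : Type*} [MeasurableSpace α] {n : ℕ} (y : Fin n → α) :
    (∑ i, Measure.dirac (y i) : Measure α) univ = n := by
  simp

theorem exists_chain {n : ℕ} {y : Fin n → E × ℝ≥0} (hy : StrictMono fun i => (y i).2)
    {t : ℝ≥0} (ht : ∀ i, (y i).2 < t) (hpos : ∀ i, 0 < (y i).2) (ht0 : 0 < t) (b : Fin n → Bool) :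
    ∃ j s, s < t ∧ Chain j s (pairConfig b y true) := by
  induction n generalizing t with
  | zero => exact ⟨0, 0, ht0, by simpa [pairConfig] using Chain.nil⟩
  | succ n ih =>
    obtain ⟨j, s, hs, hc⟩ := ih (y := fun i => y i.castSucc) (t := (y (Fin.last n)).2)
      (fun i k hik => hy (Fin.castSucc_lt_castSucc_iff.2 hik)) (fun i => hy (Fin.castSucc_lt_last i))
      (fun i => hpos _) (hpos _) (fun i => b i.castSucc)
    have e := pairConfig_snoc (fun i => b i.castSucc) (b (Fin.last n)) y true
    rw [show (Fin.snoc (fun i => b i.castSucc) (b (Fin.last n)) : Fin (n + 1) → Bool) = b from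
      Fin.snoc_init_self b] at e
    rw [e]
    cases b (Fin.last n)
    · exact ⟨j, s, hs.trans (ht _), by simpa using hc⟩
    · exact ⟨j + 1, _, ht _, by simpa using hc.snoc _ hs⟩

/-- Induction on the last point in time. Its label splits the sum into a part with weight `keepW`
that leaves the state alone and a part with weight `joinW` that applies `clusterStep`; together they
are `stepLaw`. -/
theorem sum_splitW_map_stateOf_of_strictMono [MeasurableSingletonClass E]
    {κ : Measure (Bool × (ℕ → Bool))} (hκ : IsCoinLaw (E := E) θ.p κ) (ρ : Measure (State E))
    [IsFiniteMeasure ρ] (hρ : κ.map (fun q => stateOf q 0) = ρ)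
    {n : ℕ} {y : Fin n → E × ℝ≥0} (hy : StrictMono fun i => (y i).2) (hpos : ∀ i, 0 < (y i).2) :
    ∑ b : Fin n → Bool, (∏ i, (θ.splitW (b i) (y i) : ℝ≥0∞)) •
        κ.map (fun q => stateOf q (pairConfig b y true)) =
      hθ.pathLaw ρ n (∑ i, Measure.dirac (y i)) := by
  induction n with
  | zero => simpa [pairConfig, Params.Admissible.pathLaw] using hρ
  | succ n ih =>
    have hy' : StrictMono fun i : Fin n => (y i.castSucc).2 :=
      fun i k hik => hy (Fin.castSucc_lt_castSucc_iff.2 hik)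
    have hlast : ∀ i : Fin n, (y i.castSucc).2 < (y (Fin.last n)).2 :=
      fun i => hy (Fin.castSucc_lt_last i)
    have ih' := ih (y := fun i => y i.castSucc) hy' fun i => hpos _
    have hst : Measurable (θ.stepLaw (y (Fin.last n))) :=
    hθ.measurable_stepLaw_left _
    have hcs : Measurable (θ.clusterStep (y (Fin.last n))) :=
      Params.measurable_clusterStep_left _
    rw [Fin.sum_univ_castSucc, pathLaw_add_dirac hθ ρ (isCounting_sum_dirac _) (sum_dirac_univ _),
      ← ih', sum_fin_succ_fun, bind_finsetSum _ hst]
    · refine Finset.sum_congr rfl fun b _ => ?_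
      obtain ⟨j, s, hs, hc⟩ := exists_chain (y := fun i : Fin n => y i.castSucc) hy' hlast
        (fun i => hpos _) (hpos _) b
      rw [pairConfig_snoc, pairConfig_snoc, if_neg (by simp), if_pos rfl, add_zero,
        hκ.map_stateOf_add_dirac hθ hc hs, Fin.prod_univ_castSucc, Fin.prod_univ_castSucc]
      simp only [Fin.snoc_castSucc, Fin.snoc_last]
      rw [mul_smul, mul_smul, ← smul_add, Measure.bind_smul]
      congr 1
      rw [bind_stepLaw hθ]
      simp [Params.splitW]
    · refine ae_finsetSum_measure_iff.2 fun i _ => ?_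
      exact (ae_dirac_iff (measurableSet_lt measurable_snd measurable_const)).2 (hlast i)

/-- Both sides are symmetric in the points, so the points may be sorted by time. -/
theorem sum_splitW_map_stateOf [MeasurableSingletonClass E]
    {κ : Measure (Bool × (ℕ → Bool))} (hκ : IsCoinLaw (E := E) θ.p κ) (ρ : Measure (State E))
    [IsFiniteMeasure ρ] (hρ : κ.map (fun q => stateOf q 0) = ρ)
    {n : ℕ} {y : Fin n → E × ℝ≥0} (hy : Function.Injective fun i => (y i).2)
    (hpos : ∀ i, 0 < (y i).2) :
    ∑ b : Fin n → Bool, (∏ i, (θ.splitW (b i) (y i) : ℝ≥0∞)) •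
        κ.map (fun q => stateOf q (pairConfig b y true)) =
      hθ.obsLaw ρ (∑ i, Measure.dirac (y i)) := by
  rw [obsLaw_apply hθ ρ (sum_dirac_univ y)]
  set σ := Tuple.sort fun i => (y i).2 with hσ
  have hmono : StrictMono fun i => ((y ∘ σ) i).2 :=
    (Tuple.monotone_sort fun i => (y i).2).strictMono_of_injective (hy.comp σ.injective)
  have h := sum_splitW_map_stateOf_of_strictMono hθ hκ ρ hρ hmono fun i => hpos _
  have hsum : ∑ i, (Measure.dirac ((y ∘ σ) i) : Measure (E × ℝ≥0)) = ∑ i, Measure.dirac (y i) :=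
    Equiv.sum_comp σ fun i => (Measure.dirac (y i) : Measure (E × ℝ≥0))
  rw [hsum] at h
  rw [← h]
  refine Fintype.sum_equiv (Equiv.arrowCongr σ.symm (Equiv.refl Bool)) _ _ fun b => ?_
  have hb : (Equiv.arrowCongr σ.symm (Equiv.refl Bool)) b = b ∘ σ := by
    ext i; simp [Equiv.arrowCongr]
  rw [hb, pairConfig_comp]
  congr 1
  exact (Equiv.prod_comp σ fun i => (θ.splitW (b i) (y i) : ℝ≥0∞)).symm

end ClusterLaw

/-! ### Absence of simultaneous points -/

section SimpleTimes

variable {E : Type*} [MeasurableSpace E]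

/-- No two points have the same time, and no point has time `0`. -/
def SimpleTimes (m : Measure (E × ℝ≥0)) : Prop :=
  m (univ ×ˢ {0}) = 0 ∧ ∫⁻ y, finPart _ m (univ ×ˢ {y.2}) ∂(finPart _ m) ≤ m univ

theorem measurableSet_time (t : ℝ≥0) : MeasurableSet ((univ : Set E) ×ˢ {t}) :=
  MeasurableSet.univ.prod (measurableSet_singleton t)

theorem measurable_finPart_time :
    Measurable fun p : Measure (E × ℝ≥0) × (E × ℝ≥0) =>
      finPart (E × ℝ≥0) p.1 (univ ×ˢ {p.2.2}) := by
  have hS : MeasurableSet {q : (Measure (E × ℝ≥0) × (E × ℝ≥0)) × (E × ℝ≥0) |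
      q.2.2 = q.1.2.2} :=
    measurableSet_eq_fun (measurable_snd.comp measurable_snd)
      (measurable_snd.comp (measurable_snd.comp measurable_fst))
  have h := Kernel.measurable_kernel_prodMk_left
    (κ := (finPart (E × ℝ≥0)).comap (Prod.fst : Measure (E × ℝ≥0) × (E × ℝ≥0) → _)
      measurable_fst) hS
  refine measurable_of_forall_eq h fun p => ?_
  rw [Kernel.comap_apply]
  congr 1
  ext z
  simp

theorem measurableSet_simpleTimes : MeasurableSet {m : Measure (E × ℝ≥0) | SimpleTimes m} := by
  refine MeasurableSet.inter ?_ ?_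
  · exact (Measure.measurable_coe (measurableSet_time 0)) (measurableSet_singleton 0)
  · exact measurableSet_le (Measurable.lintegral_kernel_prod_right' (κ := finPart (E × ℝ≥0))
      (f := fun p : Measure (E × ℝ≥0) × (E × ℝ≥0) => finPart (E × ℝ≥0) p.1 (univ ×ˢ {p.2.2}))
      measurable_finPart_time) (Measure.measurable_coe MeasurableSet.univ)

theorem simpleTimes_sum_dirac {n : ℕ} {y : Fin n → E × ℝ≥0}
    (hy : Function.Injective fun i => (y i).2) (hpos : ∀ i, 0 < (y i).2) :
    SimpleTimes (∑ i, Measure.dirac (y i)) := by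
  have := (isCounting_sum_dirac y).isFiniteMeasure
  have hval : ∀ t, (∑ i, Measure.dirac (y i) : Measure (E × ℝ≥0)) (univ ×ˢ {t}) =
      ∑ i, if (y i).2 = t then 1 else 0 := by
    intro t
    rw [Measure.coe_finsetSum, Finset.sum_apply]
    refine Finset.sum_congr rfl fun i _ => ?_
    rw [Measure.dirac_apply' _ (measurableSet_time t)]
    simp [indicator]
  refine ⟨?_, ?_⟩
  · rw [hval]
    exact Finset.sum_eq_zero fun i _ => if_neg (hpos i).ne'
  · rw [finPart_of_finite, lintegral_finsetSum_measure, sum_dirac_univ]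
    have hm : Measurable fun z : E × ℝ≥0 =>
        (∑ i, Measure.dirac (y i) : Measure (E × ℝ≥0)) (univ ×ˢ {z.2}) := by
      refine measurable_of_forall_eq
        (measurable_finPart_time.comp (measurable_prodMk_left (x := ∑ i, Measure.dirac (y i))))
        fun z => ?_
      rw [Function.comp_apply, finPart_of_finite]
    have h1 : ∀ i, ∫⁻ z, (∑ i, Measure.dirac (y i) : Measure (E × ℝ≥0)) (univ ×ˢ {z.2})
        ∂(Measure.dirac (y i)) = 1 := by
      intro i
      rw [lintegral_dirac' _ hm, hval, Finset.sum_eq_single i]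
      · simp
      · intro j _ hj
        exact if_neg fun h => hj (hy h)
      · simp
    rw [Finset.sum_congr rfl fun i _ => h1 i]
    simp

/-- Every point counts itself, so the inner mass is at least one at almost every point. The integral
condition, chosen because it is measurable in the configuration, then forces equality. -/
theorem SimpleTimes.le_one [MeasurableSingletonClass E] {m : Measure (E × ℝ≥0)}
    (h : SimpleTimes m) (hm : IsCounting m) (t : ℝ≥0) : m (univ ×ˢ {t}) ≤ 1 := by
  have := hm.isFiniteMeasure
  have h2 := h.2
  rw [finPart_of_finite] at h2
  have hmeas : Measurable fun z : E × ℝ≥0 => m (univ ×ˢ {z.2}) := by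
    refine measurable_of_forall_eq
      (measurable_finPart_time.comp (measurable_prodMk_left (x := m))) fun z => ?_
    rw [Function.comp_apply, finPart_of_finite]
  have hge : ∀ᵐ y ∂m, 1 ≤ m (univ ×ˢ {y.2}) := by
    filter_upwards [hm.ae_one_le] with y hy
    exact hy.trans (measure_mono fun z hz => by rw [mem_singleton_iff.1 hz]; simp)
  have hae : ∀ᵐ y ∂m, m (univ ×ˢ {y.2}) = 1 := by
    have hone : ∫⁻ _, 1 ∂m = m univ := by simp
    have := ae_eq_of_ae_le_of_lintegral_le hge (by rw [hone]; exact measure_ne_top _ _)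
      hmeas.aemeasurable (by rwa [hone])
    exact this.mono fun y hy => hy.symm
  by_contra hcon
  have hne : m (univ ×ˢ {t}) ≠ 0 := fun h0 => hcon (by simp [h0])
  have : ∃ᵐ y ∂m, y ∈ (univ : Set E) ×ˢ {t} := frequently_ae_mem_iff.2 hne
  obtain ⟨y, hy1, hy2⟩ := (this.and_eventually hae).exists
  rw [← hy2, mem_singleton_iff.1 hy1.2] at hcon
  exact hcon le_rfl

end SimpleTimes

/-! ### The conditional law of the state under the reference measure -/

section MapRestrict

variable {α : Type*} [MeasurableSpace α]

theorem measurable_restrict_measure {S : Set α} (hS : MeasurableSet S) :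
    Measurable fun m : Measure α => m.restrict S := by
  refine Measure.measurable_of_measurable_coe _ fun B hB => ?_
  simp only [Measure.restrict_apply hB]
  exact Measure.measurable_coe (hB.inter hS)

end MapRestrict

namespace Params

variable {E : Type*} [MeasurableSpace E] {θ : Params E}

/-- The mean measure of the observed points up to time `T`. -/
def meanO (θ : Params E) (T : ℝ≥0) : Measure (E × ℝ≥0) :=
  ((θ.ν.prod lebesgue).restrict (upTo E T)).withDensity fun y => ((θ.rateQ y + θ.γ y : ℝ≥0) : ℝ≥0∞)

theorem Admissible.measurable_splitW (hθ : θ.Admissible) (b : Bool) : Measurable (θ.splitW b) := by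
  have hs := hθ.measurable_rateQ.add hθ.measurable_γ
  cases b
  · exact hθ.measurable_γ.div hs
  · exact hθ.measurable_rateQ.div hs

/-- Thinning at the level of intensities: `λ_Q + γ` times the label probability gives back `λ_Q` or
`γ`. Division is harmless because `λ_Q > 0`. -/
theorem Admissible.meanO_withDensity (hθ : θ.Admissible) (T : ℝ≥0) (b : Bool) :
    (θ.meanO T).withDensity (fun y => (θ.splitW b y : ℝ≥0∞)) =
      (if b then θ.mean₁ else θ.mean₀).restrict (upTo E T) := by
  have hpos : ∀ y, θ.rateQ y + θ.γ y ≠ 0 := fun y =>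
    (add_pos_of_pos_of_nonneg (hθ.rateQ_pos y) zero_le).ne'
  have hs : Measurable fun y => ((θ.rateQ y + θ.γ y : ℝ≥0) : ℝ≥0∞) :=
    (hθ.measurable_rateQ.add hθ.measurable_γ).coe_nnreal_ennreal
  rw [meanO, ← withDensity_mul _ hs (hθ.measurable_splitW b).coe_nnreal_ennreal]
  cases b
  · simp only [Bool.false_eq_true, if_false]
    rw [mean₀, restrict_withDensity (measurableSet_upTo _)]
    congr 1
    funext y
    simp only [Pi.mul_apply, splitW, Bool.false_eq_true, if_false, keepW]
    rw [← ENNReal.coe_mul, mul_div_cancel₀ _ (hpos y)]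
  · simp only [if_true]
    rw [mean₁, restrict_withDensity (measurableSet_upTo _)]
    congr 1
    funext y
    simp only [Pi.mul_apply, splitW, if_true, joinW]
    rw [← ENNReal.coe_mul, mul_div_cancel₀ _ (hpos y)]

theorem Admissible.isFiniteMeasure_meanO (hθ : θ.Admissible) (T : ℝ≥0) :
    IsFiniteMeasure (θ.meanO T) := by
  refine ⟨?_⟩
  have h1 := hθ.mean₁_finite T
  have h0 := hθ.mean₀_finite T
  rw [mean₁, withDensity_apply _ (measurableSet_upTo _)] at h1
  rw [mean₀, withDensity_apply _ (measurableSet_upTo _)] at h0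
  rw [meanO, withDensity_apply _ MeasurableSet.univ, Measure.restrict_univ]
  simp only [ENNReal.coe_add]
  rw [lintegral_add_left hθ.measurable_rateQ.coe_nnreal_ennreal]
  exact ENNReal.add_lt_top.2 ⟨h1, h0⟩

theorem Admissible.meanO_time (hθ : θ.Admissible) (T t : ℝ≥0) :
    θ.meanO T {y | y.2 = t} = 0 := by
  have := hθ.sigmaFinite
  have h : (θ.ν.prod lebesgue) {y | y.2 = t} = 0 := by
    have := ae_time_ne (ν := θ.ν) t
    rw [ae_iff] at this
    simpa using this
  exact withDensity_absolutelyContinuous _ _ (Measure.absolutelyContinuous_of_le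
    Measure.restrict_le_self h)

theorem sum_prod_splitW (hθ : θ.Admissible) {n : ℕ} (y : Fin n → E × ℝ≥0) :
    ∑ b : Fin n → Bool, ∏ i, (θ.splitW (b i) (y i) : ℝ≥0∞) = 1 := by
  have h := (Finset.prod_univ_sum (fun _ : Fin n => (Finset.univ : Finset Bool))
    fun i c => (θ.splitW c (y i) : ℝ≥0∞))
  rw [Fintype.piFinset_univ] at h
  rw [← h]
  refine Finset.prod_eq_one fun i _ => ?_
  rw [Fintype.sum_bool]
  simp only [splitW, if_true, Bool.false_eq_true, if_false]
  rw [← ENNReal.coe_add, add_comm, hθ.keepW_add_joinW, ENNReal.coe_one]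

end Params

namespace Model

variable {E Ω : Type*} [MeasurableSpace E] {mΩ : MeasurableSpace Ω} {X : Model E Ω}
  {θ : Params E} {ℱ : Filtration ℝ≥0 mΩ} {Q : Measure Ω}

/-- The initial value of `D` together with the extinction variables. -/
def coins (X : Model E Ω) (ω : Ω) : Bool × (ℕ → Bool) := (X.D₀ ω, fun k => X.I k ω)

/-- The law of the initial state. -/
def initLaw (X : Model E Ω) (Q : Measure Ω) : Measure (State E) :=
  (Q.map X.coins).map fun q => stateOf q 0

/-- The observed points up to time `T`. -/
def obsUpTo (X : Model E Ω) (T : ℝ≥0) (ω : Ω) : Measure (E × ℝ≥0) := (X.O ω).restrict (upTo E T)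

/-- The cluster events (`true`) and single events (`false`) up to time `T`. -/
def split (X : Model E Ω) (T : ℝ≥0) (ω : Ω) (b : Bool) : Measure (E × ℝ≥0) :=
  (if b then X.C ω else X.N ω).restrict (upTo E T)

theorem split_add (T : ℝ≥0) (ω : Ω) : X.split T ω true + X.split T ω false = X.obsUpTo T ω := by
  simp [split, obsUpTo, O, add_comm]

namespace IsReference

theorem measurable_coins (hX : X.IsReference θ ℱ Q) : Measurable X.coins :=
  hX.measurable_D₀.prodMk (measurable_pi_lambda _ hX.measurable_I)

theorem isCounting_C (hX : X.IsReference θ ℱ Q) (T : ℝ≥0) (ω : Ω) :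
    IsCounting ((X.C ω).restrict (upTo E T)) := hX.poisson_C.counting ω T

theorem isCounting_N (hX : X.IsReference θ ℱ Q) (T : ℝ≥0) (ω : Ω) :
    IsCounting ((X.N ω).restrict (upTo E T)) := hX.poisson_N.counting ω T

theorem isCounting_obsUpTo (hX : X.IsReference θ ℱ Q) (T : ℝ≥0) (ω : Ω) :
    IsCounting (X.obsUpTo T ω) := by
  rw [obsUpTo, O, Measure.restrict_add]
  exact (hX.isCounting_N T ω).add (hX.isCounting_C T ω)

theorem state_eq (hX : X.IsReference θ ℱ Q) (T : ℝ≥0) (ω : Ω) :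
    X.state T ω = stateOf (X.coins ω) ((X.C ω).restrict (upTo E T)) := by
  have := (hX.isCounting_C T ω).isFiniteMeasure
  rw [state, stateOf, finPart_of_finite, Prod.mk.injEq]
  refine ⟨?_, rfl⟩
  congr 1
  refine Measure.map_congr ?_
  filter_upwards [ae_restrict_mem (measurableSet_upTo T)] with y hy
  have hsub : upTo E y.2 ⊆ upTo E T := prod_mono le_rfl (Iic_subset_Iic.2 (mem_Iic.1 hy.2))
  rw [markOf, finPart_of_finite, D, count, Measure.restrict_apply (measurableSet_upTo _),
    inter_eq_left.2 hsub]
  rfl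

theorem measurable_split (hX : X.IsReference θ ℱ Q) (T : ℝ≥0) : Measurable (X.split T) := by
  refine measurable_pi_lambda _ fun b => ?_
  cases b
  · exact (measurable_restrict_measure (measurableSet_upTo T)).comp hX.poisson_N.measurable
  · exact (measurable_restrict_measure (measurableSet_upTo T)).comp hX.poisson_C.measurable

theorem measurable_obsUpTo (hX : X.IsReference θ ℱ Q) (T : ℝ≥0) : Measurable (X.obsUpTo T) :=
  (measurable_restrict_measure (measurableSet_upTo T)).comp
    (hX.poisson_N.measurable.add hX.poisson_C.measurable)

theorem measurable_state (hX : X.IsReference θ ℱ Q) (T : ℝ≥0) : Measurable (X.state T) := by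
  have h : Measurable fun ω => (X.coins ω, (X.C ω).restrict (upTo E T)) :=
    hX.measurable_coins.prodMk
      ((measurable_restrict_measure (measurableSet_upTo T)).comp hX.poisson_C.measurable)
  exact measurable_of_forall_eq (measurable_stateOf.comp h) fun ω => hX.state_eq T ω

variable [IsProbabilityMeasure Q]

theorem map_split (hX : X.IsReference θ ℱ Q) (hθ : θ.Admissible) (T : ℝ≥0) :
    Q.map (X.split T) = poissonPair fun b => (θ.meanO T).withDensity fun y => (θ.splitW b y : ℝ≥0∞) := by
  have hfin : ∀ b : Bool, IsFiniteMeasure ((if b then θ.mean₁ else θ.mean₀).restrict (upTo E T)) := by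
    intro b
    refine ⟨?_⟩
    rw [Measure.restrict_apply MeasurableSet.univ, univ_inter]
    cases b
    · exact hθ.mean₀_finite T
    · exact hθ.mean₁_finite T
  simp_rw [hθ.meanO_withDensity]
  have hP : ∀ b : Bool, IsPoissonRandomMeasure Q (if b then θ.mean₁ else θ.mean₀)
      (fun ω => if b then X.C ω else X.N ω) := by
    intro b
    cases b
    · exact hX.poisson_N
    · exact hX.poisson_C
  refine map_eq_poissonPair (hX.measurable_split T) ?_ ?_ ?_ ?_
  · intro ω b
    cases b
    · exact (hX.isCounting_N T ω).isFiniteMeasure.measure_univ_lt_top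
    · exact (hX.isCounting_C T ω).isFiniteMeasure.measure_univ_lt_top
  · exact (hX.indep_N_C.comp (measurable_restrict_measure (measurableSet_upTo T))
      (measurable_restrict_measure (measurableSet_upTo T))).symm
  · intro b B hB
    have h := (hP b).law (B ∩ upTo E T) (hB.inter (measurableSet_upTo T)) (by
      rw [← Measure.restrict_apply hB]; exact measure_lt_top _ _)
    simp only [split, Measure.restrict_apply hB]
    exact h
  · intro b n B hB hd
    have h := (hP b).indep n (fun i => B i ∩ upTo E T)
      (fun i => (hB i).inter (measurableSet_upTo T))
      fun i j hij => (hd hij).mono inter_subset_left inter_subset_left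
    simp only [split, Measure.restrict_apply (hB _)]
    exact h

theorem map_split_coins (hX : X.IsReference θ ℱ Q) (T : ℝ≥0) :
    Q.map (fun ω => (X.split T ω, X.coins ω)) = (Q.map (X.split T)).prod (Q.map X.coins) := by
  refine (indepFun_iff_map_prod_eq_prod_map_map (hX.measurable_split T).aemeasurable
    hX.measurable_coins.aemeasurable).1 ?_
  have hm : Measurable fun p : Measure (E × ℝ≥0) × Measure (E × ℝ≥0) => fun b : Bool =>
      (if b then p.2 else p.1).restrict (upTo E T) := by
    refine measurable_pi_lambda _ fun b => ?_
    cases b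
    · exact (measurable_restrict_measure (measurableSet_upTo T)).comp measurable_fst
    · exact (measurable_restrict_measure (measurableSet_upTo T)).comp measurable_snd
  exact hX.indep_NC_D₀I.comp hm measurable_id

/-- Independence of `D₀` from all coins and of the coins among themselves is regrouped by
associativity of the product measure. -/
theorem indepFun_coins (hX : X.IsReference θ ℱ Q) (j : ℕ) :
    IndepFun (fun ω => (X.D₀ ω, fun i : Finset.range j => X.I i ω)) (X.I j) Q := by
  classical
  have hB : Measurable fun ω => fun i : Finset.range j => X.I i ω :=
    measurable_pi_lambda _ fun i => hX.measurable_I i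
  have hA := hX.measurable_D₀
  have hC := hX.measurable_I j
  have h1 : IndepFun X.D₀ (fun ω => ((fun i : Finset.range j => X.I i ω), X.I j ω)) Q :=
    hX.indep_D₀_I.comp (ψ := fun v : ℕ → Bool => ((fun i : Finset.range j => v i), v j))
      measurable_id ((measurable_pi_lambda _ fun i => measurable_pi_apply _).prodMk
        (measurable_pi_apply j))
  have h2 : IndepFun (fun ω => fun i : Finset.range j => X.I i ω) (X.I j) Q := by
    have h := hX.indep_I.indepFun_finset (Finset.range j) {j} (by simp) hX.measurable_I
    exact h.comp (ψ := fun v : ({j} : Finset ℕ) → Bool => v ⟨j, Finset.mem_singleton_self j⟩)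
      measurable_id (measurable_pi_apply _)
  have h3 : IndepFun X.D₀ (fun ω => fun i : Finset.range j => X.I i ω) Q :=
    h1.comp measurable_id measurable_fst
  rw [indepFun_iff_map_prod_eq_prod_map_map hA.aemeasurable (hB.prodMk hC).aemeasurable,
    h2.map_prod_eq_prod_map_map hB.aemeasurable hC.aemeasurable] at h1
  rw [indepFun_iff_map_prod_eq_prod_map_map (hA.prodMk hB).aemeasurable hC.aemeasurable,
    h3.map_prod_eq_prod_map_map hA.aemeasurable hB.aemeasurable]
  have := Measure.isProbabilityMeasure_map (μ := Q) hA.aemeasurable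
  have := Measure.isProbabilityMeasure_map (μ := Q) hB.aemeasurable
  have := Measure.isProbabilityMeasure_map (μ := Q) hC.aemeasurable
  have hmp := (measurePreserving_prodAssoc (Q.map X.D₀)
    (Q.map fun ω => fun i : Finset.range j => X.I i ω) (Q.map (X.I j))).symm
  rw [← hmp.map_eq, ← h1, Measure.map_map (MeasurableEquiv.measurable _) (hA.prodMk (hB.prodMk hC))]
  rfl

theorem isCoinLaw (hX : X.IsReference θ ℱ Q) (hθ : θ.Admissible) :
    IsCoinLaw (E := E) θ.p (Q.map X.coins) := by
  have hc := hX.measurable_coins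
  have hIm : ∀ j, Measurable fun q : Bool × (ℕ → Bool) => q.2 j := fun j =>
    (measurable_pi_apply j).comp measurable_snd
  refine ⟨Measure.isProbabilityMeasure_map hc.aemeasurable, fun j => ?_, fun j f hf => ?_⟩
  · rw [Measure.map_map (hIm j) hc]
    have e : ((fun q : Bool × (ℕ → Bool) => q.2 j) ∘ X.coins) = X.I j := rfl
    rw [e]
    have := Measure.isProbabilityMeasure_map (μ := Q) (hX.measurable_I j).aemeasurable
    have ht : Q.map (X.I j) {true} = ENNReal.ofReal θ.p := by
      rw [Measure.map_apply (hX.measurable_I j) (measurableSet_singleton _)]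
      exact hX.bernoulli j
    refine Measure.ext_of_singleton fun b => ?_
    cases b
    · have hcompl : ({false} : Set Bool) = {true}ᶜ := by ext b; cases b <;> simp
      have h1 : Q.map (X.I j) {false} = ENNReal.ofReal (1 - θ.p) := by
        rw [hcompl, prob_compl_eq_one_sub (measurableSet_singleton _), ht,
          ENNReal.ofReal_sub _ hθ.p_nonneg, ENNReal.ofReal_one]
      rw [h1]; simp
    · rw [ht]; simp
  · rw [Measure.map_map (hf.prodMk (hIm j)) hc, Measure.map_map hf hc, Measure.map_map (hIm j) hc]
    have hfd : Measurable fun r : Bool × (Finset.range j → Bool) => f r.1 r.2 := .of_discrete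
    exact ((hX.indepFun_coins j).comp hfd measurable_id).map_prod_eq_prod_map_map
      (hf.comp hc).aemeasurable (hX.measurable_I j).aemeasurable

theorem isProbabilityMeasure_initLaw (hX : X.IsReference θ ℱ Q) :
    IsProbabilityMeasure (X.initLaw Q) := by
  have := Measure.isProbabilityMeasure_map (μ := Q) hX.measurable_coins.aemeasurable
  exact Measure.isProbabilityMeasure_map (measurable_stateOf_left 0).aemeasurable

theorem ae_pi_points (hθ : θ.Admissible) (T : ℝ≥0) (n : ℕ) :
    have := hθ.isFiniteMeasure_meanO T
    ∀ᵐ y ∂(Measure.pi fun _ : Fin n => θ.meanO T),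
      (Function.Injective fun i => (y i).2) ∧ ∀ i, 0 < (y i).2 := by
  have := hθ.isFiniteMeasure_meanO T
  have h0 : ∀ᵐ y ∂(θ.meanO T), 0 < y.2 := by
    have := hθ.meanO_time T 0
    refine measure_mono_null (fun y hy => ?_) this
    simpa using hy
  exact (ae_pi_injective _ measurable_snd (hθ.meanO_time T)).and (ae_pi_forall _ h0)

/-- In the representation by labelled points, the unlabelled points are sampled from `meanO` and
carry independent labels with probabilities `splitW`. Two functionals with the same label averages
have the same expectation, and points with equal or zero times may be ignored. -/
theorem lintegral_poissonPair_split (hθ : θ.Admissible) (T : ℝ≥0)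
    {A B : (Bool → Measure (E × ℝ≥0)) → ℝ≥0∞} (hA : Measurable A) (hB : Measurable B)
    (h : ∀ n (y : Fin n → E × ℝ≥0), (Function.Injective fun i => (y i).2) → (∀ i, 0 < (y i).2) →
      ∑ b : Fin n → Bool, (∏ i, (θ.splitW (b i) (y i) : ℝ≥0∞)) * A (pairConfig b y) =
        ∑ b : Fin n → Bool, (∏ i, (θ.splitW (b i) (y i) : ℝ≥0∞)) * B (pairConfig b y)) :
    ∫⁻ z, A z ∂(poissonPair fun b => (θ.meanO T).withDensity fun y => (θ.splitW b y : ℝ≥0∞)) =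
      ∫⁻ z, B z ∂(poissonPair fun b =>
        (θ.meanO T).withDensity fun y => (θ.splitW b y : ℝ≥0∞)) := by
  have hfm := hθ.isFiniteMeasure_meanO T
  have hfin : ∀ b : Bool, IsFiniteMeasure
      ((θ.meanO T).withDensity fun y => (θ.splitW b y : ℝ≥0∞)) := by
    intro b
    rw [hθ.meanO_withDensity]
    refine ⟨?_⟩
    rw [Measure.restrict_apply MeasurableSet.univ, univ_inter]
    cases b
    · exact hθ.mean₀_finite T
    · exact hθ.mean₁_finite T
  have hw : ∀ b, Measurable fun y => (θ.splitW b y : ℝ≥0∞) := fun b =>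
    (hθ.measurable_splitW b).coe_nnreal_ennreal
  have key : ∀ (n : ℕ) {A : (Bool → Measure (E × ℝ≥0)) → ℝ≥0∞}, Measurable A →
      ∫⁻ z, A z ∂(∑ b : Fin n → Bool, (Measure.pi fun i =>
        (θ.meanO T).withDensity fun y => (θ.splitW (b i) y : ℝ≥0∞)).map (pairConfig b)) =
      ∫⁻ y, ∑ b : Fin n → Bool, (∏ i, (θ.splitW (b i) (y i) : ℝ≥0∞)) * A (pairConfig b y)
        ∂(Measure.pi fun _ : Fin n => θ.meanO T) := by
    intro n A hA
    have hp : ∀ b : Fin n → Bool, Measurable fun y : Fin n → E × ℝ≥0 =>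
        ∏ i, (θ.splitW (b i) (y i) : ℝ≥0∞) := fun b =>
      Finset.measurable_prod _ fun i _ => (hw (b i)).comp (measurable_pi_apply i)
    have hAp : ∀ b : Fin n → Bool, Measurable fun y : Fin n → E × ℝ≥0 => A (pairConfig b y) :=
      fun b => hA.comp (measurable_pairConfig b)
    have hpA : ∀ b : Fin n → Bool, Measurable fun y : Fin n → E × ℝ≥0 =>
        (∏ i, (θ.splitW (b i) (y i) : ℝ≥0∞)) * A (pairConfig b y) := fun b => (hp b).mul (hAp b)
    rw [lintegral_finsetSum_measure, lintegral_finsetSum _ fun b _ => hpA b]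
    refine Finset.sum_congr rfl fun b _ => ?_
    rw [lintegral_map hA (measurable_pairConfig b), pi_withDensity_prod _ fun i => hw (b i),
      lintegral_withDensity_eq_lintegral_mul _ (hp b) (hAp b)]
    rfl
  rw [poissonPair, lintegral_sum_measure, lintegral_sum_measure]
  refine tsum_congr fun n => ?_
  rw [lintegral_smul_measure, lintegral_smul_measure, key n hA, key n hB]
  congr 1
  refine lintegral_congr_ae ?_
  filter_upwards [ae_pi_points hθ T n] with y hy
  exact h n y hy.1 hy.2

variable [MeasurableSingletonClass E]

/-- Conditioning on the unlabelled points turns the expectation over coins and labels into the sum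
evaluated by `sum_splitW_map_stateOf`. -/
theorem lintegral_obs_state (hX : X.IsReference θ ℱ Q) (hθ : θ.Admissible)
    [IsFiniteMeasure (X.initLaw Q)] (T : ℝ≥0)
    {F : Measure (E × ℝ≥0) × State E → ℝ≥0∞} (hF : Measurable F) :
    ∫⁻ ω, F (X.obsUpTo T ω, X.state T ω) ∂Q =
      ∫⁻ ω, ∫⁻ x, F (X.obsUpTo T ω, x) ∂(hθ.obsLaw (X.initLaw Q) (X.obsUpTo T ω)) ∂Q := by
  have hκ := hX.isCoinLaw hθ
  have hprob := hκ.isProbabilityMeasure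
  have hadd : Measurable fun z : Bool → Measure (E × ℝ≥0) => z true + z false :=
    (measurable_pi_apply true).add (measurable_pi_apply false)
  have hG : Measurable fun r : (Bool → Measure (E × ℝ≥0)) × (Bool × (ℕ → Bool)) =>
      F (r.1 true + r.1 false, stateOf r.2 (r.1 true)) :=
    hF.comp ((hadd.comp measurable_fst).prodMk (measurable_stateOf_comp measurable_snd
      ((measurable_pi_apply true).comp measurable_fst)))
  have hA : Measurable fun z : Bool → Measure (E × ℝ≥0) =>
      ∫⁻ q, F (z true + z false, stateOf q (z true)) ∂(Q.map X.coins) := hG.lintegral_prod_right'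
  have hB : Measurable fun z : Bool → Measure (E × ℝ≥0) =>
      ∫⁻ x, F (z true + z false, x) ∂(hθ.obsLaw (X.initLaw Q) (z true + z false)) :=
    (Measurable.lintegral_kernel_prod_right' (κ := hθ.obsLaw (X.initLaw Q)) hF).comp hadd
  have e1 : ∫⁻ ω, F (X.obsUpTo T ω, X.state T ω) ∂Q =
      ∫⁻ z, ∫⁻ q, F (z true + z false, stateOf q (z true)) ∂(Q.map X.coins)
        ∂(Q.map (X.split T)) := by
    have := Measure.isProbabilityMeasure_map (μ := Q) (hX.measurable_split T).aemeasurable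
    rw [← lintegral_prod _ hG.aemeasurable, ← hX.map_split_coins,
      lintegral_map hG ((hX.measurable_split T).prodMk hX.measurable_coins)]
    refine lintegral_congr fun ω => ?_
    simp only [split_add, hX.state_eq]
    rfl
  have e2 : ∫⁻ ω, ∫⁻ x, F (X.obsUpTo T ω, x) ∂(hθ.obsLaw (X.initLaw Q) (X.obsUpTo T ω)) ∂Q =
      ∫⁻ z, ∫⁻ x, F (z true + z false, x) ∂(hθ.obsLaw (X.initLaw Q) (z true + z false))
        ∂(Q.map (X.split T)) := by
    rw [lintegral_map hB (hX.measurable_split T)]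
    simp only [split_add]
  rw [e1, e2, hX.map_split hθ]
  refine lintegral_poissonPair_split hθ T hA hB fun n y hy hpos => ?_
  simp only [pairConfig_add]
  have hFy : Measurable fun x => F (∑ i, Measure.dirac (y i), x) :=
    hF.comp measurable_prodMk_left
  -- One functional depends on the labels only through the observed points, and the label
  -- probabilities sum to one.
  rw [← Finset.sum_mul, Params.sum_prod_splitW hθ, one_mul,
    ← sum_splitW_map_stateOf hθ hκ (X.initLaw Q) rfl hy hpos, lintegral_finsetSum_measure]
  refine Finset.sum_congr rfl fun b _ => ?_
  rw [lintegral_smul_measure, lintegral_map hFy (measurable_stateOf_left _)]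
  rfl

theorem ae_simpleTimes (hX : X.IsReference θ ℱ Q) (hθ : θ.Admissible) (T : ℝ≥0) :
    ∀ᵐ ω ∂Q, SimpleTimes (X.obsUpTo T ω) := by
  classical
  have hadd : Measurable fun z : Bool → Measure (E × ℝ≥0) => z true + z false :=
    (measurable_pi_apply true).add (measurable_pi_apply false)
  have hS : MeasurableSet {z : Bool → Measure (E × ℝ≥0) | ¬ SimpleTimes (z true + z false)} :=
    (hadd measurableSet_simpleTimes).compl
  have e : ∫⁻ ω, {z : Bool → Measure (E × ℝ≥0) | ¬ SimpleTimes (z true + z false)}.indicator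
      1 (X.split T ω) ∂Q = 0 := by
    rw [← lintegral_map (measurable_one.indicator hS) (hX.measurable_split T), hX.map_split hθ,
      lintegral_poissonPair_split hθ T (measurable_one.indicator hS) (measurable_const (a := 0)),
      lintegral_zero]
    intro n y hy hpos
    refine Finset.sum_congr rfl fun b _ => ?_
    rw [indicator_of_notMem]
    rw [mem_ofPred_eq, not_not, pairConfig_add]
    exact simpleTimes_sum_dirac hy hpos
  have hm : Measurable fun ω => {z : Bool → Measure (E × ℝ≥0) |
      ¬ SimpleTimes (z true + z false)}.indicator (1 : (Bool → Measure (E × ℝ≥0)) → ℝ≥0∞) (X.split T ω) :=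
    (measurable_one.indicator hS).comp (hX.measurable_split T)
  rw [lintegral_eq_zero_iff hm] at e
  filter_upwards [e] with ω hω
  by_contra hcon
  rw [← split_add] at hcon
  simp [indicator, hcon] at hω

end IsReference

end Model

/-! ### Locally finite configurations: gaps and jumps -/

section LocCounting

variable {E : Type*} [MeasurableSpace E]

/-- The measure is a finite counting measure up to every time. -/
def LocCounting (c : Measure (E × ℝ≥0)) : Prop := ∀ t, IsCounting (c.restrict (upTo E t))

variable {c : Measure (E × ℝ≥0)}

/-- Finitely many points near `t` leave an interval free of points after `t`. Together with its
left-sided analogue this is what makes induction along the half-line proceed from gap to gap. -/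
theorem exists_gap_right (hc : LocCounting c) (t : ℝ≥0) :
    ∃ u, t < u ∧ c (univ ×ˢ Ioo t u) = 0 := by
  have key : ∃ u, t < u ∧ c.restrict (upTo E (t + 1)) (univ ×ˢ Ioo t u) = 0 := by
    refine (hc (t + 1)).induction (P := fun m => ∃ u, t < u ∧ m (univ ×ˢ Ioo t u) = 0) ?_ ?_
    · exact ⟨t + 1, lt_add_of_pos_right t one_pos, by simp⟩
    · rintro x m - ⟨u, htu, hu⟩
      refine ⟨if t < x.2 then min u x.2 else u, by split_ifs with h <;> simp [h, htu], ?_⟩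
      rw [Measure.add_apply, Measure.dirac_apply' _ (MeasurableSet.univ.prod measurableSet_Ioo)]
      split_ifs with h
      · rw [indicator_of_notMem fun hx => (lt_min_iff.1 (mem_Ioo.1 hx.2).2).2.false, zero_add]
        exact measure_mono_null (prod_mono le_rfl (Ioo_subset_Ioo_right (min_le_left _ _))) hu
      · rw [indicator_of_notMem fun hx => h (mem_Ioo.1 hx.2).1, zero_add, hu]
  obtain ⟨u, htu, hu⟩ := key
  refine ⟨min u (t + 1), lt_min htu (lt_add_of_pos_right t one_pos), ?_⟩
  rw [Measure.restrict_apply (MeasurableSet.univ.prod measurableSet_Ioo)] at hu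
  refine measure_mono_null (fun y hy => ?_) hu
  have h2 := lt_min_iff.1 (mem_Ioo.1 hy.2).2
  exact ⟨⟨mem_univ _, (mem_Ioo.1 hy.2).1, h2.1⟩, mem_univ _, h2.2.le⟩

theorem exists_gap_left (hc : LocCounting c) {t : ℝ≥0} (ht : 0 < t) :
    ∃ r, r < t ∧ c (univ ×ˢ Ioo r t) = 0 := by
  have key : ∃ r, r < t ∧ c.restrict (upTo E t) (univ ×ˢ Ioo r t) = 0 := by
    refine (hc t).induction (P := fun m => ∃ r, r < t ∧ m (univ ×ˢ Ioo r t) = 0) ?_ ?_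
    · exact ⟨0, ht, by simp⟩
    · rintro x m - ⟨r, hrt, hr⟩
      refine ⟨if x.2 < t then max r x.2 else r, by split_ifs with h <;> simp [h, hrt], ?_⟩
      rw [Measure.add_apply, Measure.dirac_apply' _ (MeasurableSet.univ.prod measurableSet_Ioo)]
      split_ifs with h
      · rw [indicator_of_notMem fun hx => (max_lt_iff.1 (mem_Ioo.1 hx.2).1).2.false, zero_add]
        exact measure_mono_null (prod_mono le_rfl (Ioo_subset_Ioo_left (le_max_left _ _))) hr
      · rw [indicator_of_notMem fun hx => h (mem_Ioo.1 hx.2).2, zero_add, hr]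
  obtain ⟨r, hrt, hr⟩ := key
  refine ⟨r, hrt, ?_⟩
  rw [Measure.restrict_apply (MeasurableSet.univ.prod measurableSet_Ioo)] at hr
  refine measure_mono_null (fun y hy => ?_) hr
  exact ⟨hy, mem_univ _, (mem_Ioo.1 hy.2).2.le⟩

theorem restrict_upTo_of_gap {a b t : ℝ≥0} (h : c (univ ×ˢ Ioo a b) = 0) (hat : a ≤ t)
    (htb : t < b) : c.restrict (upTo E t) = c.restrict (upTo E a) := by
  have h0 : c.restrict (slab E a t) = 0 := by
    rw [Measure.restrict_eq_zero]
    have hsub : slab E a t ⊆ univ ×ˢ Ioo a b := fun y hy =>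
      ⟨hy.1, hy.2.1, hy.2.2.trans_lt htb⟩
    exact measure_mono_null hsub h
  rw [upTo_eq_union hat, Measure.restrict_union (disjoint_upTo_slab a t) (measurableSet_slab _ _),
    h0, add_zero]

theorem restrict_before_of_gap {a b t : ℝ≥0} (h : c (univ ×ˢ Ioo a b) = 0) (hat : a < t)
    (htb : t ≤ b) : c.restrict (before E t) = c.restrict (upTo E a) := by
  have h0 : c.restrict (univ ×ˢ Ioo a t) = 0 := by
    rw [Measure.restrict_eq_zero]
    exact measure_mono_null (prod_mono le_rfl (Ioo_subset_Ioo_right htb)) h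
  have hun : before E t = upTo E a ∪ univ ×ˢ Ioo a t := by
    rw [before, upTo, ← prod_union, Iic_union_Ioo_eq_Iio hat]
  rw [hun, Measure.restrict_union _ (MeasurableSet.univ.prod measurableSet_Ioo), h0, add_zero]
  exact Disjoint.set_prod_right (disjoint_left.2 fun s hs hs' => hs'.1.not_ge hs) _ _

theorem upTo_eq_before_union (t : ℝ≥0) : upTo E t = before E t ∪ univ ×ˢ {t} := by
  rw [before, upTo, ← prod_union, Iio_union_right]

theorem disjoint_before_time (t : ℝ≥0) : Disjoint (before E t) (univ ×ˢ {t}) :=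
  Disjoint.set_prod_right (by simp) _ _

theorem restrict_upTo_eq_add (c : Measure (E × ℝ≥0)) (t : ℝ≥0) :
    c.restrict (upTo E t) = c.restrict (before E t) + c.restrict (univ ×ˢ {t}) := by
  rw [upTo_eq_before_union,
    Measure.restrict_union (disjoint_before_time t) (measurableSet_time t)]

theorem LocCounting.restrict (hc : LocCounting c) {S : Set (E × ℝ≥0)} {t : ℝ≥0}
    (hS : MeasurableSet S) (hSt : S ⊆ upTo E t) : IsCounting (c.restrict S) := by
  have h := (hc t).restrict hS
  rwa [Measure.restrict_restrict hS, inter_eq_left.2 hSt] at h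

theorem LocCounting.before (hc : LocCounting c) (t : ℝ≥0) :
    IsCounting (c.restrict (before E t)) :=
  hc.restrict (measurableSet_before t) fun _ hy => ⟨hy.1, (mem_Iio.1 hy.2).le⟩

theorem LocCounting.time (hc : LocCounting c) (t : ℝ≥0) :
    IsCounting (c.restrict (univ ×ˢ {t})) :=
  hc.restrict (measurableSet_time t) fun _ hy => ⟨hy.1, (mem_singleton_iff.1 hy.2).le⟩

theorem LocCounting.restrict_slab (hc : LocCounting c) (a t : ℝ≥0) :
    IsCounting (c.restrict (slab E a t)) :=
  hc.restrict (measurableSet_slab a t) fun _ hy => ⟨hy.1, hy.2.2⟩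

theorem LocCounting.jump_cases [MeasurableSingletonClass E] (hc : LocCounting c) {t : ℝ≥0}
    (h : c (univ ×ˢ {t}) ≤ 1) :
    c.restrict (univ ×ˢ {t}) = 0 ∨ ∃ u, c.restrict (univ ×ˢ {t}) = Measure.dirac (u, t) := by
  obtain ⟨n, hn⟩ := (hc.time t).exists_nat MeasurableSet.univ
  have hle : (n : ℝ≥0∞) ≤ 1 := by
    rw [← hn, Measure.restrict_apply MeasurableSet.univ, univ_inter]; exact h
  have hle' : n ≤ 1 := by exact_mod_cast hle
  interval_cases n
  · left
    rw [← Measure.measure_univ_eq_zero]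
    simpa using hn
  · right
    obtain ⟨⟨u, s⟩, hy⟩ := (hc.time t).eq_dirac_of_singleton (by simpa using hn)
    have hs : s = t := by
      by_contra hne
      have h0 : c.restrict (univ ×ˢ {t}) (univ ×ˢ {t})ᶜ = 0 := by
        rw [Measure.restrict_apply (measurableSet_time t).compl, compl_inter_self, measure_empty]
      rw [hy, Measure.dirac_apply' _ (measurableSet_time t).compl] at h0
      simp [hne] at h0
    exact ⟨u, by rw [hy, hs]⟩

theorem endsBy_stateOf {m : Measure (E × ℝ≥0)} [IsFiniteMeasure m] {t : ℝ≥0}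
    (h : m (univ ×ˢ Ioi t) = 0) (q : Bool × (ℕ → Bool)) : EndsBy t (stateOf q m) := by
  have hms : MeasurableSet ((univ : Set Bool) ×ˢ Ioi t) := MeasurableSet.univ.prod measurableSet_Ioi
  refine ⟨?_, measure_lt_top m _, ?_, h⟩
  · rw [stateOf, finPart_of_finite, Measure.add_apply,
      Measure.map_apply (measurable_markOf _ _) MeasurableSet.univ]
    exact ENNReal.add_lt_top.2 ⟨measure_lt_top _ _, measure_lt_top _ _⟩
  · rw [stateOf, finPart_of_finite, Measure.add_apply, Measure.map_apply (measurable_markOf _ _) hms,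
      Measure.dirac_apply' _ hms]
    simp only [mem_prod, mem_univ, true_and, mem_Ioi, not_lt_zero, not_false_eq_true,
      indicator_of_notMem, zero_add]
    refine measure_mono_null (fun y hy => ?_) h
    exact ⟨mem_univ _, hy.2⟩

theorem endsBy_stateOf_upTo (hc : LocCounting c) (t : ℝ≥0) (q : Bool × (ℕ → Bool)) :
    EndsBy t (stateOf q (c.restrict (upTo E t))) := by
  have := (hc t).isFiniteMeasure
  refine endsBy_stateOf ?_ q
  rw [Measure.restrict_apply (MeasurableSet.univ.prod measurableSet_Ioi)]
  convert measure_empty (μ := c)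
  rw [upTo, prod_inter_prod, Ioi_inter_Iic, Ioc_self, prod_empty]

theorem stateOf_jump (hc : LocCounting c) {t : ℝ≥0} {u : E}
    (h : c.restrict (univ ×ˢ {t}) = Measure.dirac (u, t)) (q : Bool × (ℕ → Bool)) :
    ∃ d, stateOf q (c.restrict (upTo E t)) =
      addPoint d (u, t) (stateOf q (c.restrict (before E t))) := by
  have := (hc.before t).isFiniteMeasure
  obtain ⟨n, hn⟩ := (hc.before t).exists_nat MeasurableSet.univ
  have hlt : ∀ᵐ y ∂c.restrict (ClusterFilter.before E t), y.2 < ((u, t) : E × ℝ≥0).2 := by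
    filter_upwards [ae_restrict_mem (measurableSet_before t)] with y hy using hy.2
  exact ⟨_, by rw [restrict_upTo_eq_add, h, stateOf_add_dirac hn hlt]⟩

end LocCounting

theorem LocCounting.time_of_simpleTimes {E : Type*} [MeasurableSpace E]
    [MeasurableSingletonClass E] {m : Measure (E × ℝ≥0)} (hm : LocCounting m)
    (h : ∀ n : ℕ, SimpleTimes (m.restrict (upTo E n))) :
    m (univ ×ˢ {0}) = 0 ∧ ∀ t, m (univ ×ˢ {t}) ≤ 1 := by
  have hrest : ∀ (n : ℕ) (t : ℝ≥0), t ≤ n →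
      m.restrict (upTo E n) (univ ×ˢ {t}) = m (univ ×ˢ {t}) := by
    intro n t ht
    rw [Measure.restrict_apply (measurableSet_time t), inter_eq_left.2]
    rintro y ⟨-, hy⟩
    exact ⟨mem_univ _, (mem_singleton_iff.1 hy).le.trans ht⟩
  refine ⟨?_, fun t => ?_⟩
  · rw [← hrest 0 0 zero_le]
    exact (h 0).1
  · obtain ⟨n, hn⟩ := exists_nat_ge t
    rw [← hrest n t hn]
    exact (h n).le_one (hm n) t

/-! ### Pathwise solution of the likelihood equation -/

section Likelihood

variable {E : Type*} [MeasurableSpace E] {θ : Params E}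

/-- The functional `weight` describes the likelihood along the state `x` at time `t`. -/
def Params.IsGood (θ : Params E) (t : ℝ≥0) (x : State E) : Prop :=
  θ.jumps x = 0 ∨ θ.surv t x = negExp (cum θ.ν (θ.rateAt x) t)

theorem Params.isGood_addPoint (hθ : θ.Admissible) {x : State E} {y : E × ℝ≥0} {s : ℝ≥0}
    (hx : EndsBy s x) (hs : s < y.2) (d : Bool) (h : θ.IsGood y.2 x) :
    θ.IsGood y.2 (addPoint d y x) := by
  rcases h with h | h
  · left
    have hx2 : ∀ᵐ z ∂x.2, z.2 ≤ y.2 := by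
      refine measure_mono_null (fun z hz => ?_) hx.4
      exact ⟨mem_univ _, hs.trans (not_le.1 hz)⟩
    rw [hθ.jumps_addPoint hx.1 hx.2 hx2, h, zero_mul]
  · right
    rw [surv_addPoint hx.1 hx.2 le_rfl, cum_addPoint hx.1 hx.2 le_rfl, h]

/-- Both sides of the identity are left-continuous, the accumulated intensity even at the value `∞`.
-/
theorem Params.isGood_of_left (hθ : θ.Admissible) {x : State E} {a b : ℝ≥0} (hab : a < b)
    (h : ∀ t ∈ Ico a b, θ.IsGood t x) : θ.IsGood b x := by
  by_cases h0 : θ.jumps x = 0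
  · exact Or.inl h0
  right
  have hb : 0 < b := zero_le.trans_lt hab
  have h1 : Tendsto (fun t => θ.surv t x) (𝓝[<] b) (𝓝 (θ.surv b x)) :=
    (hθ.continuous_surv x).continuousAt.tendsto.mono_left nhdsWithin_le_nhds
  have h2 : Tendsto (fun t => negExp (cum θ.ν (θ.rateAt x) t)) (𝓝[<] b)
      (𝓝 (negExp (cum θ.ν (θ.rateAt x) b))) := by
    have := hθ.sigmaFinite
    exact (continuous_negExp.tendsto _).comp (cum_tendsto_left hb)
  have : (𝓝[<] b).NeBot := nhdsLT_neBot_of_exists_lt ⟨a, hab⟩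
  refine tendsto_nhds_unique (h1.congr' ?_) h2
  filter_upwards [Ioo_mem_nhdsLT hab] with t ht
  exact (h t ⟨ht.1.le, ht.2⟩).resolve_left h0

theorem Params.weight_zero (hθ : θ.Admissible) (d : Bool) :
    θ.weight 0 ((Measure.dirac (d, 0), 0) : State E) = 1 := by
  have := hθ.sigmaFinite
  have h1 : θ.cumQ 0 = 0 := by rw [cumQ, mean₁_upTo, cum_zero, ENNReal.toReal_zero]
  rw [weight, h1, surv, survival_zero, jumps, jumpPos, jumpNeg, finPart_of_finite]
  simp [negExp_zero]

theorem Params.isGood_zero (hθ : θ.Admissible) (x : State E) : θ.IsGood 0 x := by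
  have := hθ.sigmaFinite
  right
  rw [surv, survival_zero, cum_zero, negExp_zero]

/-- One step of the identification of the likelihood: between two cluster events. -/
theorem Params.eq_weight_of_hasDens (hθ : θ.Admissible) {x : State E} {a t : ℝ≥0} {ℓ : ℝ≥0 → ℝ}
    (hat : a ≤ t) (hx : EndsBy a x) (h0 : ℓ a = θ.weight a x) (hg : θ.IsGood a x)
    (hd : HasDens θ.ν ℓ (fun y => -(((θ.rate y x : ℝ) - θ.rateQ y) * ℓ y.2)) a t) :
    ℓ t = θ.weight t x ∧ θ.IsGood t x := by
  have := hθ.sigmaFinite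
  have hgm := hθ.measurable_rateAt x
  set J := θ.jumps x with hJ
  -- Multiplication by `exp(-cumQ)` removes `λ_Q` and leaves `R' = -g R`, to which
  -- `HasDens.eq_mul_negExp` applies without integrability of `g`.
  have hR : HasDens θ.ν (fun s => ℓ s * Real.exp (-1 * θ.cumQ s))
      (fun y => -(θ.rateAt x y * (ℓ y.2 * Real.exp (-1 * θ.cumQ y.2)))) a t := by
    refine (hd.mul ((hθ.hasDens_cumQ a t).const_mul (-1)).exp).congr_dens
      (Eventually.of_forall fun y hy => ?_)
    rw [rateAt, hx.trunc_eq hy.2.1]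
    ring
  have hRa : ℓ a * Real.exp (-1 * θ.cumQ a) = J * negExp (cum θ.ν (θ.rateAt x) a) := by
    have e : ℓ a * Real.exp (-1 * θ.cumQ a) = J * θ.surv a x := by
      rw [h0, weight, ← hJ]
      have : Real.exp (θ.cumQ a) * Real.exp (-1 * θ.cumQ a) = 1 := by
        rw [← Real.exp_add]; simp
      linear_combination J * θ.surv a x * this
    rw [e]
    rcases hg with hg | hg
    · rw [hJ, hg, zero_mul, zero_mul]
    · rw [hg]
  have hRt : ∀ s ∈ Icc a t, ℓ s * Real.exp (-1 * θ.cumQ s) =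
      J * negExp (cum θ.ν (θ.rateAt x) s) := by
    intro s hs
    rw [hR.eq_mul_negExp hgm hs, hRa, cum_add_slab hs.1, negExp_add, mul_assoc]
  have hsurv : HasDens θ.ν (fun s => J * θ.surv s x)
      (fun y => J * -(θ.rateAt x y * negExp (cum θ.ν (θ.rateAt x) y.2))) a t :=
    (((hasDens_survival hgm t).mono zero_le le_rfl).const_mul J)
  -- By `hRt` the left side has the density of `J * surv`, and the two agree at `a`. Comparison with
  -- `hRt` at `t` then shows that goodness persists, unless `J = 0`.
  have heq : ℓ t * Real.exp (-1 * θ.cumQ t) = J * θ.surv t x := by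
    refine (hR.2 t ⟨hat, le_rfl⟩).trans (Eq.trans ?_ (hsurv.2 t ⟨hat, le_rfl⟩).symm)
    congr 1
    · refine hRa.trans ?_
      show _ = J * θ.surv a x
      rcases hg with hg | hg
      · rw [hJ, hg, zero_mul, zero_mul]
      · rw [hg]
    · refine setIntegral_congr_fun (measurableSet_slab _ _) fun y hy => ?_
      have := hRt y.2 ⟨hy.2.1.le, hy.2.2⟩
      linear_combination -(θ.rateAt x y : ℝ) * this
  refine ⟨?_, ?_⟩
  · have : Real.exp (θ.cumQ t) * Real.exp (-1 * θ.cumQ t) = 1 := by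
      rw [← Real.exp_add]; simp
    rw [weight, ← hJ]
    linear_combination Real.exp (θ.cumQ t) * heq - ℓ t * this
  · by_cases hJ0 : J = 0
    · exact Or.inl hJ0
    · right
      have := heq.symm.trans (hRt t ⟨hat, le_rfl⟩)
      exact mul_left_cancel₀ hJ0 this

variable {c : Measure (E × ℝ≥0)} {q : Bool × (ℕ → Bool)} {ℓ : ℝ≥0 → ℝ}

theorem slab_null_of_gap {a b t : ℝ≥0} (h : c (univ ×ˢ Ioo a b) = 0) (ht : t < b) :
    c (slab E a t) = 0 := by
  have hsub : slab E a t ⊆ univ ×ˢ Ioo a b := fun y hy => ⟨hy.1, hy.2.1, lt_of_le_of_lt hy.2.2 ht⟩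
  exact measure_mono_null hsub h

theorem gap_of_slab_null {a b t : ℝ≥0} (h : c (slab E a b) = 0) (ht : t ≤ b) :
    c (univ ×ˢ Ioo a t) = 0 := by
  have hsub : (univ : Set E) ×ˢ Ioo a t ⊆ slab E a b := fun y hy => ⟨hy.1, hy.2.1, hy.2.2.le.trans ht⟩
  exact measure_mono_null hsub h

theorem restrict_slab_of_gap {a b : ℝ≥0} (hab : a < b) (hgap : c (univ ×ˢ Ioo a b) = 0) :
    c.restrict (slab E a b) = c.restrict (univ ×ˢ {b}) := by
  have hu : slab E a b = univ ×ˢ Ioo a b ∪ univ ×ˢ {b} := by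
    rw [slab, ← prod_union, Ioo_union_right hab]
  rw [hu, Measure.restrict_union _ (measurableSet_time b), Measure.restrict_eq_zero.2 hgap,
    zero_add]
  exact Disjoint.set_prod_right (by simp) _ _

/-- The integrand of the likelihood equation. -/
def likIntegrand (θ : Params E) (c : Measure (E × ℝ≥0)) (q : Bool × (ℕ → Bool)) (ℓ : ℝ≥0 → ℝ)
    (y : E × ℝ≥0) : ℝ :=
  ((θ.rate y (stateOf q (c.restrict (before E y.2))) : ℝ) / θ.rateQ y - 1) *
    Function.leftLim ℓ y.2

/-- The likelihood equation on a path. -/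
def SolvesLik (θ : Params E) (c : Measure (E × ℝ≥0)) (q : Bool × (ℕ → Bool)) (ℓ : ℝ≥0 → ℝ) : Prop :=
  ∀ t, IntegrableOn (likIntegrand θ c q ℓ) (upTo E t) θ.mean₁ ∧
    ℓ t = 1 + ((∫ y in upTo E t, likIntegrand θ c q ℓ y ∂c) -
      ∫ y in upTo E t, likIntegrand θ c q ℓ y ∂θ.mean₁)

namespace SolvesLik

theorem integrableOn_slab (hθ : θ.Admissible) (h : SolvesLik θ c q ℓ) (a t : ℝ≥0) :
    IntegrableOn (fun y => (θ.rateQ y : ℝ) * likIntegrand θ c q ℓ y) (slab E a t)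
      (θ.ν.prod lebesgue) := by
  have h1 : IntegrableOn (likIntegrand θ c q ℓ) (slab E a t) θ.mean₁ :=
    (h t).1.mono_set fun y hy => ⟨hy.1, hy.2.2⟩
  rw [IntegrableOn, Params.mean₁, restrict_withDensity (measurableSet_slab _ _),
    integrable_withDensity_iff_integrable_smul hθ.measurable_rateQ] at h1
  exact h1

theorem sub_eq [MeasurableSingletonClass E] (hθ : θ.Admissible) (hc : LocCounting c)
    (h : SolvesLik θ c q ℓ) {a t : ℝ≥0} (hat : a ≤ t) :
    ℓ t = ℓ a + (∫ y in slab E a t, likIntegrand θ c q ℓ y ∂c) -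
      ∫ y in slab E a t, (θ.rateQ y : ℝ) * likIntegrand θ c q ℓ y ∂(θ.ν.prod lebesgue) := by
  have e1 : ∫ y in slab E a t, likIntegrand θ c q ℓ y ∂θ.mean₁ =
      ∫ y in slab E a t, (θ.rateQ y : ℝ) * likIntegrand θ c q ℓ y ∂(θ.ν.prod lebesgue) := by
    rw [Params.mean₁, restrict_withDensity (measurableSet_slab _ _),
      integral_withDensity_eq_integral_smul hθ.measurable_rateQ]
    rfl
  have hu : upTo E t = upTo E a ∪ slab E a t := upTo_eq_union hat
  rw [(h t).2, (h a).2, hu, setIntegral_union (disjoint_upTo_slab a t) (measurableSet_slab _ _)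
    ((hc a).integrable _) ((hc.restrict_slab a t).integrable _),
    setIntegral_union (disjoint_upTo_slab a t) (measurableSet_slab _ _) (h a).1
    ((h t).1.mono_set fun y hy => ⟨hy.1, hy.2.2⟩), e1]
  ring

variable [MeasurableSingletonClass E]

/-- Without cluster events only the compensator acts. The solution is then continuous, so its left
limits are its values, and the factor `λ_Q` cancels the quotient. -/
theorem hasDens (hθ : θ.Admissible) (hc : LocCounting c) (h : SolvesLik θ c q ℓ) {a t : ℝ≥0}
    (hgap : c (slab E a t) = 0) :
    HasDens θ.ν ℓ (fun y => -(((θ.rate y (stateOf q (c.restrict (upTo E a))) : ℝ) - θ.rateQ y) *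
      ℓ y.2)) a t := by
  have := hθ.sigmaFinite
  have h1 : HasDens θ.ν ℓ (fun y => -((θ.rateQ y : ℝ) * likIntegrand θ c q ℓ y)) a t := by
    refine ⟨(h.integrableOn_slab hθ a t).neg, fun s hs => ?_⟩
    have h0 : c.restrict (slab E a s) = 0 := by
      rw [Measure.restrict_eq_zero]
      exact measure_mono_null (slab_mono le_rfl hs.2) hgap
    rw [h.sub_eq hθ hc hs.1, h0, integral_zero_measure, integral_neg]
    ring
  refine h1.congr_dens (Eventually.of_forall fun y hy => ?_)
  have hlt := hy.2.1
  have hle := hy.2.2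
  have hgap' : c (univ ×ˢ Ioo a y.2) = 0 := gap_of_slab_null hgap hle
  have hcont : ContinuousWithinAt ℓ (Iic y.2) y.2 :=
    ((h1.continuousOn.mono (Icc_subset_Icc_right hle)) y.2
      ⟨hlt.le, le_rfl⟩).mono_of_mem_nhdsWithin (Icc_mem_nhdsLE hlt)
  have hQ : (θ.rateQ y : ℝ) ≠ 0 := (NNReal.coe_pos.2 (hθ.rateQ_pos y)).ne'
  rw [likIntegrand, restrict_before_of_gap hgap' hlt le_rfl, hcont.leftLim_eq]
  field_simp

theorem eq_weight_right (hθ : θ.Admissible) (hc : LocCounting c) (h : SolvesLik θ c q ℓ)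
    {a b : ℝ≥0} (hgap : c (univ ×ˢ Ioo a b) = 0)
    (ha : ℓ a = θ.weight a (stateOf q (c.restrict (upTo E a))) ∧
      θ.IsGood a (stateOf q (c.restrict (upTo E a)))) {t : ℝ≥0} (hat : a ≤ t) (htb : t < b) :
    ℓ t = θ.weight t (stateOf q (c.restrict (upTo E a))) ∧
      θ.IsGood t (stateOf q (c.restrict (upTo E a))) := by
  refine Params.eq_weight_of_hasDens hθ hat (endsBy_stateOf_upTo hc a q) ha.1 ha.2
    (h.hasDens hθ hc (slab_null_of_gap hgap htb))

/-- The solution of the likelihood equation is given by `weight`. -/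
theorem eq_weight (hθ : θ.Admissible) (hc : LocCounting c) (h0 : c (univ ×ˢ {0}) = 0)
    (h1 : ∀ t, c (univ ×ˢ {t}) ≤ 1) (h : SolvesLik θ c q ℓ) (t : ℝ≥0) :
    ℓ t = θ.weight t (stateOf q (c.restrict (upTo E t))) ∧
      θ.IsGood t (stateOf q (c.restrict (upTo E t))) := by
  have := hθ.sigmaFinite
  refine nnreal_induction (P := fun t => ℓ t = θ.weight t (stateOf q (c.restrict (upTo E t))) ∧
    θ.IsGood t (stateOf q (c.restrict (upTo E t)))) ?_ ?_ ?_ t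
  · have hu : upTo E 0 = univ ×ˢ {0} := by rw [upTo]; congr 1; ext s; simp
    have hc0 : c.restrict (upTo E 0) = 0 := by rw [Measure.restrict_eq_zero, hu, h0]
    have hm0 : θ.mean₁.restrict (upTo E 0) = 0 := by
      rw [Measure.restrict_eq_zero, Params.mean₁_upTo, cum_zero]
    refine ⟨?_, Params.isGood_zero hθ _⟩
    rw [(h 0).2, hc0, hm0, Chain.stateOf_zero, Params.weight_zero hθ]
    simp
  · intro b hb ih
    obtain ⟨a, hab, hgap⟩ := exists_gap_left hc hb
    set x := stateOf q (c.restrict (upTo E a)) with hx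
    have hseg : ∀ t ∈ Ico a b, ℓ t = θ.weight t x ∧ θ.IsGood t x := fun t ht =>
      h.eq_weight_right hθ hc hgap (ih a hab) ht.1 ht.2
    have hgood : θ.IsGood b x := Params.isGood_of_left hθ hab fun t ht => (hseg t ht).2
    have hne : (𝓝[<] b).NeBot := nhdsLT_neBot_of_exists_lt ⟨a, hab⟩
    have hlim : Tendsto ℓ (𝓝[<] b) (𝓝 (θ.weight b x)) := by
      refine ((hθ.continuous_weight x).continuousAt.tendsto.mono_left
        nhdsWithin_le_nhds).congr' ?_
      filter_upwards [Ioo_mem_nhdsLT hab] with t ht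
      exact (hseg t ⟨ht.1.le, ht.2⟩).1.symm
    have hll : Function.leftLim ℓ b = θ.weight b x := leftLim_eq_of_tendsto hlim
    have hbef : c.restrict (before E b) = c.restrict (upTo E a) :=
      restrict_before_of_gap hgap hab le_rfl
    -- The compensator is continuous in time, so the jump at `b` is the integral of `C` over that
    -- single time.
    have hjump : ℓ b = θ.weight b x + ∫ y in univ ×ˢ {b}, likIntegrand θ c q ℓ y ∂c := by
      have hM : ContinuousOn (fun t => ∫ y in slab E a t,
          (θ.rateQ y : ℝ) * likIntegrand θ c q ℓ y ∂(θ.ν.prod lebesgue)) (Icc a b) :=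
        (hasDens_integral (h.integrableOn_slab hθ a b)).continuousOn
      have hl2 : Tendsto ℓ (𝓝[<] b) (𝓝 (ℓ a - ∫ y in slab E a b,
          (θ.rateQ y : ℝ) * likIntegrand θ c q ℓ y ∂(θ.ν.prod lebesgue))) := by
        have hmem : Icc a b ∈ 𝓝[<] b :=
          mem_of_superset (Ioo_mem_nhdsLT hab) fun s hs => ⟨hs.1.le, hs.2.le⟩
        have hMb := ((hM b ⟨hab.le, le_rfl⟩).mono_of_mem_nhdsWithin hmem).tendsto
        refine (hMb.const_sub (ℓ a)).congr' ?_
        filter_upwards [Ioo_mem_nhdsLT hab] with t ht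
        have h0 : c.restrict (slab E a t) = 0 :=
          Measure.restrict_eq_zero.2 (slab_null_of_gap hgap ht.2)
        rw [h.sub_eq hθ hc ht.1.le, h0, integral_zero_measure]
        ring
      rw [h.sub_eq hθ hc hab.le, restrict_slab_of_gap hab hgap, tendsto_nhds_unique hlim hl2]
      ring
    rcases hc.jump_cases (h1 b) with hz | ⟨u, hu⟩
    · have hS : c.restrict (upTo E b) = c.restrict (upTo E a) := by
        rw [restrict_upTo_eq_add, hz, add_zero, hbef]
      rw [hS]
      refine ⟨?_, hgood⟩
      rw [hjump, hz, integral_zero_measure, add_zero]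
    · obtain ⟨d, hd⟩ := stateOf_jump hc hu q
      rw [hbef] at hd
      rw [hd]
      refine ⟨?_, Params.isGood_addPoint hθ (endsBy_stateOf_upTo hc a q) hab d hgood⟩
      -- The jump is `(λ/λ_Q - 1) L(b-)`: the left limit gets multiplied by the ratio, exactly as
      -- `weight` does.
      rw [hjump, hu, integral_dirac]
      have hw := hθ.weight_addPoint (y := (u, b)) (endsBy_stateOf_upTo hc a q) hab d
      simp only at hw
      rw [hw, likIntegrand, hll, hbef]
      ring
  · intro a ha
    obtain ⟨b, hab, hgap⟩ := exists_gap_right hc a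
    filter_upwards [Ioo_mem_nhdsGT hab] with t ht
    rw [restrict_upTo_of_gap hgap ht.1.le ht.2]
    exact h.eq_weight_right hθ hc hgap ha ht.1.le ht.2

end SolvesLik

end Likelihood

namespace Model

variable {E Ω : Type*} [MeasurableSpace E] [MeasurableSingletonClass E] {mΩ : MeasurableSpace Ω}
  {X : Model E Ω} {θ : Params E} {ℱ : Filtration ℝ≥0 mΩ} {Q : Measure Ω} [IsProbabilityMeasure Q]

namespace IsReference

theorem locCounting_C (hX : X.IsReference θ ℱ Q) (ω : Ω) : LocCounting (X.C ω) :=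
  fun T => hX.isCounting_C T ω

theorem locCounting_O (hX : X.IsReference θ ℱ Q) (ω : Ω) : LocCounting (X.O ω) :=
  fun T => hX.isCounting_obsUpTo T ω

theorem ae_time_O (hX : X.IsReference θ ℱ Q) (hθ : θ.Admissible) :
    ∀ᵐ ω ∂Q, X.O ω (univ ×ˢ {0}) = 0 ∧ ∀ t, X.O ω (univ ×ˢ {t}) ≤ 1 := by
  filter_upwards [ae_all_iff.2 fun n : ℕ => hX.ae_simpleTimes hθ (n : ℝ≥0)] with ω hω
  exact (hX.locCounting_O ω).time_of_simpleTimes hω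

theorem stateLeft_eq (hX : X.IsReference θ ℱ Q) (T : ℝ≥0) (ω : Ω) :
    X.stateLeft T ω = stateOf (X.coins ω) ((X.C ω).restrict (before E T)) := by
  have := ((hX.locCounting_C ω).before T).isFiniteMeasure
  rw [stateLeft, stateOf, finPart_of_finite, Prod.mk.injEq]
  refine ⟨?_, rfl⟩
  congr 1
  refine Measure.map_congr ?_
  filter_upwards [ae_restrict_mem (measurableSet_before T)] with y hy
  have hsub : upTo E y.2 ⊆ before E T := fun z hz => ⟨hz.1, mem_Iio.2 (lt_of_le_of_lt (mem_Iic.1 hz.2) (mem_Iio.1 hy.2))⟩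
  rw [markOf, finPart_of_finite, D, count, Measure.restrict_apply (measurableSet_upTo _),
    inter_eq_left.2 hsub]
  rfl

/-- The likelihood is a functional of the state, so conditioning it requires the conditional law of
the state and nothing else. -/
theorem ae_likelihood_eq (hX : X.IsReference θ ℱ Q) (hθ : θ.Admissible) {L : ℝ≥0 → Ω → ℝ}
    (hL : X.IsLikelihood θ ℱ Q L) :
    ∀ᵐ ω ∂Q, ∀ t, L t ω = θ.weight t (X.state t ω) ∧ θ.IsGood t (X.state t ω) := by
  filter_upwards [hX.ae_time_O hθ, hL.solves] with ω hω hsol t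
  have hle : ∀ S, X.C ω S ≤ X.O ω S := fun S => by
    rw [O, Measure.add_apply]; exact le_add_self
  rw [hX.state_eq]
  refine SolvesLik.eq_weight (ℓ := fun t => L t ω) hθ (hX.locCounting_C ω)
    (le_antisymm ((hle _).trans hω.1.le) zero_le) (fun t => (hle _).trans (hω.2 t)) ?_ t
  intro t
  have h := hsol t
  simp only [hX.stateLeft_eq] at h
  exact h

end IsReference

end Model

/-- A function that locally, on both sides, agrees with continuous functions is càdlàg. -/
theorem isCadlag_of_local {F : ℝ≥0 → ℝ}
    (hr : ∀ t, ∃ u, t < u ∧ ∃ G : ℝ≥0 → ℝ, Continuous G ∧ ∀ s ∈ Ico t u, F s = G s)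
    (hl : ∀ t, 0 < t → ∃ r, r < t ∧ ∃ G : ℝ≥0 → ℝ, Continuous G ∧ ∀ s ∈ Ioo r t, F s = G s) :
    IsCadlag F := by
  intro t
  constructor
  · obtain ⟨u, htu, G, hG, h⟩ := hr t
    have hc : ContinuousWithinAt G (Ici t) t := hG.continuousAt.continuousWithinAt
    refine hc.congr_of_eventuallyEq ?_ (h t ⟨le_rfl, htu⟩)
    filter_upwards [Ico_mem_nhdsGE htu] with s hs using h s hs
  · rcases eq_or_lt_of_le (zero_le (a := t)) with h0 | h0
    · refine ⟨0, ?_⟩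
      have : Iio t = ∅ := by rw [← h0]; ext s; simp
      rw [this, nhdsWithin_empty]
      exact tendsto_bot
    · obtain ⟨r, hrt, G, hG, h⟩ := hl t h0
      refine ⟨G t, (hG.continuousAt.tendsto.mono_left nhdsWithin_le_nhds).congr' ?_⟩
      filter_upwards [Ioo_mem_nhdsLT hrt] with s hs using (h s hs).symm

/-! ### The explicit filter and its existence -/

section WeightedLaw

variable {E : Type*} [MeasurableSpace E] {θ : Params E}

/-- The unnormalized conditional law of the state at time `t`, given the observed points. -/
def Params.Admissible.weightedLaw (hθ : θ.Admissible) (ρ : Measure (State E)) [IsFiniteMeasure ρ]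
    (t : ℝ≥0) : Kernel (Measure (E × ℝ≥0)) (State E) :=
  Kernel.withDensity (hθ.obsLaw ρ) fun _ x => ENNReal.ofReal (θ.weight t x)

variable (hθ : θ.Admissible) {ρ : Measure (State E)} [IsFiniteMeasure ρ]

theorem weightedLaw_apply (t : ℝ≥0) (m : Measure (E × ℝ≥0)) :
    hθ.weightedLaw ρ t m =
      (hθ.obsLaw ρ m).withDensity fun x => ENNReal.ofReal (θ.weight t x) := by
  rw [Params.Admissible.weightedLaw, Kernel.withDensity_apply]
  exact ((hθ.measurable_weight t).comp measurable_snd).ennreal_ofReal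

theorem integral_weightedLaw (t : ℝ≥0) (m : Measure (E × ℝ≥0)) (f : State E → ℝ) :
    ∫ x, f x ∂(hθ.weightedLaw ρ t m) = ∫ x, f x * θ.weight t x ∂(hθ.obsLaw ρ m) := by
  rw [weightedLaw_apply]
  have h := integral_withDensity_eq_integral_smul (μ := hθ.obsLaw ρ m)
    (hθ.measurable_weight t).real_toNNReal f
  refine Eq.trans h (integral_congr_ae (Eventually.of_forall fun x => ?_))
  simp only [NNReal.smul_def, smul_eq_mul]
  rw [Real.coe_toNNReal _ (hθ.weight_nonneg t x), mul_comm]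

theorem isFiniteMeasure_weightedLaw (hρ : IsAtomic ρ) (t : ℝ≥0) {m : Measure (E × ℝ≥0)}
    (hm : IsCounting m) : IsFiniteMeasure (hθ.weightedLaw ρ t m) := by
  rw [weightedLaw_apply]
  exact isFiniteMeasure_withDensity_ofReal
    ((isAtomic_obsLaw hθ hρ hm).integrable (hθ.measurable_weight t)).2

theorem integrable_weightedLaw (hρ : IsAtomic ρ) (t : ℝ≥0) {m : Measure (E × ℝ≥0)}
    (hm : IsCounting m) {f : State E → ℝ} (hf : Measurable f) :
    Integrable f (hθ.weightedLaw ρ t m) := by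
  rw [weightedLaw_apply]
  have h := integrable_withDensity_iff_integrable_smul (μ := hθ.obsLaw ρ m)
    (hθ.measurable_weight t).real_toNNReal (g := f)
  refine h.2 ?_
  simp only [NNReal.smul_def, smul_eq_mul]
  exact (isAtomic_obsLaw hθ hρ hm).integrable
    ((hθ.measurable_weight t).real_toNNReal.coe_nnreal_real.mul hf)

theorem continuous_integral_mul_weight (hθ : θ.Admissible) {κ : Measure (State E)} (hκ : IsAtomic κ)
    {f : State E → ℝ} (hf : Measurable f) :
    Continuous fun t => ∫ x, f x * θ.weight t x ∂κ := by
  obtain ⟨s, w, -, rfl⟩ := hκ.exists_sum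
  have h : (fun t => ∫ x, f x * θ.weight t x ∂(∑ x ∈ s, (w x : ℝ≥0∞) • Measure.dirac x)) =
      fun t => ∑ x ∈ s, (w x : ℝ) * (f x * θ.weight t x) :=
    funext fun t => integral_sum_dirac (hf.mul (hθ.measurable_weight t))
  rw [h]
  exact continuous_finsetSum _ fun x _ =>
    continuous_const.mul (continuous_const.mul (hθ.continuous_weight x))

/-- Within a gap the observed configuration is constant, so the integral is a finite sum of
continuous weights. -/
theorem isCadlag_weightedLaw (hρ : IsAtomic ρ) {m : Measure (E × ℝ≥0)} (hm : LocCounting m)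
    {f : State E → ℝ} (hf : Measurable f) :
    IsCadlag fun t => ∫ x, f x ∂(hθ.weightedLaw ρ t (m.restrict (upTo E t))) := by
  simp only [integral_weightedLaw]
  refine isCadlag_of_local (fun t => ?_) (fun t ht => ?_)
  · obtain ⟨u, htu, h⟩ := exists_gap_right hm t
    refine ⟨u, htu, _, continuous_integral_mul_weight hθ (isAtomic_obsLaw hθ hρ (hm t)) hf,
      fun s hs => ?_⟩
    rw [restrict_upTo_of_gap h hs.1 hs.2]
  · obtain ⟨r, hrt, h⟩ := exists_gap_left hm ht
    refine ⟨r, hrt, _, continuous_integral_mul_weight hθ (isAtomic_obsLaw hθ hρ (hm r)) hf,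
      fun s hs => ?_⟩
    rw [restrict_upTo_of_gap h hs.1.le hs.2]

end WeightedLaw

namespace Model

variable {E Ω : Type*} [MeasurableSpace E] [MeasurableSingletonClass E] {mΩ : MeasurableSpace Ω}
  {X : Model E Ω} {θ : Params E} {ℱ : Filtration ℝ≥0 mΩ} {Q : Measure Ω} [IsProbabilityMeasure Q]

namespace IsReference

theorem isAtomic_initLaw (hX : X.IsReference θ ℱ Q) : IsAtomic (X.initLaw Q) := by
  have e : X.initLaw Q =
      (Q.map X.D₀).map fun d => ((Measure.dirac (d, 0), 0) : State E) := by
    rw [initLaw, Measure.map_map (measurable_stateOf_left 0) hX.measurable_coins,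
      Measure.map_map .of_discrete hX.measurable_D₀]
    congr 1
    funext ω
    exact Chain.stateOf_zero _
  have hat : ∀ κ : Measure Bool, IsFiniteMeasure κ → IsAtomic κ := by
    intro κ _
    have h : κ = ∑ b : Bool, ((κ {b}).toNNReal : ℝ≥0∞) • Measure.dirac b := by
      refine Measure.ext_of_singleton fun b => ?_
      rw [Fintype.sum_bool]
      cases b <;> simp [ENNReal.coe_toNNReal (measure_ne_top κ _)]
    rw [h, Fintype.sum_bool]
    exact ((IsAtomic.dirac _).smul _).add ((IsAtomic.dirac _).smul _)
  rw [e]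
  exact (hat _ inferInstance).map .of_discrete

theorem map_obs_state (hX : X.IsReference θ ℱ Q) (hθ : θ.Admissible)
    [IsFiniteMeasure (X.initLaw Q)] (T : ℝ≥0) :
    Q.map (fun ω => (X.obsUpTo T ω, X.state T ω)) =
      (Q.map (X.obsUpTo T)) ⊗ₘ (hθ.obsLaw (X.initLaw Q)) := by
  have ho := hX.measurable_obsUpTo T
  ext B hB
  rw [Measure.map_apply (ho.prodMk (hX.measurable_state T)) hB, Measure.compProd_apply hB,
    lintegral_map (Kernel.measurable_kernel_prodMk_left hB) ho]
  have h := hX.lintegral_obs_state hθ T (F := B.indicator 1) (measurable_one.indicator hB)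
  have e1 : ∫⁻ ω, B.indicator 1 (X.obsUpTo T ω, X.state T ω) ∂Q =
      Q ((fun ω => (X.obsUpTo T ω, X.state T ω)) ⁻¹' B) := by
    rw [← lintegral_indicator_one ((ho.prodMk (hX.measurable_state T)) hB)]
    rfl
  rw [← e1, h]
  refine lintegral_congr fun ω => ?_
  rw [← lintegral_indicator_one (measurable_prodMk_left hB)]
  rfl

theorem obs_le (hX : X.IsReference θ ℱ Q) (T : ℝ≥0) : X.obs T ≤ mΩ :=
  (hX.measurable_obsUpTo T).comap_le

/-- The conditional law of the state given the observed points. -/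
theorem condExp_state (hX : X.IsReference θ ℱ Q) (hθ : θ.Admissible)
    [IsFiniteMeasure (X.initLaw Q)] (T : ℝ≥0) {H : State E → ℝ} (hH : Measurable H)
    (hint : Integrable (fun ω => H (X.state T ω)) Q) :
    (fun ω => ∫ x, H x ∂(hθ.obsLaw (X.initLaw Q) (X.obsUpTo T ω))) =ᵐ[Q]
      Q[fun ω => H (X.state T ω) | X.obs T] := by
  have ho := hX.measurable_obsUpTo T
  have hs := hX.measurable_state T
  have hmap := hX.map_obs_state hθ T
  have hHm : Measurable fun p : Measure (E × ℝ≥0) × State E => H p.2 := hH.comp measurable_snd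
  have hintC : Integrable (fun p : Measure (E × ℝ≥0) × State E => H p.2)
      ((Q.map (X.obsUpTo T)) ⊗ₘ (hθ.obsLaw (X.initLaw Q))) := by
    rw [← hmap]
    exact (integrable_map_measure hHm.aestronglyMeasurable (ho.prodMk hs).aemeasurable).2 hint
  have hK : StronglyMeasurable fun m : Measure (E × ℝ≥0) =>
      ∫ x, H x ∂(hθ.obsLaw (X.initLaw Q) m) :=
    StronglyMeasurable.integral_kernel_prod_right' (κ := hθ.obsLaw (X.initLaw Q))
      (f := fun p : Measure (E × ℝ≥0) × State E => H p.2) hHm.stronglyMeasurable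
  have hKint : Integrable (fun m : Measure (E × ℝ≥0) => ∫ x, H x ∂(hθ.obsLaw (X.initLaw Q) m))
      (Q.map (X.obsUpTo T)) := 
    (((Measure.integrable_compProd_iff hHm.aestronglyMeasurable).1 hintC).2).mono'
      hK.aestronglyMeasurable (Eventually.of_forall fun _ => norm_integral_le_integral_norm _)
  have hgint : Integrable (fun ω => ∫ x, H x ∂(hθ.obsLaw (X.initLaw Q) (X.obsUpTo T ω))) Q :=
    (integrable_map_measure hK.aestronglyMeasurable ho.aemeasurable).1 hKint
  refine ae_eq_condExp_of_forall_setIntegral_eq (hX.obs_le T) hint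
    (fun _ _ _ => hgint.integrableOn) ?_ ?_
  · rintro _ ⟨B, hB, rfl⟩ -
    have e1 : ∫ ω in X.obsUpTo T ⁻¹' B, ∫ x, H x ∂(hθ.obsLaw (X.initLaw Q) (X.obsUpTo T ω)) ∂Q =
        ∫ m in B, ∫ x, H x ∂(hθ.obsLaw (X.initLaw Q) m) ∂(Q.map (X.obsUpTo T)) :=
      (setIntegral_map hB hK.aestronglyMeasurable ho.aemeasurable).symm
    have e2 := Measure.setIntegral_compProd (μ := Q.map (X.obsUpTo T))
      (κ := hθ.obsLaw (X.initLaw Q)) hB MeasurableSet.univ hintC.integrableOn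
    simp only [Measure.restrict_univ] at e2
    have e3 : ∫ p in B ×ˢ univ, H p.2 ∂(Q.map fun ω => (X.obsUpTo T ω, X.state T ω)) =
        ∫ ω in X.obsUpTo T ⁻¹' B, H (X.state T ω) ∂Q := by
      rw [setIntegral_map (hB.prod MeasurableSet.univ) hHm.aestronglyMeasurable
        (ho.prodMk hs).aemeasurable]
      congr 2
      ext ω
      simp
    exact e1.trans (e2.symm.trans (by rw [← hmap]; exact e3))
  · exact (hK.comp_measurable (comap_measurable (X.obsUpTo T))).aestronglyMeasurable

/-- The explicit unnormalized filter. -/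
def filter (X : Model E Ω) (Q : Measure Ω) (hθ : θ.Admissible) [IsFiniteMeasure (X.initLaw Q)]
    (t : ℝ≥0) (ω : Ω) : Measure (State E) :=
  hθ.weightedLaw (X.initLaw Q) t (X.obsUpTo t ω)

/-- Almost surely `f L` equals `f` times the weight, evaluated at the state; its conditional
expectation is the integral against `obsLaw`, that is, of `f` against the weighted law. -/
theorem isUnnormalizedFilter (hX : X.IsReference θ ℱ Q) (hθ : θ.Admissible)
    [IsFiniteMeasure (X.initLaw Q)] {L : ℝ≥0 → Ω → ℝ} (hL : X.IsLikelihood θ ℱ Q L) :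
    X.IsUnnormalizedFilter Q L (filter X Q hθ) where
  adapted t := (hθ.weightedLaw (X.initLaw Q) t).measurable.comp (comap_measurable (X.obsUpTo t))
  finite t ω := isFiniteMeasure_weightedLaw hθ hX.isAtomic_initLaw t (hX.isCounting_obsUpTo t ω)
  cadlag ω A hA := by
    have h := isCadlag_weightedLaw hθ hX.isAtomic_initLaw (hX.locCounting_O ω)
      (f := A.indicator 1) (measurable_one.indicator hA)
    simp only [integral_indicator_one hA] at h
    exact h
  condExp t f hf hint := by
    have hae : (fun ω => f (X.state t ω) * L t ω) =ᵐ[Q]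
        fun ω => f (X.state t ω) * θ.weight t (X.state t ω) := by
      filter_upwards [hX.ae_likelihood_eq hθ hL] with ω hω
      rw [(hω t).1]
    have h := hX.condExp_state hθ t (H := fun x => f x * θ.weight t x)
      (hf.mul (hθ.measurable_weight t)) (hint.congr hae)
    refine EventuallyEq.trans (Eventually.of_forall fun ω => ?_) (h.trans (condExp_congr_ae hae).symm)
    exact integral_weightedLaw hθ t _ f

end IsReference

end Model

/-! ### Countably many values determine a measure on the states -/

theorem exists_countable_isPiSystem (α : Type*) [mα : MeasurableSpace α]
    [MeasurableSpace.CountablyGenerated α] :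
    ∃ S : Set (Set α), S.Countable ∧ IsPiSystem S ∧ MeasurableSpace.generateFrom S = mα ∧
      univ ∈ S := by
  have hA := isSetAlgebra_generateSetAlgebra (𝒜 := MeasurableSpace.countableGeneratingSet α)
  refine ⟨generateSetAlgebra (MeasurableSpace.countableGeneratingSet α),
    countable_generateSetAlgebra MeasurableSpace.countable_countableGeneratingSet,
    fun s hs t ht _ => hA.inter_mem hs ht, ?_, hA.univ_mem⟩
  rw [generateFrom_generateSetAlgebra_eq, MeasurableSpace.generateFrom_countableGeneratingSet]

section Determination

variable {α β : Type*} [MeasurableSpace α] [MeasurableSpace β]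

/-- Replace infinite measures by zero. -/
def finPair (x : Measure α × Measure β) : Measure α × Measure β :=
  (finPart _ x.1, finPart _ x.2)

theorem measurable_finPair : Measurable (finPair : Measure α × Measure β → _) :=
  ((finPart α).measurable.comp measurable_fst).prodMk ((finPart β).measurable.comp measurable_snd)

theorem finPair_of_lt {x : Measure α × Measure β} (h1 : x.1 univ < ∞) (h2 : x.2 univ < ∞) :
    finPair x = x := by
  rw [finPair, finPart_of_lt h1, finPart_of_lt h2]

theorem isFiniteMeasure_finPart (m : Measure α) : IsFiniteMeasure (finPart α m) := by
  by_cases h : m univ < ∞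
  · rw [finPart_of_lt h]; exact ⟨h⟩
  · rw [finPart_of_not_lt h]; infer_instance

variable (α β) in
/-- A finite measure on the pairs of finite measures is determined by countably many values. -/
theorem exists_countable_determining [MeasurableSpace.CountablyGenerated α]
    [MeasurableSpace.CountablyGenerated β] :
    ∃ S : Set (Set (Measure α × Measure β)), S.Countable ∧ (∀ A ∈ S, MeasurableSet A) ∧
      ∀ κ η : Measure (Measure α × Measure β), IsFiniteMeasure κ →
        (∀ᵐ x ∂κ, x.1 univ < ∞ ∧ x.2 univ < ∞) → (∀ᵐ x ∂η, x.1 univ < ∞ ∧ x.2 univ < ∞) →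
        (∀ A ∈ S, κ A = η A) → κ = η := by
  obtain ⟨S₁, hc₁, hp₁, hg₁, hu₁⟩ := exists_countable_isPiSystem α
  obtain ⟨S₂, hc₂, hp₂, hg₂, hu₂⟩ := exists_countable_isPiSystem β
  have := hc₁.to_subtype
  have := hc₂.to_subtype
  have hm₁ : ∀ s ∈ S₁, MeasurableSet s := fun s hs => by
    rw [← hg₁]; exact MeasurableSpace.measurableSet_generateFrom hs
  have hm₂ : ∀ s ∈ S₂, MeasurableSet s := fun s hs => by
    rw [← hg₂]; exact MeasurableSpace.measurableSet_generateFrom hs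
  -- Finite measures are determined by their values on a countable π-system. So `Φ`, with values in
  -- a countably generated space, generates the σ-algebra as far as pairs of finite measures are
  -- concerned, although the full state space is too large for that.
  let Φ : Measure α × Measure β → (S₁ → ℝ≥0∞) × (S₂ → ℝ≥0∞) := fun x =>
    (fun s => finPart α x.1 s, fun s => finPart β x.2 s)
  have hΦ : Measurable Φ := by
    refine Measurable.prodMk (measurable_pi_lambda _ fun s => ?_)
      (measurable_pi_lambda _ fun s => ?_)
    · exact (Measure.measurable_coe (hm₁ s s.2)).comp ((finPart α).measurable.comp measurable_fst)
    · exact (Measure.measurable_coe (hm₂ s s.2)).comp ((finPart β).measurable.comp measurable_snd)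
  have hr : Measurable[MeasurableSpace.comap Φ inferInstance]
      (finPair : Measure α × Measure β → Measure α × Measure β) := by
    have hΦ' : Measurable[MeasurableSpace.comap Φ inferInstance] Φ := comap_measurable Φ
    refine Measurable.prodMk ?_ ?_
    · have : ∀ x : Measure α × Measure β, IsFiniteMeasure (finPart α x.1) :=
        fun x => isFiniteMeasure_finPart _
      refine Measurable.measure_of_isPiSystem (μ := fun x : Measure α × Measure β => finPart α x.1)
        hg₁.symm hp₁ (fun s hs => ?_) ?_
      · exact ((measurable_pi_apply (⟨s, hs⟩ : S₁)).comp measurable_fst).comp hΦ'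
      · exact ((measurable_pi_apply (⟨univ, hu₁⟩ : S₁)).comp measurable_fst).comp hΦ'
    · have : ∀ x : Measure α × Measure β, IsFiniteMeasure (finPart β x.2) :=
        fun x => isFiniteMeasure_finPart _
      refine Measurable.measure_of_isPiSystem (μ := fun x : Measure α × Measure β => finPart β x.2)
        hg₂.symm hp₂ (fun s hs => ?_) ?_
      · exact ((measurable_pi_apply (⟨s, hs⟩ : S₂)).comp measurable_snd).comp hΦ'
      · exact ((measurable_pi_apply (⟨univ, hu₂⟩ : S₂)).comp measurable_snd).comp hΦ'
  obtain ⟨S, hc, hp, hg, hu⟩ := exists_countable_isPiSystem ((S₁ → ℝ≥0∞) × (S₂ → ℝ≥0∞))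
  have hm : ∀ B ∈ S, MeasurableSet B := fun s hs => by
    rw [← hg]; exact MeasurableSpace.measurableSet_generateFrom hs
  refine ⟨(fun B => Φ ⁻¹' B) '' S, hc.image _, ?_, ?_⟩
  · rintro _ ⟨B, hB, rfl⟩
    exact hΦ (hm B hB)
  intro κ η hκ h1 h2 h
  have hmap : κ.map Φ = η.map Φ := by
    refine ext_of_generate_finite S hg.symm hp (fun B hB => ?_) ?_
    · rw [Measure.map_apply hΦ (hm B hB), Measure.map_apply hΦ (hm B hB)]
      exact h _ ⟨B, hB, rfl⟩
    · rw [Measure.map_apply hΦ MeasurableSet.univ, Measure.map_apply hΦ MeasurableSet.univ]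
      exact h _ ⟨univ, hu, rfl⟩
  have key : ∀ ζ : Measure (Measure α × Measure β), (∀ᵐ x ∂ζ, x.1 univ < ∞ ∧ x.2 univ < ∞) →
      ζ.map finPair = ζ := by
    intro ζ hζ
    conv_rhs => rw [← Measure.map_id (μ := ζ)]
    exact Measure.map_congr (hζ.mono fun x hx => finPair_of_lt hx.1 hx.2)
  rw [← key κ h1, ← key η h2]
  ext A hA
  rw [Measure.map_apply measurable_finPair hA, Measure.map_apply measurable_finPair hA]
  obtain ⟨B, hB, hBA⟩ := hr hA
  rw [← hBA, ← Measure.map_apply hΦ hB, hmap, Measure.map_apply hΦ hB]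

end Determination

/-! ### Uniqueness of the filter outside an observed null set -/

section Regular

variable {E : Type*} [MeasurableSpace E] {θ : Params E}

theorem Params.Admissible.measurableSet_isGood (hθ : θ.Admissible) (t : ℝ≥0) :
    MeasurableSet {x : State E | θ.IsGood t x} :=
  (hθ.measurable_jumps (measurableSet_singleton 0)).union
    (measurableSet_eq_fun (hθ.measurable_surv t)
      (measurable_negExp.comp (hθ.measurable_cum_left t)))

/-- The observed points, and the conditional law of the state that they determine, have the
properties that hold almost surely. -/
structure RegularPath (hθ : θ.Admissible) (ρ : Measure (State E)) [IsFiniteMeasure ρ]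
    (m : Measure (E × ℝ≥0)) : Prop where
  locCounting : LocCounting m
  zero : m (univ ×ˢ {0}) = 0
  le_one : ∀ t, m (univ ×ˢ {t}) ≤ 1
  good : ∀ T : ℚ≥0, ∀ᵐ x ∂(hθ.obsLaw ρ (m.restrict (upTo E T))), EndsBy T x ∧ θ.IsGood T x

end Regular

/-- `P` has a density on each `ℱ_t` but is not assumed absolutely continuous on all of `𝓕`.
Exceptional sets are therefore traced to null sets in some observed σ-algebra, which the trimmed
measure records. -/
theorem ae_of_ae_trim_of_null {Ω : Type*} {m m0 : MeasurableSpace Ω} (hm : m ≤ m0)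
    {μ M : Measure[m0] Ω} (h : ∀ A, MeasurableSet[m] A → μ A = 0 → M A = 0) {p : Ω → Prop}
    (hp : ∀ᵐ ω ∂(μ.trim hm), p ω) : ∀ᵐ ω ∂M, p ω := by
  obtain ⟨A, hsub, hA, h0⟩ := @exists_measurable_superset_of_null _ m (μ.trim hm) {ω | ¬ p ω} hp
  rw [trim_measurableSet_eq hm hA] at h0
  exact measure_mono_null hsub (h A hA h0)

namespace Model

variable {E Ω : Type*} [MeasurableSpace E] {mΩ : MeasurableSpace Ω}
  {X : Model E Ω} {θ : Params E} {ℱ : Filtration ℝ≥0 mΩ} {Q : Measure Ω}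
  {L : ℝ≥0 → Ω → ℝ} {φ ψ : ℝ≥0 → Ω → Measure (State E)}

namespace IsUnnormalizedFilter

theorem condExp_indicator (hφ : X.IsUnnormalizedFilter Q L φ) {t : ℝ≥0}
    (hs : Measurable (X.state t)) (hL : Integrable (L t) Q) {A : Set (State E)}
    (hA : MeasurableSet A) :
    (fun ω => (φ t ω).real A) =ᵐ[Q] Q[(X.state t ⁻¹' A).indicator (L t) | X.obs t] := by
  have e : (fun ω => A.indicator (1 : State E → ℝ) (X.state t ω) * L t ω) =
      (X.state t ⁻¹' A).indicator (L t) := by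
    ext ω
    by_cases h : X.state t ω ∈ A
    · rw [indicator_of_mem h, indicator_of_mem (show ω ∈ X.state t ⁻¹' A from h), Pi.one_apply,
        one_mul]
    · rw [indicator_of_notMem h, indicator_of_notMem (show ω ∉ X.state t ⁻¹' A from h), zero_mul]
  have h := hφ.condExp t (A.indicator 1) (measurable_one.indicator hA)
    (by rw [e]; exact hL.indicator (hs hA))
  rw [e] at h
  refine EventuallyEq.trans (Eventually.of_forall fun ω => ?_) h
  exact (integral_indicator_one hA).symm

theorem measurable_real (hφ : X.IsUnnormalizedFilter Q L φ) (t : ℝ≥0) {A : Set (State E)}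
    (hA : MeasurableSet A) : Measurable[X.obs t] fun ω => (φ t ω).real A :=
  ((Measure.measurable_coe hA).comp (hφ.adapted t)).ennreal_toReal

theorem ae_trim_finite (hφ : X.IsUnnormalizedFilter Q L φ) {t : ℝ≥0} (hobs : X.obs t ≤ mΩ)
    (hs : Measurable (X.state t)) (hL : Integrable (L t) Q)
    (hfin : ∀ ω, (X.state t ω).1 univ < ∞ ∧ (X.state t ω).2 univ < ∞) :
    ∀ᵐ ω ∂(Q.trim hobs), ∀ᵐ x ∂(φ t ω), x.1 univ < ∞ ∧ x.2 univ < ∞ := by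
  have hA : MeasurableSet {x : State E | x.1 univ < ∞ ∧ x.2 univ < ∞} :=
    (((Measure.measurable_coe MeasurableSet.univ).comp measurable_fst) measurableSet_Iio).inter
      (((Measure.measurable_coe MeasurableSet.univ).comp measurable_snd) measurableSet_Iio)
  have h := hφ.condExp_indicator hs hL hA.compl
  have h0 : X.state t ⁻¹' {x : State E | x.1 univ < ∞ ∧ x.2 univ < ∞}ᶜ = ∅ :=
    eq_empty_of_forall_notMem fun ω hω => hω (hfin ω)
  rw [h0, indicator_empty, show (fun _ : Ω => (0 : ℝ)) = 0 from rfl, condExp_zero] at h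
  filter_upwards [ae_eq_trim_of_measurable hobs (hφ.measurable_real t hA.compl)
    measurable_const h] with ω hω
  have := hφ.finite t ω
  exact (measureReal_eq_zero_iff).1 hω

/-- Two versions of a conditional expectation agree almost surely for each set, and countably many
sets determine the measures. -/
theorem ae_trim_eq [StandardBorelSpace E] (hφ : X.IsUnnormalizedFilter Q L φ)
    (hψ : X.IsUnnormalizedFilter Q L ψ) {t : ℝ≥0} (hobs : X.obs t ≤ mΩ)
    (hs : Measurable (X.state t)) (hL : Integrable (L t) Q)
    (hfin : ∀ ω, (X.state t ω).1 univ < ∞ ∧ (X.state t ω).2 univ < ∞) :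
    ∀ᵐ ω ∂(Q.trim hobs), φ t ω = ψ t ω := by
  obtain ⟨S, hc, hm, hS⟩ := exists_countable_determining (Bool × ℝ≥0) (E × ℝ≥0)
  have hall : ∀ᵐ ω ∂(Q.trim hobs), ∀ A ∈ S, (φ t ω).real A = (ψ t ω).real A := by
    refine (ae_ball_iff hc).2 fun A hA => ?_
    exact ae_eq_trim_of_measurable hobs (hφ.measurable_real t (hm A hA))
      (hψ.measurable_real t (hm A hA))
      ((hφ.condExp_indicator hs hL (hm A hA)).trans (hψ.condExp_indicator hs hL (hm A hA)).symm)
  filter_upwards [hall, hφ.ae_trim_finite hobs hs hL hfin, hψ.ae_trim_finite hobs hs hL hfin]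
    with ω h h1 h2
  have := hφ.finite t ω
  have := hψ.finite t ω
  exact hS _ _ inferInstance h1 h2 fun A hA => (measureReal_eq_measureReal_iff).1 (h A hA)

/-- Right continuity on each measurable set carries the identity from rational times to all times.
-/
theorem eq_of_forall_nnrat (hφ : X.IsUnnormalizedFilter Q L φ)
    (hψ : X.IsUnnormalizedFilter Q L ψ) {ω : Ω} (h : ∀ T : ℚ≥0, φ T ω = ψ T ω) (t : ℝ≥0) :
    φ t ω = ψ t ω := by
  have := hφ.finite t ω
  have := hψ.finite t ω
  ext A hA
  refine (measureReal_eq_measureReal_iff).1 ?_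
  have h1 : Tendsto (fun s => (φ s ω).real A) (𝓝[>] t) (𝓝 ((φ t ω).real A)) :=
    ((hφ.cadlag ω A hA t).1.mono Ioi_subset_Ici_self).tendsto
  have h2 : Tendsto (fun s => (ψ s ω).real A) (𝓝[>] t) (𝓝 ((ψ t ω).real A)) :=
    ((hψ.cadlag ω A hA t).1.mono Ioi_subset_Ici_self).tendsto
  refine tendsto_nhds_unique_of_frequently_eq h1 h2 ?_
  intro hne
  obtain ⟨u, hu, hsub⟩ := mem_nhdsGT_iff_exists_Ioo_subset.1 hne
  obtain ⟨q, hq⟩ := exists_nnrat_between (mem_Ioi.1 hu)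
  exact hsub ⟨hq.1, hq.2⟩ (show (φ q ω).real A = (ψ q ω).real A by rw [h q])

end IsUnnormalizedFilter

namespace IsReference

variable [IsProbabilityMeasure Q] [StandardBorelSpace E]

theorem endsBy_state (hX : X.IsReference θ ℱ Q) (t : ℝ≥0) (ω : Ω) : EndsBy t (X.state t ω) := by
  rw [hX.state_eq]
  exact endsBy_stateOf_upTo (hX.locCounting_C ω) t _

theorem ae_trim_obs (hX : X.IsReference θ ℱ Q) {T : ℝ≥0} {p : Measure (E × ℝ≥0) → Prop}
    (h : ∀ᵐ m ∂(Q.map (X.obsUpTo T)), p m) :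
    ∀ᵐ ω ∂(Q.trim (hX.obs_le T)), p (X.obsUpTo T ω) := by
  have h1 := measurableSet_toMeasurable (Q.map (X.obsUpTo T)) {m | ¬ p m}
  have h2 : (Q.map (X.obsUpTo T)) (toMeasurable (Q.map (X.obsUpTo T)) {m | ¬ p m}) = 0 := by
    rw [measure_toMeasurable]; exact h
  rw [Measure.map_apply (hX.measurable_obsUpTo T) h1] at h2
  have h3 : (Q.trim (hX.obs_le T))
      (X.obsUpTo T ⁻¹' toMeasurable (Q.map (X.obsUpTo T)) {m | ¬ p m}) = 0 := by
    exact (trim_measurableSet_eq (hX.obs_le T) ⟨_, h1, rfl⟩).trans h2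
  have hsub : {ω | ¬ p (X.obsUpTo T ω)} ⊆
      X.obsUpTo T ⁻¹' toMeasurable (Q.map (X.obsUpTo T)) {m | ¬ p m} :=
    fun ω hω => subset_toMeasurable _ _ hω
  exact measure_mono_null hsub h3

/-- What holds almost surely for the true state holds, by disintegration, almost everywhere under
its conditional law for almost every observation. -/
theorem ae_obsLaw_good (hX : X.IsReference θ ℱ Q) (hθ : θ.Admissible)
    [IsFiniteMeasure (X.initLaw Q)] (hL : X.IsLikelihood θ ℱ Q L) (T : ℝ≥0) :
    ∀ᵐ m ∂(Q.map (X.obsUpTo T)), ∀ᵐ x ∂(hθ.obsLaw (X.initLaw Q) m), EndsBy T x ∧ θ.IsGood T x := by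
  have hB : MeasurableSet {x : State E | EndsBy T x ∧ θ.IsGood T x} :=
    (measurableSet_endsBy T).inter (hθ.measurableSet_isGood T)
  refine Measure.ae_ae_of_ae_compProd
    (p := fun z : Measure (E × ℝ≥0) × State E => EndsBy T z.2 ∧ θ.IsGood T z.2) ?_
  rw [← hX.map_obs_state hθ T]
  refine (ae_map_iff ((hX.measurable_obsUpTo T).prodMk (hX.measurable_state T)).aemeasurable
    (measurable_snd hB)).2 ?_
  filter_upwards [hX.ae_likelihood_eq hθ hL] with ω hω
  exact ⟨hX.endsBy_state T ω, (hω T).2⟩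

/-- Almost surely, for every measure that is absolutely continuous with respect to the
reference probability on the observed events, a version of the filter is the explicit one. -/
theorem ae_regularPath (hX : X.IsReference θ ℱ Q) (hθ : θ.Admissible)
    [IsFiniteMeasure (X.initLaw Q)] (hL : X.IsLikelihood θ ℱ Q L)
    (hφ : X.IsUnnormalizedFilter Q L φ) {M : Measure Ω}
    (hM : ∀ T A, MeasurableSet[X.obs T] A → Q A = 0 → M A = 0) :
    ∀ᵐ ω ∂M, RegularPath hθ (X.initLaw Q) (X.O ω) ∧
      ∀ t, φ t ω = hθ.weightedLaw (X.initLaw Q) t ((X.O ω).restrict (upTo E t)) := by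
  have hψ := hX.isUnnormalizedFilter hθ hL
  have key : ∀ (T : ℝ≥0) (p : Ω → Prop), (∀ᵐ ω ∂(Q.trim (hX.obs_le T)), p ω) →
      ∀ᵐ ω ∂M, p ω := fun T p hp => ae_of_ae_trim_of_null (hX.obs_le T) (hM T) hp
  have hsimple : ∀ᵐ ω ∂M, ∀ n : ℕ, SimpleTimes (X.obsUpTo n ω) :=
    ae_all_iff.2 fun n => key n (fun ω => SimpleTimes (X.obsUpTo n ω)) (hX.ae_trim_obs
      ((ae_map_iff (hX.measurable_obsUpTo n).aemeasurable measurableSet_simpleTimes).2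
        (hX.ae_simpleTimes hθ n)))
  have hgood : ∀ᵐ ω ∂M, ∀ T : ℚ≥0,
      ∀ᵐ x ∂(hθ.obsLaw (X.initLaw Q) (X.obsUpTo T ω)), EndsBy T x ∧ θ.IsGood T x :=
    ae_all_iff.2 fun T => key T
      (fun ω => ∀ᵐ x ∂(hθ.obsLaw (X.initLaw Q) (X.obsUpTo T ω)), EndsBy T x ∧ θ.IsGood T x) (hX.ae_trim_obs
        (p := fun m => ∀ᵐ x ∂(hθ.obsLaw (X.initLaw Q) m), EndsBy T x ∧ θ.IsGood T x)
        (hX.ae_obsLaw_good hθ hL T))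
  have heq : ∀ᵐ ω ∂M, ∀ T : ℚ≥0, φ T ω = filter X Q hθ T ω :=
    ae_all_iff.2 fun T => key T (fun ω => φ T ω = filter X Q hθ T ω) (hφ.ae_trim_eq hψ (hX.obs_le T) (hX.measurable_state T)
      (hL.martingale.integrable T) fun ω => ⟨(hX.endsBy_state T ω).1, (hX.endsBy_state T ω).2⟩)
  filter_upwards [hsimple, hgood, heq] with ω h1 h2 h3
  have h4 := (hX.locCounting_O ω).time_of_simpleTimes h1
  exact ⟨⟨hX.locCounting_O ω, h4.1, h4.2, h2⟩, hφ.eq_of_forall_nnrat hψ h3⟩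

end IsReference

end Model

/-! ### Evolution of the filter between observed points and at one of them -/

section Segments

/-- The argument goes through a measurable null superset, because singletons in the state space need
not be measurable. -/
theorem of_ae_dirac {α : Type*} [MeasurableSpace α] {a : α} {p : α → Prop}
    (h : ∀ᵐ x ∂(Measure.dirac a), p x) : p a := by
  obtain ⟨A, hsub, hA, h0⟩ := exists_measurable_superset_of_null (ae_iff.1 h)
  by_contra hp
  rw [Measure.dirac_apply' _ hA, indicator_of_mem (hsub hp)] at h0
  exact one_ne_zero h0

theorem null_Ioi_of_forall_nnrat {A : Type*} [MeasurableSpace A] {μ : Measure (A × ℝ≥0)}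
    {a b : ℝ≥0} (hab : a < b) (h : ∀ q : ℚ≥0, a < q → (q : ℝ≥0) < b → μ (univ ×ˢ Ioi (q : ℝ≥0)) = 0) :
    μ (univ ×ˢ Ioi a) = 0 := by
  have hsub : (univ : Set A) ×ˢ Ioi a ⊆
      ⋃ q : {q : ℚ≥0 // a < (q : ℝ≥0) ∧ (q : ℝ≥0) < b}, univ ×ˢ Ioi ((q : ℚ≥0) : ℝ≥0) := by
    rintro y ⟨-, hy⟩
    obtain ⟨q, h1, h2⟩ := exists_nnrat_between (lt_min hab (mem_Ioi.1 hy))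
    exact mem_iUnion.2 ⟨⟨q, h1, h2.trans_le (min_le_left _ _)⟩, mem_univ _,
      h2.trans_le (min_le_right _ _)⟩
  exact measure_mono_null hsub (measure_iUnion_null fun q => h q q.2.1 q.2.2)

variable {E : Type*} [MeasurableSpace E] {θ : Params E}

/-- Rational times accumulate at `t` from the left, and both sides of the identity are
left-continuous. -/
theorem Params.isGood_of_forall_nnrat (hθ : θ.Admissible) {x : State E} {a b : ℝ≥0}
    (h : ∀ q : ℚ≥0, a < q → (q : ℝ≥0) < b → θ.IsGood q x) {t : ℝ≥0} (ht : t ∈ Ioo a b) :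
    θ.IsGood t x := by
  by_cases h0 : θ.jumps x = 0
  · exact Or.inl h0
  right
  have hb : 0 < t := zero_le.trans_lt ht.1
  have h1 : Tendsto (fun t => θ.surv t x) (𝓝[<] t) (𝓝 (θ.surv t x)) :=
    (hθ.continuous_surv x).continuousAt.tendsto.mono_left nhdsWithin_le_nhds
  have h2 : Tendsto (fun t => negExp (cum θ.ν (θ.rateAt x) t)) (𝓝[<] t)
      (𝓝 (negExp (cum θ.ν (θ.rateAt x) t))) := by
    have := hθ.sigmaFinite
    exact (continuous_negExp.tendsto _).comp (cum_tendsto_left hb)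
  refine tendsto_nhds_unique_of_frequently_eq h1 h2 ?_
  intro hne
  obtain ⟨u, hu, hsub⟩ := mem_nhdsLT_iff_exists_Ioo_subset' hb |>.1 hne
  obtain ⟨q, hq1, hq2⟩ := exists_nnrat_between (max_lt ht.1 (mem_Iio.1 hu))
  exact hsub ⟨(le_max_right _ _).trans_lt hq1, hq2⟩
    ((h q ((le_max_left _ _).trans_lt hq1) (hq2.trans ht.2)).resolve_left h0)

/-- For a fixed state only the survival factor can vanish in the course of time, and it is
nonincreasing. -/
theorem Params.weight_eq_zero_of_le (hθ : θ.Admissible) {x : State E} {a t : ℝ≥0} (hat : a ≤ t)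
    (h : θ.weight a x = 0) : θ.weight t x = 0 := by
  have := hθ.sigmaFinite
  rw [weight, mul_eq_zero, mul_eq_zero] at h
  rw [weight]
  rcases h with (h | h) | h
  · rw [h, zero_mul, zero_mul]
  · exact absurd h (Real.exp_ne_zero _)
  · have h1 : θ.surv t x ≤ θ.surv a x := survival_antitone (hθ.measurable_rateAt x) hat
    rw [le_antisymm (h1.trans h.le) (hθ.surv_nonneg t x), mul_zero]

/-- The integral of `f` with respect to the law `κ`, weighted by the likelihood at time `t`. -/
def Params.segInt (θ : Params E) (κ : Measure (State E)) (f : State E → ℝ) (t : ℝ≥0) : ℝ :=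
  ∫ x, f x * θ.weight t x ∂κ

/-- The frozen law is a finite sum of atoms, so the linear equations of their weights can be added
with no integrability condition on `f`. -/
theorem Params.hasDens_segInt (hθ : θ.Admissible) {κ : Measure (State E)} (hκ : IsAtomic κ)
    {a b : ℝ≥0} (h : ∀ᵐ x ∂κ, EndsBy a x ∧ ∀ t ∈ Ioo a b, θ.IsGood t x) {f : State E → ℝ}
    (hf : Measurable f) :
    HasDens θ.ν (θ.segInt κ f)
      (fun y => -θ.segInt κ (fun x => f x * ((θ.rate y x : ℝ) - θ.rateQ y)) y.2) a b := by
  have := hθ.sigmaFinite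
  obtain ⟨s, w, hw, rfl⟩ := hκ.exists_sum
  have hgood : ∀ x ∈ s, EndsBy a x ∧ ∀ t ∈ Ioo a b, θ.IsGood t x := by
    intro x hx
    -- The masses of the atoms are nonzero, so an almost everywhere property holds at each atom.
    have h1 := ae_finsetSum_measure_iff.1 h x hx
    exact of_ae_dirac (p := fun x => EndsBy a x ∧ ∀ t ∈ Ioo a b, θ.IsGood t x)
      ((Measure.absolutelyContinuous_smul (ENNReal.coe_ne_zero.2 (hw x hx))).ae_le h1)
  have hd := HasDens.sum (ν := θ.ν) (a := a) (b := b) s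
    (F := fun x t => (w x : ℝ) * (f x * θ.weight t x))
    (f := fun x y => (w x : ℝ) * (f x * -(((θ.rate y x : ℝ) - θ.rateQ y) * θ.weight y.2 x)))
    fun x hx => ((hθ.hasDens_weight (hgood x hx).1 (by
      by_cases h0 : θ.jumps x = 0
      · exact Or.inl h0
      · exact Or.inr fun t ht => ((hgood x hx).2 t ht).resolve_left h0)).const_mul (f x)).const_mul _
  have e1 : ∀ t, θ.segInt (∑ x ∈ s, (w x : ℝ≥0∞) • Measure.dirac x) f t =
      ∑ x ∈ s, (w x : ℝ) * (f x * θ.weight t x) :=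
    fun t => integral_sum_dirac (hf.mul (hθ.measurable_weight t))
  refine (hd.congr_fun' e1).congr_dens (Eventually.of_forall fun y _ => ?_)
  have hm : Measurable fun x => f x * ((θ.rate y x : ℝ) - θ.rateQ y) * θ.weight y.2 x :=
    (hf.mul ((hθ.measurable_rate_left y).coe_nnreal_real.sub_const _)).mul (hθ.measurable_weight _)
  rw [segInt, integral_sum_dirac hm, ← Finset.sum_neg_distrib]
  exact Finset.sum_congr rfl fun x _ => by ring

end Segments

section Regular

variable {E : Type*} [MeasurableSpace E] {θ : Params E} (hθ : θ.Admissible)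
  {ρ : Measure (State E)} [IsFiniteMeasure ρ] {m : Measure (E × ℝ≥0)}

/-- The unnormalized filter along the observed points `m`. -/
def Params.Admissible.pathInt (hθ : θ.Admissible) (ρ : Measure (State E)) [IsFiniteMeasure ρ]
    (m : Measure (E × ℝ≥0)) (f : State E → ℝ) (t : ℝ≥0) : ℝ :=
  ∫ x, f x ∂(hθ.weightedLaw ρ t (m.restrict (upTo E t)))

theorem pathInt_eq_segInt (f : State E → ℝ) {a b t : ℝ≥0} (hgap : m (univ ×ˢ Ioo a b) = 0)
    (hat : a ≤ t) (htb : t < b) :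
    hθ.pathInt ρ m f t = θ.segInt (hθ.obsLaw ρ (m.restrict (upTo E a))) f t := by
  rw [Params.Admissible.pathInt, integral_weightedLaw, restrict_upTo_of_gap hgap hat htb]
  rfl

theorem leftLim_pathInt (hρ : IsAtomic ρ) (hm : LocCounting m) {f : State E → ℝ}
    (hf : Measurable f) {a b : ℝ≥0} (hab : a < b) (hgap : m (univ ×ˢ Ioo a b) = 0) :
    Tendsto (hθ.pathInt ρ m f) (𝓝[<] b)
      (𝓝 (θ.segInt (hθ.obsLaw ρ (m.restrict (upTo E a))) f b)) := by
  have hc : Continuous (θ.segInt (hθ.obsLaw ρ (m.restrict (upTo E a))) f) :=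
    continuous_integral_mul_weight hθ (isAtomic_obsLaw hθ hρ (hm a)) hf
  refine (hc.continuousAt.tendsto.mono_left nhdsWithin_le_nhds).congr' ?_
  filter_upwards [Ioo_mem_nhdsLT hab] with t ht
  exact (pathInt_eq_segInt hθ f hgap ht.1.le ht.2).symm

/-- Regularity gives information at rational times only. In a gap the conditional law does not
change, so countably many times share one null set; rationals decreasing to `a` show that no atom of
the state lies after `a`. -/
theorem RegularPath.ae_good (hθ : θ.Admissible) (hm : RegularPath hθ ρ m) {a b : ℝ≥0}
    (hab : a < b) (hgap : m (univ ×ˢ Ioo a b) = 0) :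
    ∀ᵐ x ∂(hθ.obsLaw ρ (m.restrict (upTo E a))), EndsBy a x ∧ ∀ t ∈ Ioo a b, θ.IsGood t x := by
  have h : ∀ᵐ x ∂(hθ.obsLaw ρ (m.restrict (upTo E a))), ∀ q : ℚ≥0, a < q → (q : ℝ≥0) < b →
      EndsBy q x ∧ θ.IsGood q x := by
    refine ae_all_iff.2 fun q => ?_
    by_cases hq : a < (q : ℝ≥0) ∧ (q : ℝ≥0) < b
    · have := hm.good q
      rw [restrict_upTo_of_gap hgap hq.1.le hq.2] at this
      exact this.mono fun x hx _ _ => hx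
    · exact Eventually.of_forall fun x h1 h2 => absurd ⟨h1, h2⟩ hq
  filter_upwards [h] with x hx
  obtain ⟨q, hq1, hq2⟩ := exists_nnrat_between hab
  have h1 := (hx q hq1 hq2).1
  exact ⟨⟨h1.1, h1.2, null_Ioi_of_forall_nnrat hab fun q h1 h2 => (hx q h1 h2).1.3,
    null_Ioi_of_forall_nnrat hab fun q h1 h2 => (hx q h1 h2).1.4⟩,
    fun t ht => Params.isGood_of_forall_nnrat hθ (fun q h1 h2 => (hx q h1 h2).2) ht⟩

theorem pathInt_of_no_jump (f : State E → ℝ) {a b : ℝ≥0} (hab : a < b)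
    (hgap : m (univ ×ˢ Ioo a b) = 0) (h0 : m.restrict (univ ×ˢ {b}) = 0) :
    hθ.pathInt ρ m f b = θ.segInt (hθ.obsLaw ρ (m.restrict (upTo E a))) f b := by
  rw [Params.Admissible.pathInt, integral_weightedLaw, restrict_upTo_eq_add, h0, add_zero,
    restrict_before_of_gap hgap hab le_rfl]
  rfl

theorem Params.integral_stepLaw (hθ : θ.Admissible) {g : State E → ℝ} (hg : Measurable g)
    (y : E × ℝ≥0) (x : State E) :
    ∫ z, g z ∂(θ.stepLaw y x) = θ.keepW y * g x + θ.joinW y * fNew θ.p g y x := by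
  have hd : ∀ z : State E, Integrable g (Measure.dirac z) := fun z =>
    (IsAtomic.dirac z).integrable hg
  have h1 : 0 ≤ active x := by rcases active_eq_zero_or_one x with h | h <;> rw [h]; norm_num
  have h2 : 0 ≤ 1 - active x := by rcases active_eq_zero_or_one x with h | h <;> rw [h] <;> norm_num
  have h3 := hθ.p_nonneg
  have h4 : 0 ≤ 1 - θ.p := sub_nonneg.2 hθ.p_le_one
  have i1 := (hd (addPoint false y x)).smul_measure (c := ENNReal.ofReal θ.p) ENNReal.ofReal_ne_top
  have i2 := (hd (addPoint true y x)).smul_measure (c := ENNReal.ofReal (1 - θ.p))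
    ENNReal.ofReal_ne_top
  have i3 := (i1.add_measure i2).smul_measure (c := ENNReal.ofReal (active x)) ENNReal.ofReal_ne_top
  have i4 := (hd (addPoint true y x)).smul_measure (c := ENNReal.ofReal (1 - active x))
    ENNReal.ofReal_ne_top
  have i5 := (i4.add_measure i3).smul_measure (c := (θ.joinW y : ℝ≥0∞)) ENNReal.coe_ne_top
  have i6 := (hd x).smul_measure (c := (θ.keepW y : ℝ≥0∞)) ENNReal.coe_ne_top
  rw [stepLaw, clusterStep, integral_add_measure i6 i5, integral_smul_measure,
    integral_smul_measure, integral_add_measure i4 i3, integral_smul_measure, integral_smul_measure,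
    integral_add_measure i1 i2, integral_smul_measure, integral_smul_measure,
    integral_dirac' _ _ hg.stronglyMeasurable, integral_dirac' _ _ hg.stronglyMeasurable,
    integral_dirac' _ _ hg.stronglyMeasurable, ENNReal.toReal_ofReal h1, ENNReal.toReal_ofReal h2,
    ENNReal.toReal_ofReal h3, ENNReal.toReal_ofReal h4]
  simp only [smul_eq_mul, ENNReal.coe_toReal, fNew]

theorem integral_bind_stepLaw (hθ : θ.Admissible) {κ : Measure (State E)} (hκ : IsAtomic κ)
    {g : State E → ℝ} (hg : Measurable g) (y : E × ℝ≥0) :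
    ∫ z, g z ∂(κ.bind (θ.stepLaw y)) = ∫ x, (θ.keepW y * g x + θ.joinW y * fNew θ.p g y x) ∂κ := by
  have hs := hθ.measurable_stepLaw_left y
  have hm : Measurable fun x => θ.keepW y * g x + θ.joinW y * fNew θ.p g y x :=
    (hg.const_mul _).add ((measurable_fNew hg y).const_mul _)
  have hb : ∀ η : Measure (State E), IsAtomic η → Integrable g (η.bind (θ.stepLaw y)) :=
    fun η hη => (hη.bind hs fun x => Params.isAtomic_stepLaw y x).integrable hg
  refine hκ.induction (P := fun κ => ∫ z, g z ∂(κ.bind (θ.stepLaw y)) =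
    ∫ x, (θ.keepW y * g x + θ.joinW y * fNew θ.p g y x) ∂κ) ?_ ?_ ?_ ?_
  · intro x
    rw [Measure.dirac_bind hs, Params.integral_stepLaw hθ hg, integral_dirac' _ _ hm.stronglyMeasurable]
  · simp
  · intro κ η h1 h3 h2 h4
    rw [bind_add_left hs, integral_add_measure (hb κ h1) (hb η h3), h2, h4,
      integral_add_measure (h1.integrable hm) (h3.integrable hm)]
  · intro c κ _ h2
    rw [Measure.bind_smul, integral_smul_measure, integral_smul_measure, h2]

/-- The effect of an observed point on the filter. -/
theorem pathInt_of_jump [MeasurableSingletonClass E] (hθ : θ.Admissible) (hρ : IsAtomic ρ)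
    (hm : RegularPath hθ ρ m) {f : State E → ℝ} (hf : Measurable f) {a b : ℝ≥0} {u : E}
    (hab : a < b) (hgap : m (univ ×ˢ Ioo a b) = 0)
    (hu : m.restrict (univ ×ˢ {b}) = Measure.dirac (u, b)) :
    hθ.pathInt ρ m f b = θ.segInt (hθ.obsLaw ρ (m.restrict (upTo E a)))
      (fun x => θ.keepW (u, b) * f x + θ.joinW (u, b) *
        (fNew θ.p f (u, b) x * ((θ.rate (u, b) x : ℝ) / θ.rateQ (u, b)))) b := by
  have hc := hm.locCounting a
  obtain ⟨k, hk⟩ := hc.exists_nat MeasurableSet.univ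
  have hlt : ∀ᵐ z ∂(m.restrict (upTo E a)), z.2 < ((u, b) : E × ℝ≥0).2 := by
    filter_upwards [ae_restrict_mem (measurableSet_upTo a)] with z hz
    exact lt_of_le_of_lt (mem_Iic.1 hz.2) hab
  have hb : m.restrict (upTo E b) = m.restrict (upTo E a) + Measure.dirac (u, b) := by
    rw [restrict_upTo_eq_add, hu, restrict_before_of_gap hgap hab le_rfl]
  have hk1 : m.restrict (upTo E b) univ = ((k + 1 : ℕ) : ℝ≥0∞) := by
    rw [hb, Measure.add_apply, hk, measure_univ]
    push_cast
    rfl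
  have hw := hθ.measurable_weight b
  have hat : IsAtomic (hθ.obsLaw ρ (m.restrict (upTo E a))) := isAtomic_obsLaw hθ hρ hc
  have hlaw : hθ.obsLaw ρ (m.restrict (upTo E b)) =
      (hθ.obsLaw ρ (m.restrict (upTo E a))).bind (θ.stepLaw (u, b)) := by
    rw [obsLaw_apply hθ ρ hk1, obsLaw_apply hθ ρ hk, hb, pathLaw_add_dirac hθ ρ hc hk hlt]
  rw [Params.Admissible.pathInt, integral_weightedLaw, hlaw]
  refine (integral_bind_stepLaw hθ hat (hf.mul hw) (u, b)).trans (integral_congr_ae ?_)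
  -- The states end by time `a < b`, so a cluster event at `b` multiplies their weight by `λ/λ_Q`.
  filter_upwards [hm.ae_good hθ hab hgap] with x hx
  have hwd := fun d => hθ.weight_addPoint (y := (u, b)) hx.1 hab d
  simp only at hwd
  simp only [fNew, Pi.mul_apply, hwd]
  ring

end Regular

/-! ### From gaps and single jumps to an integral equation -/

section Evolution

variable {E : Type*} [MeasurableSpace E] [MeasurableSingletonClass E] {ν : Measure E} [SigmaFinite ν]
  {m : Measure (E × ℝ≥0)}

theorem LocCounting.gap_mono {a b c d : ℝ≥0} (hgap : m (univ ×ˢ Ioo a b) = 0) (hac : a ≤ c)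
    (hdb : d ≤ b) : m (univ ×ˢ Ioo c d) = 0 := by
  have hsub : (univ : Set E) ×ˢ Ioo c d ⊆ univ ×ˢ Ioo a b :=
    fun y hy => ⟨hy.1, hac.trans_lt hy.2.1, hy.2.2.trans_le hdb⟩
  exact measure_mono_null hsub hgap

/-- A function that has the density `A` between the points of `m`, and jumps by `B` at these
points, satisfies the corresponding integral equation. -/
theorem LocCounting.evolution (hm : LocCounting m) (h0 : m (univ ×ˢ {0}) = 0) {F : ℝ≥0 → ℝ}
    {A B : E × ℝ≥0 → ℝ} {T : ℝ≥0}
    (h : ∀ a b, a < b → b ≤ T → m (univ ×ˢ Ioo a b) = 0 → ∃ G, HasDens ν G A a b ∧ G a = F a ∧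
      F b = G b + ∫ y in univ ×ˢ {b}, B y ∂m) {t : ℝ≥0} (ht : t ≤ T) :
    IntegrableOn A (upTo E t) (ν.prod lebesgue) ∧
      F t = F 0 + ∫ y in upTo E t, A y ∂(ν.prod lebesgue) + ∫ y in upTo E t, B y ∂m := by
  -- The integral equation is carried across one gap together with the point, if any, at its right
  -- end.
  have step : ∀ a b, a < b → b ≤ T → m (univ ×ˢ Ioo a b) = 0 →
      (IntegrableOn A (upTo E a) (ν.prod lebesgue) ∧
        F a = F 0 + ∫ y in upTo E a, A y ∂(ν.prod lebesgue) + ∫ y in upTo E a, B y ∂m) →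
      IntegrableOn A (upTo E b) (ν.prod lebesgue) ∧
        F b = F 0 + ∫ y in upTo E b, A y ∂(ν.prod lebesgue) + ∫ y in upTo E b, B y ∂m := by
    rintro a b hab hb hgap ⟨h1, h2⟩
    obtain ⟨G, hG, hGa, hFb⟩ := h a b hab hb hgap
    have hu : upTo E b = upTo E a ∪ slab E a b := upTo_eq_union hab.le
    refine ⟨by rw [hu]; exact h1.union hG.1, ?_⟩
    rw [hu, setIntegral_union (disjoint_upTo_slab a b) (measurableSet_slab _ _) h1 hG.1,
      setIntegral_union (disjoint_upTo_slab a b) (measurableSet_slab _ _)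
        ((hm a).integrable _) ((hm.restrict_slab a b).integrable _), restrict_slab_of_gap hab hgap,
      hFb, hG.2 b ⟨hab.le, le_rfl⟩, hGa, h2]
    ring
  refine nnreal_induction (P := fun t => t ≤ T → IntegrableOn A (upTo E t) (ν.prod lebesgue) ∧
      F t = F 0 + ∫ y in upTo E t, A y ∂(ν.prod lebesgue) + ∫ y in upTo E t, B y ∂m)
    ?_ ?_ ?_ t ht
  · intro _
    have hu : upTo E 0 = univ ×ˢ {0} := by rw [upTo]; congr 1; ext s; simp
    have hm0 : m.restrict (upTo E 0) = 0 := by rw [Measure.restrict_eq_zero, hu, h0]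
    have hl0 : (ν.prod lebesgue).restrict (upTo E 0) = 0 := by
      rw [Measure.restrict_eq_zero, hu]
      have := ae_time_ne (ν := ν) 0
      refine measure_mono_null (fun y hy => ?_) this
      exact fun hne => hne hy.2
    refine ⟨?_, ?_⟩
    · rw [IntegrableOn, hl0]; exact integrable_zero_measure
    · rw [hm0, hl0]; simp
  · intro b hb ih hbT
    obtain ⟨a, hab, hgap⟩ := exists_gap_left hm hb
    exact step a b hab hbT hgap (ih a hab (hab.le.trans hbT))
  · intro a ha
    obtain ⟨b, hab, hgap⟩ := exists_gap_right hm a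
    filter_upwards [Ioo_mem_nhdsGT hab] with s hs hsT
    exact step a s hs.1 hsT (LocCounting.gap_mono hgap le_rfl hs.2.le) (ha (hs.1.le.trans hsT))

/-- Statements about almost every observed point reduce to statements about a jump time that carries
a single point. -/
theorem LocCounting.ae_jump (hm : LocCounting m) (h0 : m (univ ×ˢ {0}) = 0)
    (h1 : ∀ t, m (univ ×ˢ {t}) ≤ 1) (t : ℝ≥0) :
    ∀ᵐ y ∂(m.restrict (upTo E t)), 0 < y.2 ∧ y.2 ≤ t ∧
      m.restrict (univ ×ˢ {y.2}) = Measure.dirac y := by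
  filter_upwards [(hm t).ae_one_le, ae_restrict_mem (measurableSet_upTo t)] with y hy hyt
  have hy1 : 1 ≤ m {y} := hy.trans (Measure.restrict_apply_le _ _)
  have hsub : ({y} : Set (E × ℝ≥0)) ⊆ univ ×ˢ {y.2} := by
    rintro z rfl
    exact ⟨mem_univ _, rfl⟩
  refine ⟨pos_iff_ne_zero.2 fun h => ?_, hyt.2, ?_⟩
  · rw [h] at hsub
    have := hy1.trans ((measure_mono hsub).trans h0.le)
    exact absurd this (by simp)
  · have hr : m.restrict (univ ×ˢ {y.2}) {y} = m {y} := by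
      rw [Measure.restrict_apply (measurableSet_singleton y), inter_eq_left.2 hsub]
    rcases hm.jump_cases (h1 y.2) with hz | ⟨u, hu⟩
    · rw [hz] at hr
      rw [← hr] at hy1
      exact absurd hy1 (by simp)
    · rw [hu] at hr ⊢
      have : y = (u, y.2) := by
        by_contra hne
        rw [Measure.dirac_apply' _ (measurableSet_singleton y), indicator_of_notMem
          (fun h => hne (mem_singleton_iff.1 h).symm)] at hr
        rw [← hr] at hy1
        exact absurd hy1 (by simp)
      rw [← this]

end Evolution

/-! ### The Zakai and Kushner–Stratonovich equations along a regular path -/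

section SegInt

variable {E : Type*} [MeasurableSpace E] {θ : Params E} {κ : Measure (State E)}
  {f g : State E → ℝ}

theorem Params.integrable_mul_weight (hθ : θ.Admissible) (hκ : IsAtomic κ) (hf : Measurable f)
    (t : ℝ≥0) : Integrable (fun x => f x * θ.weight t x) κ :=
  hκ.integrable (hf.mul (hθ.measurable_weight t))

theorem Params.segInt_add (hθ : θ.Admissible) (hκ : IsAtomic κ) (hf : Measurable f)
    (hg : Measurable g) (t : ℝ≥0) :
    θ.segInt κ (fun x => f x + g x) t = θ.segInt κ f t + θ.segInt κ g t := by
  rw [segInt, segInt, segInt, ← integral_add (integrable_mul_weight hθ hκ hf t)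
    (integrable_mul_weight hθ hκ hg t)]
  simp only [add_mul]

theorem Params.segInt_const_mul (c : ℝ) (f : State E → ℝ) (t : ℝ≥0) :
    θ.segInt κ (fun x => c * f x) t = c * θ.segInt κ f t := by
  rw [segInt, segInt, ← integral_const_mul]
  simp only [mul_assoc]

theorem Params.segInt_nonneg (hθ : θ.Admissible) (hf : ∀ x, 0 ≤ f x) (t : ℝ≥0) :
    0 ≤ θ.segInt κ f t :=
  integral_nonneg fun x => mul_nonneg (hf x) (hθ.weight_nonneg t x)

/-- If the total mass vanishes, everything vanishes from then on. -/
theorem Params.segInt_eq_zero (hθ : θ.Admissible) (hκ : IsAtomic κ) {s t : ℝ≥0} (hst : s ≤ t)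
    (h : θ.segInt κ (fun _ => 1) s = 0) (f : State E → ℝ) : θ.segInt κ f t = 0 := by
  have h1 := (integral_eq_zero_iff_of_nonneg
    (fun x => mul_nonneg zero_le_one (hθ.weight_nonneg s x))
    (integrable_mul_weight hθ hκ measurable_const s)).1 h
  refine integral_eq_zero_of_ae ?_
  filter_upwards [h1] with x hx
  have hx' : θ.weight s x = 0 := by simpa using hx
  simp [weight_eq_zero_of_le hθ hst hx']

end SegInt

section Equations

variable {E : Type*} [MeasurableSpace E] [MeasurableSingletonClass E] {θ : Params E}
  {ρ : Measure (State E)} [IsFiniteMeasure ρ] {m : Measure (E × ℝ≥0)} {f : State E → ℝ}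

theorem Params.keepW_coe (hθ : θ.Admissible) (y : E × ℝ≥0) :
    (θ.keepW y : ℝ) = 1 - θ.joinW y :=
  eq_sub_of_add_eq (by exact_mod_cast hθ.keepW_add_joinW y)

/-- The integrand of the observed points in the equation of the unnormalized filter. -/
def Params.zakaiJump (θ : Params E) (f : State E → ℝ) (y : E × ℝ≥0) (x : State E) : ℝ :=
  fNew θ.p f y x * ((θ.rate y x : ℝ) / θ.rateQ y) - f x

theorem Params.measurable_zakaiJump (hθ : θ.Admissible) (hf : Measurable f) (y : E × ℝ≥0) :
    Measurable (θ.zakaiJump f y) :=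
  ((measurable_fNew hf y).mul ((hθ.measurable_rate_left y).coe_nnreal_real.div_const _)).sub hf

theorem Params.measurable_fNew_mul_rate (hθ : θ.Admissible) (hf : Measurable f) (y : E × ℝ≥0) :
    Measurable fun x => fNew θ.p f y x * (θ.rate y x : ℝ) :=
  (measurable_fNew hf y).mul (hθ.measurable_rate_left y).coe_nnreal_real

theorem Params.measurable_mul_rate (hθ : θ.Admissible) (hf : Measurable f) (y : E × ℝ≥0) :
    Measurable fun x => f x * (θ.rate y x : ℝ) :=
  hf.mul (hθ.measurable_rate_left y).coe_nnreal_real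

theorem leftLim_pathInt_eq (hθ : θ.Admissible) (hρ : IsAtomic ρ) (hm : LocCounting m)
    (hf : Measurable f) {a b : ℝ≥0} (hab : a < b) (hgap : m (univ ×ˢ Ioo a b) = 0) :
    Function.leftLim (hθ.pathInt ρ m f) b =
      θ.segInt (hθ.obsLaw ρ (m.restrict (upTo E a))) f b := by
  have : (𝓝[<] b).NeBot := nhdsLT_neBot_of_exists_lt ⟨a, hab⟩
  exact leftLim_eq_of_tendsto (leftLim_pathInt hθ hρ hm hf hab hgap)

/-- Since `keepW = 1 - joinW`, the observed point changes the integral by `joinW` times the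
difference between the updated and the old integrand. -/
theorem pathInt_jump (hθ : θ.Admissible) (hρ : IsAtomic ρ) (hm : RegularPath hθ ρ m)
    (hf : Measurable f) {a b : ℝ≥0} {u : E} (hab : a < b) (hgap : m (univ ×ˢ Ioo a b) = 0)
    (hu : m.restrict (univ ×ˢ {b}) = Measure.dirac (u, b)) :
    hθ.pathInt ρ m f b = θ.segInt (hθ.obsLaw ρ (m.restrict (upTo E a))) f b +
      θ.joinW (u, b) * θ.segInt (hθ.obsLaw ρ (m.restrict (upTo E a))) (θ.zakaiJump f (u, b)) b := by
  have hκ := isAtomic_obsLaw hθ hρ (hm.locCounting a)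
  rw [pathInt_of_jump hθ hρ hm hf hab hgap hu, ← Params.segInt_const_mul,
    ← Params.segInt_add hθ hκ hf ((Params.measurable_zakaiJump hθ hf _).const_mul _)]
  congr 1
  funext x
  rw [Params.keepW_coe hθ, Params.zakaiJump]
  ring

/-- The unnormalized filter satisfies its evolution equation along a regular path. -/
theorem RegularPath.zakai (hθ : θ.Admissible) (hρ : IsAtomic ρ) (hm : RegularPath hθ ρ m)
    (hf : Measurable f) (t : ℝ≥0) :
    IntegrableOn (fun y => -hθ.pathInt ρ m (fun x => f x * ((θ.rate y x : ℝ) - θ.rateQ y)) y.2)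
        (upTo E t) (θ.ν.prod lebesgue) ∧
      hθ.pathInt ρ m f t = hθ.pathInt ρ m f 0 +
        ∫ y in upTo E t, -hθ.pathInt ρ m (fun x => f x * ((θ.rate y x : ℝ) - θ.rateQ y)) y.2
          ∂(θ.ν.prod lebesgue) +
        ∫ y in upTo E t, Function.leftLim (hθ.pathInt ρ m (θ.zakaiJump f y)) y.2 *
          θ.joinW y ∂m := by
  have := hθ.sigmaFinite
  refine hm.locCounting.evolution hm.zero (T := t) (fun a b hab _ hgap => ?_) le_rfl
  have hκ := isAtomic_obsLaw hθ hρ (hm.locCounting a)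
  refine ⟨θ.segInt (hθ.obsLaw ρ (m.restrict (upTo E a))) f, ?_, ?_, ?_⟩
  · refine (Params.hasDens_segInt hθ hκ (hm.ae_good hθ hab hgap) hf).congr_dens ?_
    -- The frozen law gives the filter strictly before `b`; the jump time itself is negligible for
    -- the drift.
    filter_upwards [ae_time_ne (ν := θ.ν) b] with y hy hys
    rw [pathInt_eq_segInt hθ _ hgap hys.2.1.le (lt_of_le_of_ne hys.2.2 hy)]
  · exact (pathInt_eq_segInt hθ f hgap le_rfl hab).symm
  · rcases hm.locCounting.jump_cases (hm.le_one b) with h0 | ⟨u, hu⟩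
    · rw [h0, integral_zero_measure, add_zero, pathInt_of_no_jump hθ f hab hgap h0]
    · rw [hu, integral_dirac, pathInt_jump hθ hρ hm hf hab hgap hu,
        leftLim_pathInt_eq hθ hρ hm.locCounting (Params.measurable_zakaiJump hθ hf _) hab hgap]
      ring

theorem pathInt_one_nonneg (hθ : θ.Admissible) (t : ℝ≥0) : 0 ≤ hθ.pathInt ρ m (fun _ => 1) t :=
  integral_nonneg fun _ => zero_le_one

theorem pathInt_one_eq_zero_of_left (hθ : θ.Admissible) (hρ : IsAtomic ρ) (hm : RegularPath hθ ρ m)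
    {a b : ℝ≥0} (hab : a < b) (hgap : m (univ ×ˢ Ioo a b) = 0) {t : ℝ≥0} (htb : t ≤ b)
    (h : θ.segInt (hθ.obsLaw ρ (m.restrict (upTo E a))) (fun _ => 1) t = 0) :
    hθ.pathInt ρ m (fun _ => 1) b = 0 := by
  have hκ := isAtomic_obsLaw hθ hρ (hm.locCounting a)
  rcases hm.locCounting.jump_cases (hm.le_one b) with h0 | ⟨u, hu⟩
  · rw [pathInt_of_no_jump hθ _ hab hgap h0]
    exact Params.segInt_eq_zero hθ hκ htb h _
  · rw [pathInt_jump hθ hρ hm measurable_const hab hgap hu,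
      Params.segInt_eq_zero hθ hκ htb h, Params.segInt_eq_zero hθ hκ htb h]
    ring

/-- Zero mass means that all weights vanish. Weights that vanish stay zero until the next observed
point, and the update there is an integral against the same weighted law. -/
theorem pathInt_one_eq_zero_of_le (hθ : θ.Admissible) (hρ : IsAtomic ρ) (hm : RegularPath hθ ρ m)
    {s t : ℝ≥0} (hst : s ≤ t) (h : hθ.pathInt ρ m (fun _ => 1) s = 0) :
    hθ.pathInt ρ m (fun _ => 1) t = 0 := by
  have step : ∀ a b, a < b → m (univ ×ˢ Ioo a b) = 0 → hθ.pathInt ρ m (fun _ => 1) a = 0 →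
      hθ.pathInt ρ m (fun _ => 1) b = 0 := by
    intro a b hab hgap ha
    rw [pathInt_eq_segInt hθ _ hgap le_rfl hab] at ha
    exact pathInt_one_eq_zero_of_left hθ hρ hm hab hgap hab.le ha
  refine nnreal_induction (P := fun t => s ≤ t → hθ.pathInt ρ m (fun _ => 1) t = 0) ?_ ?_ ?_ t hst
  · intro hs
    rwa [le_antisymm hs zero_le] at h
  · intro b hb ih hsb
    rcases eq_or_lt_of_le hsb with rfl | hlt
    · exact h
    obtain ⟨a, hab, hgap⟩ := exists_gap_left hm.locCounting hb
    exact step (max a s) b (max_lt hab hlt) (LocCounting.gap_mono hgap (le_max_left _ _) le_rfl)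
      (ih _ (max_lt hab hlt) (le_max_right _ _))
  · intro a ha
    rcases le_or_gt s a with hsa | has
    · obtain ⟨b, hab, hgap⟩ := exists_gap_right hm.locCounting a
      filter_upwards [Ioo_mem_nhdsGT hab] with r hr _
      exact step a r hr.1 (LocCounting.gap_mono hgap le_rfl hr.2.le) (ha hsa)
    · filter_upwards [Ioo_mem_nhdsGT has] with r hr hsr
      exact absurd hsr hr.2.not_ge

theorem pathInt_one_pos_of_le (hθ : θ.Admissible) (hρ : IsAtomic ρ) (hm : RegularPath hθ ρ m)
    {s t : ℝ≥0} (hst : s ≤ t) (h : 0 < hθ.pathInt ρ m (fun _ => 1) t) :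
    0 < hθ.pathInt ρ m (fun _ => 1) s :=
  lt_of_le_of_ne (pathInt_one_nonneg hθ s) fun h0 =>
    h.ne' (pathInt_one_eq_zero_of_le hθ hρ hm hst h0.symm)

theorem segInt_one_pos (hθ : θ.Admissible) (hρ : IsAtomic ρ) (hm : RegularPath hθ ρ m)
    {a b : ℝ≥0} (hab : a < b) (hgap : m (univ ×ˢ Ioo a b) = 0) {t : ℝ≥0} (htb : t ≤ b)
    (h : 0 < hθ.pathInt ρ m (fun _ => 1) b) :
    0 < θ.segInt (hθ.obsLaw ρ (m.restrict (upTo E a))) (fun _ => 1) t :=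
  lt_of_le_of_ne (Params.segInt_nonneg hθ (fun _ => zero_le_one) t) fun h0 =>
    h.ne' (pathInt_one_eq_zero_of_left hθ hρ hm hab hgap htb h0.symm)

/-- The normalized filter along the observed points `m`. -/
def Params.Admissible.pathMean (hθ : θ.Admissible) (ρ : Measure (State E)) [IsFiniteMeasure ρ]
    (m : Measure (E × ℝ≥0)) (f : State E → ℝ) (t : ℝ≥0) : ℝ :=
  hθ.pathInt ρ m f t / hθ.pathInt ρ m (fun _ => 1) t

theorem tendsto_left_pathMean (hθ : θ.Admissible) (hρ : IsAtomic ρ) (hm : RegularPath hθ ρ m)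
    (hf : Measurable f) {a b : ℝ≥0} (hab : a < b) (hgap : m (univ ×ˢ Ioo a b) = 0)
    (h : 0 < hθ.pathInt ρ m (fun _ => 1) b) :
    Tendsto (hθ.pathMean ρ m f) (𝓝[<] b)
      (𝓝 (θ.segInt (hθ.obsLaw ρ (m.restrict (upTo E a))) f b /
        θ.segInt (hθ.obsLaw ρ (m.restrict (upTo E a))) (fun _ => 1) b)) :=
  (leftLim_pathInt hθ hρ hm.locCounting hf hab hgap).div
    (leftLim_pathInt hθ hρ hm.locCounting measurable_const hab hgap)
    (segInt_one_pos hθ hρ hm hab hgap le_rfl h).ne'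

theorem leftLim_pathMean_eq (hθ : θ.Admissible) (hρ : IsAtomic ρ) (hm : RegularPath hθ ρ m)
    (hf : Measurable f) {a b : ℝ≥0} (hab : a < b) (hgap : m (univ ×ˢ Ioo a b) = 0)
    (h : 0 < hθ.pathInt ρ m (fun _ => 1) b) :
    Function.leftLim (hθ.pathMean ρ m f) b =
      θ.segInt (hθ.obsLaw ρ (m.restrict (upTo E a))) f b /
        θ.segInt (hθ.obsLaw ρ (m.restrict (upTo E a))) (fun _ => 1) b := by
  have : (𝓝[<] b).NeBot := nhdsLT_neBot_of_exists_lt ⟨a, hab⟩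
  exact leftLim_eq_of_tendsto (tendsto_left_pathMean hθ hρ hm hf hab hgap h)

theorem isCadlag_pathMean (hθ : θ.Admissible) (hρ : IsAtomic ρ) (hm : RegularPath hθ ρ m)
    (hf : Measurable f) (h : ∀ t, 0 < hθ.pathInt ρ m (fun _ => 1) t) :
    IsCadlag (hθ.pathMean ρ m f) := by
  intro t
  refine ⟨(isCadlag_weightedLaw hθ hρ hm.locCounting hf t).1.div
    (isCadlag_weightedLaw hθ hρ hm.locCounting measurable_const t).1 (h t).ne', ?_⟩
  rcases eq_or_lt_of_le (zero_le (a := t)) with h0 | h0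
  · refine ⟨0, ?_⟩
    have : Iio t = ∅ := by rw [← h0]; ext s; simp
    rw [this, nhdsWithin_empty]
    exact tendsto_bot
  · obtain ⟨a, hat, hgap⟩ := exists_gap_left hm.locCounting h0
    exact ⟨_, tendsto_left_pathMean hθ hρ hm hf hat hgap (h t)⟩

/-- The integrand of the observed points in the equation of the normalized filter. -/
def Params.Admissible.ksJump (hθ : θ.Admissible) (ρ : Measure (State E)) [IsFiniteMeasure ρ]
    (m : Measure (E × ℝ≥0)) (f : State E → ℝ) (y : E × ℝ≥0) : ℝ :=
  (Function.leftLim (hθ.pathMean ρ m fun x => fNew θ.p f y x * (θ.rate y x : ℝ)) y.2 -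
      Function.leftLim (hθ.pathMean ρ m fun x => (θ.rate y x : ℝ)) y.2 *
        Function.leftLim (hθ.pathMean ρ m f) y.2) /
    Function.leftLim (hθ.pathMean ρ m fun x => (θ.rate y x : ℝ) + θ.γ y) y.2

/-- The drift in the equation of the normalized filter. -/
def Params.Admissible.ksDrift (hθ : θ.Admissible) (ρ : Measure (State E)) [IsFiniteMeasure ρ]
    (m : Measure (E × ℝ≥0)) (f : State E → ℝ) (y : E × ℝ≥0) : ℝ :=
  hθ.pathMean ρ m (fun x => f x * (θ.rate y x : ℝ)) y.2 -
    hθ.pathMean ρ m f y.2 * hθ.pathMean ρ m (fun x => (θ.rate y x : ℝ)) y.2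

theorem Params.fNew_one (p : ℝ) (y : E × ℝ≥0) (x : State E) : fNew p (fun _ => 1) y x = 1 := by
  rw [fNew]; ring

theorem segInt_zakaiJump (hθ : θ.Admissible) {κ : Measure (State E)} (hκ : IsAtomic κ)
    (hf : Measurable f) (y : E × ℝ≥0) (t : ℝ≥0) :
    θ.segInt κ (θ.zakaiJump f y) t =
      θ.segInt κ (fun x => fNew θ.p f y x * (θ.rate y x : ℝ)) t / θ.rateQ y - θ.segInt κ f t := by
  have e : θ.zakaiJump f y = fun x =>
      (θ.rateQ y : ℝ)⁻¹ * (fNew θ.p f y x * (θ.rate y x : ℝ)) + (-1) * f x := by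
    funext x
    rw [Params.zakaiJump]
    ring
  rw [e, Params.segInt_add hθ hκ ((Params.measurable_fNew_mul_rate hθ hf y).const_mul _) (hf.const_mul _),
    Params.segInt_const_mul, Params.segInt_const_mul]
  ring

theorem segInt_rate_add (hθ : θ.Admissible) {κ : Measure (State E)} (hκ : IsAtomic κ)
    (y : E × ℝ≥0) (t : ℝ≥0) :
    θ.segInt κ (fun x => (θ.rate y x : ℝ) + θ.γ y) t =
      θ.segInt κ (fun x => (θ.rate y x : ℝ)) t + θ.γ y * θ.segInt κ (fun _ => 1) t := by
  rw [← Params.segInt_const_mul, ← Params.segInt_add hθ hκ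
    (hθ.measurable_rate_left y).coe_nnreal_real (measurable_const.const_mul _)]
  simp only [mul_one]

/-- The effect of an observed point on the unnormalized filter, without fractions. -/
theorem pathInt_jump_mul (hθ : θ.Admissible) (hρ : IsAtomic ρ) (hm : RegularPath hθ ρ m)
    (hf : Measurable f) {a b : ℝ≥0} {u : E} (hab : a < b) (hgap : m (univ ×ˢ Ioo a b) = 0)
    (hu : m.restrict (univ ×ˢ {b}) = Measure.dirac (u, b)) :
    (θ.rateQ (u, b) + θ.γ (u, b)) * hθ.pathInt ρ m f b =
      θ.γ (u, b) * θ.segInt (hθ.obsLaw ρ (m.restrict (upTo E a))) f b +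
        θ.segInt (hθ.obsLaw ρ (m.restrict (upTo E a)))
          (fun x => fNew θ.p f (u, b) x * (θ.rate (u, b) x : ℝ)) b := by
  have hκ := isAtomic_obsLaw hθ hρ (hm.locCounting a)
  have hQ : (0 : ℝ) < θ.rateQ (u, b) := NNReal.coe_pos.2 (hθ.rateQ_pos _)
  have hγ : (0 : ℝ) ≤ θ.γ (u, b) := (θ.γ (u, b)).coe_nonneg
  have hne : (θ.rateQ (u, b) : ℝ) + θ.γ (u, b) ≠ 0 := (add_pos_of_pos_of_nonneg hQ hγ).ne'
  rw [pathInt_jump hθ hρ hm hf hab hgap hu, segInt_zakaiJump hθ hκ hf, Params.joinW]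
  push_cast
  field_simp
  ring

theorem pathInt_one_jump_mul (hθ : θ.Admissible) (hρ : IsAtomic ρ) (hm : RegularPath hθ ρ m)
    {a b : ℝ≥0} {u : E} (hab : a < b) (hgap : m (univ ×ˢ Ioo a b) = 0)
    (hu : m.restrict (univ ×ˢ {b}) = Measure.dirac (u, b)) :
    (θ.rateQ (u, b) + θ.γ (u, b)) * hθ.pathInt ρ m (fun _ => 1) b =
      θ.segInt (hθ.obsLaw ρ (m.restrict (upTo E a)))
        (fun x => (θ.rate (u, b) x : ℝ) + θ.γ (u, b)) b := by
  have hκ := isAtomic_obsLaw hθ hρ (hm.locCounting a)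
  rw [pathInt_jump_mul hθ hρ hm measurable_const hab hgap hu, segInt_rate_add hθ hκ]
  simp only [Params.fNew_one, one_mul]
  ring

/-- The quantity equals `λ_Q + γ` times the total mass after the jump. Positivity of the later mass
thus makes the denominator positive. -/
theorem segInt_rate_add_pos (hθ : θ.Admissible) (hρ : IsAtomic ρ) (hm : RegularPath hθ ρ m)
    {a b : ℝ≥0} {u : E} (hab : a < b) (hgap : m (univ ×ˢ Ioo a b) = 0)
    (hu : m.restrict (univ ×ˢ {b}) = Measure.dirac (u, b))
    (h : 0 < hθ.pathInt ρ m (fun _ => 1) b) :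
    0 < θ.segInt (hθ.obsLaw ρ (m.restrict (upTo E a)))
        (fun x => (θ.rate (u, b) x : ℝ) + θ.γ (u, b)) b := by
  rw [← pathInt_one_jump_mul hθ hρ hm hab hgap hu]
  exact mul_pos (add_pos_of_pos_of_nonneg (NNReal.coe_pos.2 (hθ.rateQ_pos _))
    (θ.γ (u, b)).coe_nonneg) h

/-- The denominators in the equation of the normalized filter are positive. -/
theorem RegularPath.denominator_pos (hθ : θ.Admissible) (hρ : IsAtomic ρ)
    (hm : RegularPath hθ ρ m) {t : ℝ≥0} (h : 0 < hθ.pathInt ρ m (fun _ => 1) t) :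
    ∀ᵐ y ∂(m.restrict (upTo E t)),
      0 < Function.leftLim (hθ.pathMean ρ m fun x => (θ.rate y x : ℝ) + θ.γ y) y.2 := by
  filter_upwards [hm.locCounting.ae_jump hm.zero hm.le_one t] with y ⟨h0, hyt, hy⟩
  obtain ⟨a, hab, hgap⟩ := exists_gap_left hm.locCounting h0
  have hpos := pathInt_one_pos_of_le hθ hρ hm hyt h
  have hr := (hθ.measurable_rate_left y).coe_nnreal_real
  rw [leftLim_pathMean_eq hθ hρ hm (hr.add_const _) hab hgap hpos]
  exact div_pos (segInt_rate_add_pos hθ hρ hm (u := y.1) hab hgap hy hpos)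
    (segInt_one_pos hθ hρ hm hab hgap le_rfl hpos)

/-- The normalized filter satisfies its evolution equation along a regular path. -/
theorem RegularPath.kushnerStratonovich (hθ : θ.Admissible) (hρ : IsAtomic ρ)
    (hm : RegularPath hθ ρ m) (hf : Measurable f) {t : ℝ≥0}
    (h : 0 < hθ.pathInt ρ m (fun _ => 1) t) :
    IntegrableOn (fun y => -hθ.ksDrift ρ m f y) (upTo E t) (θ.ν.prod lebesgue) ∧
      hθ.pathMean ρ m f t = hθ.pathMean ρ m f 0 +
        ∫ y in upTo E t, -hθ.ksDrift ρ m f y ∂(θ.ν.prod lebesgue) +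
        ∫ y in upTo E t, hθ.ksJump ρ m f y ∂m := by
  have := hθ.sigmaFinite
  refine hm.locCounting.evolution hm.zero (T := t) (fun a b hab hbt hgap => ?_) le_rfl
  have hκ := isAtomic_obsLaw hθ hρ (hm.locCounting a)
  have hb := pathInt_one_pos_of_le hθ hρ hm hbt h
  -- Positivity at the right end propagates backwards over the gap, so the total mass can be
  -- inverted up to and including the left limit at `b`.
  have h1 : ∀ s ∈ Icc a b, 0 < θ.segInt (hθ.obsLaw ρ (m.restrict (upTo E a))) (fun _ => 1) s :=
    fun s hs => segInt_one_pos hθ hρ hm hab hgap hs.2 hb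
  have hmean : ∀ (g : State E → ℝ) s, a ≤ s → s < b → hθ.pathMean ρ m g s =
      θ.segInt (hθ.obsLaw ρ (m.restrict (upTo E a))) g s *
        (θ.segInt (hθ.obsLaw ρ (m.restrict (upTo E a))) (fun _ => 1) s)⁻¹ := by
    intro g s has hsb
    rw [Params.Admissible.pathMean, pathInt_eq_segInt hθ g hgap has hsb,
      pathInt_eq_segInt hθ _ hgap has hsb, div_eq_mul_inv]
  have hgood := hm.ae_good hθ hab hgap
  set κ := hθ.obsLaw ρ (m.restrict (upTo E a)) with hκdef
  have hlin : ∀ (g : State E → ℝ), Measurable g → ∀ (y : E × ℝ≥0) (s : ℝ≥0),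
      θ.segInt κ (fun x => g x * ((θ.rate y x : ℝ) - θ.rateQ y)) s =
      θ.segInt κ (fun x => g x * (θ.rate y x : ℝ)) s - θ.rateQ y * θ.segInt κ g s := by
    intro g hg y s
    have e : (fun x => g x * ((θ.rate y x : ℝ) - θ.rateQ y)) =
        fun x => g x * (θ.rate y x : ℝ) + (-(θ.rateQ y : ℝ)) * g x := by
      funext x; ring
    rw [e, Params.segInt_add hθ hκ (Params.measurable_mul_rate hθ hg y)
      (hg.const_mul _), Params.segInt_const_mul]
    ring
  -- Product rule for `φ(f)` and the inverse of `φ(1)`, both computed with the frozen law; the terms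
  -- with `λ_Q` cancel.
  refine ⟨fun s => θ.segInt κ f s * (θ.segInt κ (fun _ => 1) s)⁻¹, ?_, ?_, ?_⟩
  · refine ((Params.hasDens_segInt hθ hκ hgood hf).mul
      ((Params.hasDens_segInt hθ hκ hgood measurable_const).inv h1)).congr_dens ?_
    filter_upwards [ae_time_ne (ν := θ.ν) b] with y hy hys
    have hlt := lt_of_le_of_ne hys.2.2 hy
    have hpos := h1 y.2 ⟨hys.2.1.le, hys.2.2⟩
    rw [Params.Admissible.ksDrift, hmean _ _ hys.2.1.le hlt, hmean _ _ hys.2.1.le hlt,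
      hmean _ _ hys.2.1.le hlt, hlin f hf, hlin _ measurable_const]
    simp only [one_mul]
    have := hpos.ne'
    field_simp
    ring
  · exact (hmean f a le_rfl hab).symm
  · have hone := (h1 b ⟨hab.le, le_rfl⟩).ne'
    rcases hm.locCounting.jump_cases (hm.le_one b) with h0 | ⟨u, hu⟩
    · rw [h0, integral_zero_measure, add_zero, Params.Admissible.pathMean,
        pathInt_of_no_jump hθ f hab hgap h0, pathInt_of_no_jump hθ _ hab hgap h0, div_eq_mul_inv]
    · have hr := (hθ.measurable_rate_left (u, b)).coe_nnreal_real
      have hden := (segInt_rate_add_pos hθ hρ hm hab hgap hu hb).ne'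
      have e1 := pathInt_jump_mul hθ hρ hm hf hab hgap hu
      have e2 := pathInt_one_jump_mul hθ hρ hm hab hgap hu
      have e3 := segInt_rate_add hθ hκ (u, b) b
      rw [hu, integral_dirac, Params.Admissible.ksJump, Params.Admissible.pathMean,
        leftLim_pathMean_eq hθ hρ hm (Params.measurable_fNew_mul_rate hθ hf _) hab hgap hb,
        leftLim_pathMean_eq hθ hρ hm hr hab hgap hb, leftLim_pathMean_eq hθ hρ hm hf hab hgap hb,
        leftLim_pathMean_eq hθ hρ hm (hr.add_const _) hab hgap hb]
      have hw : (θ.rateQ (u, b) : ℝ) + θ.γ (u, b) ≠ 0 := by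
        intro h0
        rw [h0, zero_mul] at e2
        exact hden e2.symm
      -- The common factor `λ_Q + γ` drops out of the quotient, so the jump no longer contains
      -- `λ_Q`.
      have e4 : hθ.pathInt ρ m f b / hθ.pathInt ρ m (fun _ => 1) b =
          (θ.γ (u, b) * θ.segInt κ f b +
            θ.segInt κ (fun x => fNew θ.p f (u, b) x * (θ.rate (u, b) x : ℝ)) b) /
          θ.segInt κ (fun x => (θ.rate (u, b) x : ℝ) + θ.γ (u, b)) b := by
        rw [← mul_div_mul_left _ _ hw, e1, e2]
      rw [e4]
      rw [← hκdef] at hden ⊢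
      simp only
      set A := θ.segInt κ (fun x => (θ.rate (u, b) x : ℝ) + θ.γ (u, b)) b
      set B := θ.segInt κ (fun x => (θ.rate (u, b) x : ℝ)) b
      set Z := θ.segInt κ (fun _ => 1) b
      field_simp
      rw [e3]
      ring

end Equations

/-! ### The equations for an arbitrary version of the filter -/

section PathEquations

variable {E Ω : Type*} [MeasurableSpace E] [MeasurableSingletonClass E] {θ : Params E}
  {X : Model E Ω} {φ : ℝ≥0 → Ω → Measure (State E)} {ω : Ω}
  {ρ : Measure (State E)} [IsFiniteMeasure ρ]

theorem unnorm_eq_pathInt (hθ : θ.Admissible)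
    (h : ∀ t, φ t ω = hθ.weightedLaw ρ t ((X.O ω).restrict (upTo E t))) (f : State E → ℝ) :
    unnorm φ ω f = hθ.pathInt ρ (X.O ω) f := by
  funext t
  rw [unnorm, h]
  rfl

theorem RegularPath.integrable_filter (hθ : θ.Admissible) (hρ : IsAtomic ρ)
    (hm : RegularPath hθ ρ (X.O ω))
    (h : ∀ t, φ t ω = hθ.weightedLaw ρ t ((X.O ω).restrict (upTo E t))) {f : State E → ℝ}
    (hf : Measurable f) (t : ℝ≥0) : Integrable f (φ t ω) := by
  rw [h]
  exact integrable_weightedLaw hθ hρ t (hm.locCounting t) hf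

theorem RegularPath.isCadlag_unnorm (hθ : θ.Admissible) (hρ : IsAtomic ρ)
    (hm : RegularPath hθ ρ (X.O ω))
    (h : ∀ t, φ t ω = hθ.weightedLaw ρ t ((X.O ω).restrict (upTo E t))) {f : State E → ℝ}
    (hf : Measurable f) : IsCadlag (unnorm φ ω f) := by
  rw [unnorm_eq_pathInt hθ h]
  exact isCadlag_weightedLaw hθ hρ hm.locCounting hf

theorem RegularPath.zakaiAt (hθ : θ.Admissible) (hρ : IsAtomic ρ)
    (hm : RegularPath hθ ρ (X.O ω))
    (h : ∀ t, φ t ω = hθ.weightedLaw ρ t ((X.O ω).restrict (upTo E t))) {f : State E → ℝ}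
    (hf : Measurable f) (t : ℝ≥0) : ZakaiAt θ X φ ω f t := by
  obtain ⟨h1, h2⟩ := hm.zakai hθ hρ hf t
  have h1' := h1.neg
  rw [integral_neg] at h2
  simp only [ZakaiAt, unnormLeft, unnorm_eq_pathInt hθ h]
  refine ⟨?_, (hm.locCounting t).integrable _, ?_⟩
  · refine h1'.congr (Eventually.of_forall fun y => ?_)
    simp only [Pi.neg_apply, neg_neg]
  · rw [h2, ← sub_eq_add_neg]
    congr 1

theorem norml_eq_pathMean (hθ : θ.Admissible)
    (h : ∀ t, φ t ω = hθ.weightedLaw ρ t ((X.O ω).restrict (upTo E t))) (f : State E → ℝ) :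
    norml φ ω f = hθ.pathMean ρ (X.O ω) f := by
  funext t
  rw [norml, unnorm_eq_pathInt hθ h, unnorm_eq_pathInt hθ h]
  rfl

theorem RegularPath.kushnerStratonovichAt (hθ : θ.Admissible) (hρ : IsAtomic ρ)
    (hm : RegularPath hθ ρ (X.O ω))
    (h : ∀ t, φ t ω = hθ.weightedLaw ρ t ((X.O ω).restrict (upTo E t))) {f : State E → ℝ}
    (hf : Measurable f) {t : ℝ≥0} (ht : 0 < unnorm φ ω (fun _ => 1) t) :
    KushnerStratonovichAt θ X φ ω f t := by
  rw [unnorm_eq_pathInt hθ h] at ht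
  obtain ⟨h1, h2⟩ := hm.kushnerStratonovich hθ hρ hf ht
  have h1' := h1.neg
  rw [integral_neg] at h2
  simp only [KushnerStratonovichAt, normlLeft, norml_eq_pathMean hθ h]
  refine ⟨hm.denominator_pos hθ hρ ht, (hm.locCounting t).integrable _, ?_, ?_⟩
  · refine h1'.congr (Eventually.of_forall fun y => ?_)
    simp only [Pi.neg_apply, neg_neg]
    rfl
  · rw [h2, add_assoc, neg_add_eq_sub, ← add_sub_assoc]
    rfl

theorem RegularPath.isCadlag_norml (hθ : θ.Admissible) (hρ : IsAtomic ρ)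
    (hm : RegularPath hθ ρ (X.O ω))
    (h : ∀ t, φ t ω = hθ.weightedLaw ρ t ((X.O ω).restrict (upTo E t))) {f : State E → ℝ}
    (hf : Measurable f) (ht : ∀ t, 0 < unnorm φ ω (fun _ => 1) t) :
    IsCadlag (norml φ ω f) := by
  rw [norml_eq_pathMean hθ h]
  refine isCadlag_pathMean hθ hρ hm hf fun t => ?_
  have := ht t
  rwa [unnorm_eq_pathInt hθ h] at this

theorem RegularPath.unnorm_pos (hθ : θ.Admissible) (hρ : IsAtomic ρ)
    (hm : RegularPath hθ ρ (X.O ω))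
    (h : ∀ t, φ t ω = hθ.weightedLaw ρ t ((X.O ω).restrict (upTo E t)))
    (hn : ∀ n : ℕ, 0 < unnorm φ ω (fun _ => 1) n) (t : ℝ≥0) : 0 < unnorm φ ω (fun _ => 1) t := by
  obtain ⟨n, htn⟩ := exists_nat_ge t
  have := hn n
  rw [unnorm_eq_pathInt hθ h] at this ⊢
  exact pathInt_one_pos_of_le hθ hρ hm htn this

end PathEquations

/-! ### Change of measure on a sub-σ-algebra -/

section ChangeOfMeasure

variable {Ω : Type*} {m m0 : MeasurableSpace Ω} {Q P : Measure Ω} {D Z : Ω → ℝ}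

/-- Integrals with respect to a measure that has the density `D` on a sub-σ-algebra. -/
theorem integrable_of_density (hm : m ≤ m0) [SigmaFinite Q] (hD : AEMeasurable D Q)
    (hD0 : ∀ᵐ ω ∂Q, 0 ≤ D ω)
    (hP : ∀ A, MeasurableSet[m] A → P A = ∫⁻ ω in A, ENNReal.ofReal (D ω) ∂Q)
    (hZ : StronglyMeasurable[m] Z) :
    (Integrable Z P ↔ Integrable (fun ω => Z ω * D ω) Q) ∧
      ∀ A, MeasurableSet[m] A → ∫ ω in A, Z ω ∂P = ∫ ω in A, Z ω * D ω ∂Q := by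
  -- The two measures are compared on `m` only; integrals of `m`-measurable functions pass through
  -- the restriction to `m`.
  have htrim : P.trim hm = (Q.withDensity fun ω => ENNReal.ofReal (D ω)).trim hm := by
    refine @Measure.ext _ m _ _ fun A hA => ?_
    rw [trim_measurableSet_eq hm hA, trim_measurableSet_eq hm hA, hP A hA,
      withDensity_apply _ (hm A hA)]
  have hsmul : (fun ω => (D ω).toNNReal • Z ω) =ᵐ[Q] fun ω => Z ω * D ω := by
    filter_upwards [hD0] with ω hω
    rw [NNReal.smul_def, smul_eq_mul, Real.coe_toNNReal _ hω, mul_comm]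
  constructor
  · have h1 : Integrable Z P ↔ Integrable Z (P.trim hm) :=
      ⟨fun h => h.trim hm hZ, integrable_of_integrable_trim hm⟩
    have h2 : Integrable Z (Q.withDensity fun ω => ENNReal.ofReal (D ω)) ↔
        Integrable Z ((Q.withDensity fun ω => ENNReal.ofReal (D ω)).trim hm) :=
      ⟨fun h => h.trim hm hZ, integrable_of_integrable_trim hm⟩
    rw [h1, htrim, ← h2]
    exact (integrable_withDensity_iff_integrable_smul₀ hD.real_toNNReal).trans
      (integrable_congr hsmul)
  · intro A hA
    rw [setIntegral_trim hm hZ hA, htrim, ← setIntegral_trim hm hZ hA]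
    refine Eq.trans (setIntegral_withDensity_eq_setIntegral_smul₀ hD.real_toNNReal.restrict Z
      (hm A hA)) ?_
    exact integral_congr_ae (ae_restrict_of_ae hsmul)

end ChangeOfMeasure

/-! ### The state is adapted up to null sets -/

section AdaptedState

variable {E : Type*} [MeasurableSpace E] [MeasurableSingletonClass E] {c : Measure (E × ℝ≥0)}

/-- The number of points up to time `t`. -/
def numUpTo (c : Measure (E × ℝ≥0)) (t : ℝ≥0) : ℕ := ⌊(c (upTo E t)).toReal⌋₊

theorem numUpTo_eq (c : Measure (E × ℝ≥0)) (t : ℝ≥0) :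
    numUpTo c t = ⌊(c.restrict (upTo E t) univ).toReal⌋₊ := by
  rw [numUpTo, Measure.restrict_apply_univ]

theorem numUpTo_of_gap {a b t : ℝ≥0} (h : c (univ ×ˢ Ioo a b) = 0) (hat : a ≤ t) (htb : t < b) :
    numUpTo c t = numUpTo c a := by
  rw [numUpTo_eq, numUpTo_eq, restrict_upTo_of_gap h hat htb]

/-- The count starts at zero and grows by at most one at a time, so it skips no value. -/
theorem LocCounting.exists_numUpTo_eq (hc : LocCounting c) (h0 : c (univ ×ˢ {0}) = 0)
    (h1 : ∀ t, c (univ ×ˢ {t}) ≤ 1) (t : ℝ≥0) :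
    ∀ k ≤ numUpTo c t, ∃ s ≤ t, numUpTo c s = k := by
  refine nnreal_induction (P := fun t => ∀ k ≤ numUpTo c t, ∃ s ≤ t, numUpTo c s = k) ?_ ?_ ?_ t
  · intro k hk
    have hu : upTo E 0 = univ ×ˢ {0} := by rw [upTo]; congr 1; ext s; simp
    have hz : numUpTo c 0 = 0 := by rw [numUpTo, hu, h0]; simp
    exact ⟨0, le_rfl, by omega⟩
  · intro b hb ih k hk
    obtain ⟨a, hab, hgap⟩ := exists_gap_left hc hb
    rcases eq_or_lt_of_le hk with rfl | hlt
    · exact ⟨b, le_rfl, rfl⟩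
    have hle : numUpTo c b ≤ numUpTo c a + 1 := by
      have := (hc a).isFiniteMeasure
      obtain ⟨n, hn⟩ := (hc a).exists_nat MeasurableSet.univ
      rw [numUpTo_eq, numUpTo_eq, restrict_upTo_eq_add, restrict_before_of_gap hgap hab le_rfl]
      rcases hc.jump_cases (h1 b) with hz | ⟨u, hu⟩
      · rw [hz, add_zero]; omega
      · rw [hu, Measure.add_apply, measure_univ (μ := Measure.dirac (u, b)), hn]
        have e : ((n : ℝ≥0∞) + 1).toReal = ((n + 1 : ℕ) : ℝ) := by
          rw [← ENNReal.toReal_natCast]; push_cast; rfl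
        rw [e, Nat.floor_natCast, ENNReal.toReal_natCast, Nat.floor_natCast]
    obtain ⟨s, hs, hsk⟩ := ih a hab k (by omega)
    exact ⟨s, hs.trans hab.le, hsk⟩
  · intro a ha
    obtain ⟨b, hab, hgap⟩ := exists_gap_right hc a
    filter_upwards [Ioo_mem_nhdsGT hab] with r hr k hk
    rw [numUpTo_of_gap hgap hr.1.le hr.2] at hk
    obtain ⟨s, hs, hsk⟩ := ha k hk
    exact ⟨s, hs.trans hr.1.le, hsk⟩

/-- Every value of the counting process up to time `t` is attained at one of countably many
times. -/
theorem LocCounting.exists_nnrat_numUpTo_eq (hc : LocCounting c) (h0 : c (univ ×ˢ {0}) = 0)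
    (h1 : ∀ t, c (univ ×ˢ {t}) ≤ 1) {t : ℝ≥0} {k : ℕ} (hk : k ≤ numUpTo c t) :
    ∃ r : ℚ≥0, numUpTo c (min (r : ℝ≥0) t) = k := by
  obtain ⟨s, hst, hs⟩ := hc.exists_numUpTo_eq h0 h1 t k hk
  obtain ⟨b, hsb, hgap⟩ := exists_gap_right hc s
  obtain ⟨r, hr1, hr2⟩ := exists_nnrat_between hsb
  refine ⟨r, ?_⟩
  rw [numUpTo_of_gap hgap (le_min hr1.le hst) ((min_le_left _ _).trans_lt hr2), hs]

theorem stateOf_congr [IsFiniteMeasure c] {q q' : Bool × (ℕ → Bool)} (h0 : q.1 = q'.1)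
    (h : ∀ k ≤ ⌊(c univ).toReal⌋₊, activeAfter q.1 q.2 k = activeAfter q'.1 q'.2 k) :
    stateOf q c = stateOf q' c := by
  rw [stateOf, stateOf, h0]
  congr 3
  funext y
  rw [markOf, markOf, h]
  rw [finPart_of_finite]
  exact Nat.floor_mono (ENNReal.toReal_mono (measure_ne_top _ _) (measure_mono (subset_univ _)))

/-- The coins themselves cannot be read off from `D` while no cluster is active. Taking the negation
of the next value as the coin still gives the same path: it is the true coin while a cluster is
active, and the coin is ignored otherwise. -/
theorem activeAfter_reconstruct (d : Bool) (I : ℕ → Bool) (v : ℕ → Bool) (n : ℕ)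
    (hv : ∀ k ≤ n, v k = activeAfter d I k) :
    ∀ k ≤ n, activeAfter d (fun k => !v (k + 1)) k = activeAfter d I k := by
  intro k
  induction k with
  | zero => intro _; rfl
  | succ k ih =>
    intro hk
    have h1 := hv (k + 1) hk
    rw [activeAfter, ih (by omega), h1, Bool.not_not]
    rw [activeAfter]
    split_ifs <;> rfl

end AdaptedState

namespace Model

variable {E Ω : Type*} [MeasurableSpace E] [MeasurableSingletonClass E] {mΩ : MeasurableSpace Ω}
  {X : Model E Ω} {θ : Params E} {ℱ : Filtration ℝ≥0 mΩ} {Q : Measure Ω}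

/-- The value of `D` after `k` cluster events, read off from the values up to time `t`. -/
def valueAfter (X : Model E Ω) (t : ℝ≥0) (k : ℕ) (ω : Ω) : Bool :=
  open Classical in
  decide (∃ r : ℚ≥0, X.count (min (r : ℝ≥0) t) ω = k ∧ X.D (min (r : ℝ≥0) t) ω = true)

namespace IsReference

theorem adapted_obsUpTo (hX : X.IsReference θ ℱ Q) (t : ℝ≥0) : Measurable[ℱ t] (X.obsUpTo t) := by
  have h : X.obsUpTo t = fun ω => (X.N ω).restrict (upTo E t) + (X.C ω).restrict (upTo E t) := by
    funext ω
    rw [obsUpTo, O, Measure.restrict_add]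
  rw [h]
  exact (hX.adapted_N t).add (hX.adapted_C t)

theorem obs_le_filtration (hX : X.IsReference θ ℱ Q) (t : ℝ≥0) : X.obs t ≤ ℱ t :=
  (hX.adapted_obsUpTo t).comap_le

theorem adapted_count (hX : X.IsReference θ ℱ Q) (t : ℝ≥0) : Measurable[ℱ t] (X.count t) := by
  have h : X.count t = fun ω => ⌊((X.C ω).restrict (upTo E t) univ).toReal⌋₊ := by
    funext ω
    rw [count, Measure.restrict_apply_univ]
  rw [h]
  exact Nat.measurable_floor.comp
    ((Measure.measurable_coe MeasurableSet.univ).comp (hX.adapted_C t)).ennreal_toReal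

theorem adapted_valueAfter (hX : X.IsReference θ ℱ Q) (t : ℝ≥0) (k : ℕ) :
    Measurable[ℱ t] (X.valueAfter t k) := by
  refine @measurable_to_bool _ (ℱ t) _ ?_
  have h : X.valueAfter t k ⁻¹' {true} =
      ⋃ r : ℚ≥0, X.count (min (r : ℝ≥0) t) ⁻¹' {k} ∩ X.D (min (r : ℝ≥0) t) ⁻¹' {true} := by
    ext ω
    simp [valueAfter]
  rw [h]
  refine @MeasurableSet.iUnion _ _ (ℱ t) _ _ fun r => @MeasurableSet.inter _ (ℱ t) _ _ ?_ ?_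
  · exact ℱ.mono (min_le_right _ _) _ (hX.adapted_count _ (measurableSet_singleton k))
  · exact ℱ.mono (min_le_right _ _) _ (hX.adapted_D _ (measurableSet_singleton true))

/-- Up to a null set, the state is adapted to the filtration. -/
theorem exists_adapted_state [IsProbabilityMeasure Q] (hX : X.IsReference θ ℱ Q)
    (hθ : θ.Admissible) (t : ℝ≥0) :
    ∃ S : Ω → State E, Measurable[ℱ t] S ∧ ∃ A, MeasurableSet[ℱ t] A ∧ Q Aᶜ = 0 ∧
      ∀ ω ∈ A, X.state t ω = S ω := by
  -- Adaptedness is assumed for `D` and not for the coins, so the coins are replaced by those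
  -- reconstructed from `D`. The replacement is correct where there are no simultaneous points and
  -- no point at time zero.
  have hq : Measurable[ℱ t] fun ω => (X.D 0 ω, fun k => !X.valueAfter t (k + 1) ω) := by
    refine Measurable.prodMk ((hX.adapted_D 0).mono (ℱ.mono zero_le) le_rfl) ?_
    exact @measurable_pi_lambda _ _ _ (ℱ t) _ _ fun k =>
      (measurable_of_countable fun b : Bool => !b).comp (hX.adapted_valueAfter t (k + 1))
  refine ⟨fun ω => stateOf (X.D 0 ω, fun k => !X.valueAfter t (k + 1) ω)
    ((X.C ω).restrict (upTo E t)), @measurable_stateOf_comp _ _ _ (ℱ t) _ _ hq (hX.adapted_C t),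
    {ω | SimpleTimes (X.obsUpTo t ω)}, hX.adapted_obsUpTo t measurableSet_simpleTimes,
    hX.ae_simpleTimes hθ t, fun ω hω => ?_⟩
  set c := (X.C ω).restrict (upTo E t) with hcdef
  have hc : LocCounting c := fun s => by
    rw [hcdef, Measure.restrict_restrict (measurableSet_upTo s)]
    exact (hX.locCounting_C ω).restrict ((measurableSet_upTo s).inter (measurableSet_upTo t))
      inter_subset_right
  have hfin := (hX.isCounting_C t ω).isFiniteMeasure
  have hle : ∀ S, c S ≤ X.obsUpTo t ω S := fun S => by
    rw [obsUpTo, O, Measure.restrict_add, Measure.add_apply]; exact le_add_self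
  have h0 : c (univ ×ˢ {0}) = 0 := le_antisymm ((hle _).trans hω.1.le) zero_le
  have h1 : ∀ s, c (univ ×ˢ {s}) ≤ 1 := fun s =>
    (hle _).trans (hω.le_one (hX.isCounting_obsUpTo t ω) s)
  have hcount : ∀ s ≤ t, X.count s ω = numUpTo c s := fun s hs => by
    have hsub : upTo E s ⊆ upTo E t := fun y hy => ⟨hy.1, (mem_Iic.1 hy.2).trans hs⟩
    rw [count, numUpTo, hcdef, Measure.restrict_apply (measurableSet_upTo s), inter_eq_left.2 hsub]
  have hu : upTo E 0 = univ ×ˢ {0} := by rw [upTo]; congr 1; ext s; simp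
  have hD0 : X.D 0 ω = X.D₀ ω := by
    rw [D, hcount 0 zero_le, numUpTo, hu, h0]
    simp [activeAfter]
  have huniv : ⌊(c univ).toReal⌋₊ = numUpTo c t := by
    rw [numUpTo_eq, hcdef, Measure.restrict_restrict (measurableSet_upTo t), inter_self]
  rw [hX.state_eq, ← hcdef]
  refine stateOf_congr hD0.symm fun k hk => ?_
  rw [huniv] at hk
  have hv : ∀ k ≤ numUpTo c t, X.valueAfter t k ω = activeAfter (X.D₀ ω) (fun k => X.I k ω) k := by
    intro k hk
    obtain ⟨r, hr⟩ := hc.exists_nnrat_numUpTo_eq h0 h1 hk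
    have hD : ∀ r : ℚ≥0, X.count (min (r : ℝ≥0) t) ω = k →
        X.D (min (r : ℝ≥0) t) ω = activeAfter (X.D₀ ω) (fun k => X.I k ω) k := fun r hr => by
      rw [D, hr]
    rw [← hcount _ (min_le_right _ _)] at hr
    rw [Bool.eq_iff_iff]
    simp only [valueAfter, decide_eq_true_iff]
    constructor
    · rintro ⟨r', h1, h2⟩
      rw [← hD r' h1, h2]
    · intro h
      exact ⟨r, hr, by rw [hD r hr, h]⟩
  have := activeAfter_reconstruct (X.D₀ ω) (fun k => X.I k ω) (fun k => X.valueAfter t k ω) _ hv k hk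
  show activeAfter (X.D₀ ω) (fun k => X.I k ω) k = activeAfter (X.D 0 ω) _ k
  rw [hD0, ← this]

end IsReference

end Model

/-! ### The normalized filter under `P` -/

theorem measurable_integral_measure {α : Type*} [MeasurableSpace α] {f : α → ℝ}
    (hf : Measurable f) : Measurable fun m : Measure α => ∫ x, f x ∂m := by
  classical
  have h : (fun m : Measure α => ∫ x, f x ∂m) = fun m => if ∫⁻ x, ‖f x‖ₑ ∂m < ∞ then
      (∫⁻ x, ENNReal.ofReal (f x) ∂m).toReal - (∫⁻ x, ENNReal.ofReal (-f x) ∂m).toReal else 0 := by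
    funext m
    split_ifs with h
    · exact integral_eq_lintegral_pos_part_sub_lintegral_neg_part ⟨hf.aestronglyMeasurable, h⟩
    · exact integral_undef fun hi => h hi.2
  rw [h]
  refine Measurable.ite (Measure.measurable_lintegral hf.enorm measurableSet_Iio) ?_
    measurable_const
  exact (Measure.measurable_lintegral hf.ennreal_ofReal).ennreal_toReal.sub
    (Measure.measurable_lintegral hf.neg.ennreal_ofReal).ennreal_toReal

namespace Model

variable {E Ω : Type*} [MeasurableSpace E] {mΩ : MeasurableSpace Ω}
  {X : Model E Ω} {θ : Params E} {ℱ : Filtration ℝ≥0 mΩ} {Q P : Measure Ω}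
  {L : ℝ≥0 → Ω → ℝ} {φ : ℝ≥0 → Ω → Measure (State E)}

theorem IsUnnormalizedFilter.measurable_unnorm (hφ : X.IsUnnormalizedFilter Q L φ)
    {f : State E → ℝ} (hf : Measurable f) (t : ℝ≥0) :
    Measurable[X.obs t] fun ω => unnorm φ ω f t :=
  (measurable_integral_measure hf).comp (hφ.adapted t)

theorem unnorm_one_nonneg (φ : ℝ≥0 → Ω → Measure (State E)) (ω : Ω) (t : ℝ≥0) :
    0 ≤ unnorm φ ω (fun _ => 1) t :=
  integral_nonneg fun _ => zero_le_one

theorem IsUnnormalizedFilter.norml_mul (hφ : X.IsUnnormalizedFilter Q L φ) (ω : Ω)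
    (f : State E → ℝ) (t : ℝ≥0) :
    norml φ ω f t * unnorm φ ω (fun _ => 1) t = unnorm φ ω f t := by
  -- With zero total mass the measure itself is zero, so the identity survives division by zero.
  by_cases h : unnorm φ ω (fun _ => 1) t = 0
  · have := hφ.finite t ω
    have h0 : φ t ω = 0 := by
      rw [unnorm, integral_const, smul_eq_mul, mul_one] at h
      exact Measure.measure_univ_eq_zero.1 ((measureReal_eq_zero_iff).1 h)
    rw [h, mul_zero, unnorm, h0, integral_zero_measure]
  · exact div_mul_cancel₀ _ h

namespace IsReference

variable [IsProbabilityMeasure Q] [StandardBorelSpace E]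

theorem ae_nonneg_likelihood (hX : X.IsReference θ ℱ Q) (hθ : θ.Admissible)
    (hL : X.IsLikelihood θ ℱ Q L) (t : ℝ≥0) : ∀ᵐ ω ∂Q, 0 ≤ L t ω := by
  filter_upwards [hX.ae_likelihood_eq hθ hL] with ω hω
  rw [(hω t).1]
  exact hθ.weight_nonneg t _

/-- On the observed events the density is the total mass of the filter. -/
theorem density_obs (hX : X.IsReference θ ℱ Q) (hθ : θ.Admissible)
    (hL : X.IsLikelihood θ ℱ Q L) (hφ : X.IsUnnormalizedFilter Q L φ) (hP : HasDensity ℱ Q P L)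
    (t : ℝ≥0) {A : Set Ω} (hA : MeasurableSet[X.obs t] A) :
    P A = ∫⁻ ω in A, ENNReal.ofReal (unnorm φ ω (fun _ => 1) t) ∂Q := by
  have hLi := hL.martingale.integrable t
  have hone : Integrable (fun ω => (fun _ : State E => (1 : ℝ)) (X.state t ω) * L t ω) Q := by
    simpa only [one_mul] using hLi
  have hc : (fun ω => unnorm φ ω (fun _ => 1) t) =ᵐ[Q] Q[L t | X.obs t] := by
    have h := hφ.condExp t (fun _ => 1) measurable_const hone
    simp only [one_mul] at h
    exact h
  have hu : Integrable (fun ω => unnorm φ ω (fun _ => 1) t) Q := integrable_condExp.congr hc.symm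
  rw [hP.density t A (hX.obs_le_filtration t A hA),
    ← ofReal_integral_eq_lintegral_ofReal hLi.integrableOn
      (ae_restrict_of_ae (hX.ae_nonneg_likelihood hθ hL t)),
    ← ofReal_integral_eq_lintegral_ofReal hu.integrableOn
      (Eventually.of_forall fun ω => unnorm_one_nonneg φ ω t),
    ← setIntegral_condExp (hX.obs_le t) hLi hA]
  congr 1
  exact (integral_congr_ae (ae_restrict_of_ae hc)).symm

/-- On the event where the mass is not positive its density under `P` vanishes. -/
theorem ae_unnorm_pos (hX : X.IsReference θ ℱ Q) (hθ : θ.Admissible)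
    (hL : X.IsLikelihood θ ℱ Q L) (hφ : X.IsUnnormalizedFilter Q L φ) (hP : HasDensity ℱ Q P L)
    (t : ℝ≥0) : ∀ᵐ ω ∂P, 0 < unnorm φ ω (fun _ => 1) t := by
  have hA : MeasurableSet[X.obs t] {ω | unnorm φ ω (fun _ => 1) t ≤ 0} :=
    hφ.measurable_unnorm measurable_const t measurableSet_Iic
  have h0 : P {ω | unnorm φ ω (fun _ => 1) t ≤ 0} = 0 := by
    rw [hX.density_obs hθ hL hφ hP t hA]
    refine (setLIntegral_congr_fun (hX.obs_le t _ hA) fun ω hω => ?_).trans lintegral_zero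
    exact ENNReal.ofReal_of_nonpos hω
  have hsub : {ω | ¬ 0 < unnorm φ ω (fun _ => 1) t} ⊆ {ω | unnorm φ ω (fun _ => 1) t ≤ 0} :=
    fun ω hω => not_lt.1 hω
  exact measure_mono_null hsub h0

/-- The normalized filter is the conditional expectation under the probability with density `L`. -/
theorem norml_ae_eq_condExp (hX : X.IsReference θ ℱ Q) (hθ : θ.Admissible)
    (hL : X.IsLikelihood θ ℱ Q L) (hφ : X.IsUnnormalizedFilter Q L φ) (hP : HasDensity ℱ Q P L)
    (t : ℝ≥0) {f : State E → ℝ} (hf : Measurable f)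
    (hint : Integrable (fun ω => f (X.state t ω)) P) :
    (fun ω => norml φ ω f t) =ᵐ[P] P[fun ω => f (X.state t ω) | X.obs t] := by
  have := hP.isProbabilityMeasure
  obtain ⟨S, hS, A, hA, hA0, hSA⟩ := hX.exists_adapted_state hθ t
  have hPA : P Aᶜ = 0 := by
    rw [hP.density t Aᶜ hA.compl, Measure.restrict_eq_zero.2 hA0, lintegral_zero_measure]
  have hZQ : (fun ω => f (X.state t ω)) =ᵐ[Q] fun ω => f (S ω) := by
    filter_upwards [compl_mem_ae_iff.2 hA0] with ω hω
    rw [hSA ω (by simpa using hω)]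
  have hZP : (fun ω => f (X.state t ω)) =ᵐ[P] fun ω => f (S ω) := by
    filter_upwards [compl_mem_ae_iff.2 hPA] with ω hω
    rw [hSA ω (by simpa using hω)]
  have hZ : StronglyMeasurable[ℱ t] fun ω => f (S ω) := (hf.comp hS).stronglyMeasurable
  have hLi := hL.martingale.integrable t
  -- The density `L` is available on `ℱ t` only, which is why the state is replaced by its adapted
  -- version `S`.
  obtain ⟨h1, h2⟩ := integrable_of_density (ℱ.le t) hLi.aemeasurable
    (hX.ae_nonneg_likelihood hθ hL t) (hP.density t) hZ
  have hZL : (fun ω => f (X.state t ω) * L t ω) =ᵐ[Q] fun ω => f (S ω) * L t ω := by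
    filter_upwards [hZQ] with ω hω
    rw [hω]
  have hfL : Integrable (fun ω => f (X.state t ω) * L t ω) Q :=
    (h1.1 (hint.congr hZP)).congr hZL.symm
  have hc := hφ.condExp t f hf hfL
  have hum : ∀ g : State E → ℝ, Measurable g → Measurable fun ω => unnorm φ ω g t :=
    fun g hg => (hφ.measurable_unnorm hg t).mono (hX.obs_le t) le_rfl
  have hZ' : StronglyMeasurable[X.obs t] fun ω => norml φ ω f t :=
    ((hφ.measurable_unnorm hf t).div (hφ.measurable_unnorm measurable_const t)).stronglyMeasurable
  -- On observed events the density is the total mass, and `π(f,t)` times the total mass is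
  -- `φ(f,t)`: this is Bayes' formula.
  obtain ⟨h3, h4⟩ := integrable_of_density (hX.obs_le t)
    (hum _ measurable_const).aemeasurable (Eventually.of_forall fun ω => unnorm_one_nonneg φ ω t)
    (fun A hA => hX.density_obs hθ hL hφ hP t hA) hZ'
  simp only [hφ.norml_mul] at h3 h4
  have hui : Integrable (fun ω => unnorm φ ω f t) Q := integrable_condExp.congr hc.symm
  have hni : Integrable (fun ω => norml φ ω f t) P := h3.2 hui
  refine ae_eq_condExp_of_forall_setIntegral_eq (hX.obs_le t) hint
    (fun _ _ _ => hni.integrableOn) (fun B hB _ => ?_) hZ'.aestronglyMeasurable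
  rw [h4 B hB]
  calc ∫ ω in B, unnorm φ ω f t ∂Q
      = ∫ ω in B, (Q[fun ω => f (X.state t ω) * L t ω | X.obs t]) ω ∂Q :=
        integral_congr_ae (ae_restrict_of_ae hc)
    _ = ∫ ω in B, f (X.state t ω) * L t ω ∂Q := setIntegral_condExp (hX.obs_le t) hfL hB
    _ = ∫ ω in B, f (S ω) * L t ω ∂Q := integral_congr_ae (ae_restrict_of_ae hZL)
    _ = ∫ ω in B, f (S ω) ∂P := (h2 B (hX.obs_le_filtration t B hB)).symm
    _ = ∫ ω in B, f (X.state t ω) ∂P := (integral_congr_ae (ae_restrict_of_ae hZP)).symm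

end IsReference

end Model

end ClusterFilter

end

open ClusterFilter in
theorem theorem2p4 {E Ω : Type*} [MeasurableSpace E] [StandardBorelSpace E]
    {mΩ : MeasurableSpace Ω} (Q : Measure Ω) [IsProbabilityMeasure Q] (ℱ : Filtration ℝ≥0 mΩ)
    (θ : Params E) (hθ : θ.Admissible) (X : Model E Ω) (hX : X.IsReference θ ℱ Q)
    (L : ℝ≥0 → Ω → ℝ) (hL : X.IsLikelihood θ ℱ Q L) :
    -- the filter exists
    (∃ φ, X.IsUnnormalizedFilter Q L φ) ∧
    ∀ φ, X.IsUnnormalizedFilter Q L φ →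
      -- `φ(f, t)` is well defined for every `f` and satisfies the Zakai equation
      (∀ᵐ ω ∂Q, ∀ f : State E → ℝ, Measurable f →
        (∀ t, Integrable f (φ t ω)) ∧ IsCadlag (unnorm φ ω f) ∧ ∀ t, ZakaiAt θ X φ ω f t) ∧
      -- the Kushner–Stratonovich equation under `Q`, as long as `φ(1, t)` is positive
      (∀ᵐ ω ∂Q, ∀ t, 0 < unnorm φ ω (fun _ => 1) t →
        ∀ f : State E → ℝ, Measurable f → KushnerStratonovichAt θ X φ ω f t) ∧
      -- the Kushner–Stratonovich equation under `P`, where `π(f, t) = E^P[f(h_t, η_t) | 𝓕ᴼ_t]`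
      ∀ P : Measure Ω, HasDensity ℱ Q P L →
        (∀ t (f : State E → ℝ), Measurable f → Integrable (fun ω => f (X.state t ω)) P →
          (fun ω => norml φ ω f t) =ᵐ[P] P[fun ω => f (X.state t ω) | X.obs t]) ∧
        (∀ᵐ ω ∂P, (∀ t, 0 < unnorm φ ω (fun _ => 1) t) ∧
          ∀ f : State E → ℝ, Measurable f →
            IsCadlag (norml φ ω f) ∧ ∀ t, KushnerStratonovichAt θ X φ ω f t) := by
  have := hX.isProbabilityMeasure_initLaw
  have hρ := hX.isAtomic_initLaw
  refine ⟨⟨_, hX.isUnnormalizedFilter hθ hL⟩, fun φ hφ => ⟨?_, ?_, fun P hP => ⟨?_, ?_⟩⟩⟩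
  · filter_upwards [hX.ae_regularPath hθ hL hφ fun _ _ _ h => h] with ω ⟨hm, h⟩ f hf
    exact ⟨hm.integrable_filter hθ hρ h hf, hm.isCadlag_unnorm hθ hρ h hf,
      hm.zakaiAt hθ hρ h hf⟩
  · filter_upwards [hX.ae_regularPath hθ hL hφ fun _ _ _ h => h] with ω ⟨hm, h⟩ t ht f hf
    exact hm.kushnerStratonovichAt hθ hρ h hf ht
  · exact fun t f hf hint => hX.norml_ae_eq_condExp hθ hL hφ hP t hf hint
  -- Observed `Q`-null events are `P`-null because `P` has a density on each `ℱ_T`.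
  · have hnull : ∀ T A, MeasurableSet[X.obs T] A → Q A = 0 → P A = 0 := fun T A hA h0 => by
      rw [hP.density T A (hX.obs_le_filtration T A hA), Measure.restrict_eq_zero.2 h0,
        lintegral_zero_measure]
    -- Positivity at integer times suffices, since vanishing mass never recovers.
    filter_upwards [hX.ae_regularPath hθ hL hφ hnull,
      ae_all_iff.2 fun n : ℕ => hX.ae_unnorm_pos hθ hL hφ hP n] with ω ⟨hm, h⟩ hn
    have hpos := hm.unnorm_pos hθ hρ h hn
    exact ⟨hpos, fun f hf => ⟨hm.isCadlag_norml hθ hρ h hf hpos,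
      fun t => hm.kushnerStratonovichAt hθ hρ h hf (hpos t)⟩⟩
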